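/- Let $k$ be an algebraically closed field, and let $f=\sum c_\eta x^{\eta_1}y^{\eta_2}\in k[[x,y]]$ (for instance a polynomial) be a reduced (squarefree) power series of order at least $2$, so that $\mathcal C=\{f=0\}$ is singular at the origin. *Newton polygon.* Write $\mathrm{supp}(g)=\{\eta\in\mathbf Z_{\ge0}^2: c_\eta\neq0\}$ for a nonzero $g=\sum c_\eta x^{\eta_1}y^{\eta_2}$ and $\nu_\omega(g)=\min\{\omega\cdot\eta:\eta\in\mathrm{supp}(g)\}$ for $\omega\in\mathbf R_{\ge0}^2$. The Newton polygon of $g$ consists of the compact faces (vertices and segments) of the convex hull of $\mathrm{supp}(g)+\mathbf R_{\ge0}^2$. The tropical variety $T(g)$ is the set of all $\omega\in\mathbf R_{\ge0}^2$ for which $v\mapsto\omega\cdot v$ is constant, with value $\nu_\omega(g)$, on some compact segment of the Newton polygon. Assume that $f$ is Newton non-degenerate: for every compact face $\Phi$ of its Newton polygon, with $f_\Phi=\sum_{\eta\in\Phi}c_\eta x^{\eta_1}y^{\eta_2}$, the system $f_\Phi=\partial f_\Phi/\partial x=\partial f_\Phi/\partial y=0$ has no solution in $(k^\times)^2$. Let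 $f=f_1\cdots f_t$ in $k[[x,y]]$ be a tropical decomposition, i.e. each $T(f_i)$ is a half-line starting at the origin and $T(f_i)\cap T(f_j)=\{0\}$ for $i\ne j$, and let $f_i=\prod_{j=1}^{r_i}f_{ij}$ with $f_{ij}$ irreducible in $k[[x,y]]$. *Jets.* Let $m\ge0$, let $\mathbf A^2_m$ be the affine space with coordinates $x^{(0)},\dots,x^{(m)},y^{(0)},\dots,y^{(m)}$ and the Zariski topology, and for $g\in k[[x,y]]$ let $g^{(n)}$ be the coefficient of $t^n$ in $g\big(\sum_{i=1}^m x^{(i)}t^i,\sum_{i=1}^m y^{(i)}t^i\big)$ (only jets with $x^{(0)}=y^{(0)}=0$ are considered). The jet scheme of $\mathcal C$ over the origin is $$\mathcal C^0_m=\{x^{(0)}=y^{(0)}=f^{(0)}=\dots=f^{(m)}=0\}\subset\mathbf A^2_m .$$ Let $\mathbf N$ be the set of positive integers. For $\alpha\in\mathbf N^2$ put $\mathcal H^\alpha_m=\{x^{(i)}=0\ (i<\alpha_1),\ y^{(j)}=0\ (j<\alpha_2)\}\subset\mathbf A^2_m$, and $$\mathbf A^2_m\cap F^\alpha_{(i,j),l}=\mathcal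 H^\alpha_m\cap\{x^{(\alpha_1)}\ne0\}\cap\{y^{(\alpha_2)}\neq0\}\cap\{f_{ij}^{(0)}=\dots=f_{ij}^{(l)}=0\},$$ where $x^{(n)}=y^{(n)}=0$ on $\mathbf A^2_m$ for $n>m$. Put $A_m(i)=\{\alpha\in T(f_i)\cap\mathbf N^2:\nu_\alpha(f)\le m\}$, and let $B_m$ be the set of minimal elements, for the componentwise order, of $\{\gamma\in\mathbf N^2:\nu_\gamma(f)>m\}$. Let $\sigma$ be the convex hull of $T(f)$ and $\partial\sigma$ its boundary in $\mathbf R^2$. Let $B_m^*$ be obtained from $B_m$ by removing all $\alpha+(1,1)$ with $\alpha\in B_{m-1}\cap\partial\sigma$ and $\nu_\alpha(f)=m$ (so $B^*_0=B_0$). **Theorem.** For every $m\ge0$, $$\mathcal C^0_m=\bigcup_{\gamma\in B^*_m}\mathcal H^\gamma_m\ \cup\ \bigcup_{i=1}^t\ \bigcup_{\alpha\in A_m(i)}\ \bigcup_{j=1}^{r_i}\overline{\mathbf A^2_m\cap F^\alpha_{(i,j),k_{ij}}},\qquad k_{ij}=\nu_\alpha(f_{ij})+m-\nu_\alpha(f).$$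 This is the decomposition into irreducible components: the sets $\mathcal H^\gamma_m$ with $\gamma\in B^*_m$, together with the closures $\overline{\mathbf A^2_m\cap F^\alpha_{(i,j),k_{ij}}}$ with $1\le i\le t$, $\alpha\in A_m(i)$, $1\le j\le r_i$ and $f_{ij}$ divisible neither by $x$ nor by $y$, are pairwise distinct, and they are exactly the irreducible components of $\mathcal C^0_m$. -/

import Mathlib

/-!
Conventions.  `k` is a field, `k[[x, y]]` is `MvPowerSeries (Fin 2) k` with `x = X 0`, `y = X 1`.
Exponents are `η : Fin 2 →₀ ℕ`, integral weights are `α : Fin 2 → ℕ`, and the real plane (of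
exponents as well as of weights) is `Fin 2 → ℝ`.
-/

namespace NewtonJets

noncomputable section

variable {k : Type*} [Field k]

/-! ### Newton polygons, tropical varieties, non-degeneracy -/

/-- An exponent seen as a point of the real plane. -/
def toPlane (η : Fin 2 →₀ ℕ) : Fin 2 → ℝ := fun v => (η v : ℝ)

/-- An integral weight seen as a point of the real plane. -/
def castPlane (α : Fin 2 → ℕ) : Fin 2 → ℝ := fun v => (α v : ℝ)

/-- The support of a power series: the exponents with a nonzero coefficient. -/
def supp (f : MvPowerSeries (Fin 2) k) : Set (Fin 2 →₀ ℕ) :=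
  {η | MvPowerSeries.coeff η f ≠ 0}

/-- The Newton polyhedron `Γ⁺(f)`: the convex hull of the quadrants `η + ℝ²_{≥0}`, `η ∈ supp f`. -/
def newtonPolyhedron (f : MvPowerSeries (Fin 2) k) : Set (Fin 2 → ℝ) :=
  convexHull ℝ {v | ∃ η ∈ supp f, toPlane η ≤ v}

/-- `ν_ω(f)`, the minimum of `ω · η` over `η ∈ supp f`, for a real weight `ω ≥ 0`. -/
def realNu (ω : Fin 2 → ℝ) (f : MvPowerSeries (Fin 2) k) : ℝ :=
  sInf ((fun η => ω ⬝ᵥ toPlane η) '' supp f)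

/-- The line (all of the plane for `ω = 0`) `H_ω(f) = {v : ω · v = ν_ω(f)}`, which supports
`Γ⁺(f)`. -/
def supportLine (ω : Fin 2 → ℝ) (f : MvPowerSeries (Fin 2) k) : Set (Fin 2 → ℝ) :=
  {v | ω ⬝ᵥ v = realNu ω f}

/-- The faces (vertices and segments) of the Newton polygon of `f`: the compact faces
`Γ⁺(f) ∩ H_ω(f)`, `ω ≥ 0`, of the Newton polyhedron. -/
def IsNewtonFace (f : MvPowerSeries (Fin 2) k) (Φ : Set (Fin 2 → ℝ)) : Prop :=
  IsCompact Φ ∧ ∃ ω : Fin 2 → ℝ, 0 ≤ ω ∧ Φ = newtonPolyhedron f ∩ supportLine ω f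

/-- The cone `C_Φ` of the dual Newton fan: all weights `ω ≥ 0` with `Φ ⊆ H_ω(f)`. -/
def dualCone (f : MvPowerSeries (Fin 2) k) (Φ : Set (Fin 2 → ℝ)) : Set (Fin 2 → ℝ) :=
  {ω | 0 ≤ ω ∧ Φ ⊆ supportLine ω f}

/-- The tropical variety `T(f)`: the union of the cones `C_Φ` over the (nondegenerate) compact
segments `Φ` of the Newton polygon of `f`. -/
def tropicalVariety (f : MvPowerSeries (Fin 2) k) : Set (Fin 2 → ℝ) :=
  {ω | ∃ Φ, IsNewtonFace f Φ ∧ Φ.Nontrivial ∧ ω ∈ dualCone f Φ}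

/-- A compact set contains only finitely many exponents. -/
theorem finite_exponents {Φ : Set (Fin 2 → ℝ)} (hΦ : IsCompact Φ) :
    {η : Fin 2 →₀ ℕ | toPlane η ∈ Φ}.Finite := by
  obtain ⟨C, hC⟩ := hΦ.isBounded.exists_norm_le
  refine (Set.finite_Iic (Finsupp.equivFunOnFinite.symm fun _ : Fin 2 => ⌈C⌉₊)).subset ?_
  intro η hη v
  have h1 : ‖toPlane η v‖ ≤ C := (norm_le_pi_norm (toPlane η) v).trans (hC _ hη)
  have h2 : ((η v : ℕ) : ℝ) ≤ (⌈C⌉₊ : ℝ) := by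
    have h3 : ((η v : ℕ) : ℝ) ≤ C := by simpa [toPlane] using h1
    exact h3.trans (Nat.le_ceil C)
  simpa using (by exact_mod_cast h2 : η v ≤ ⌈C⌉₊)

/-- The part `f_Φ` of `f` supported on `Φ`. It is a finite sum when `Φ` is compact, by
`finite_exponents`. -/
def facePart (f : MvPowerSeries (Fin 2) k) (Φ : Set (Fin 2 → ℝ)) : MvPolynomial (Fin 2) k :=
  ∑ᶠ η ∈ {η : Fin 2 →₀ ℕ | toPlane η ∈ Φ}, MvPolynomial.monomial η (MvPowerSeries.coeff η f)

/-- `f` is Newton non-degenerate: it is reduced and, for every face `Φ` of its Newton polygon,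
`f_Φ = ∂f_Φ/∂x = ∂f_Φ/∂y = 0` has no solution in the torus `(kˣ)²`. -/
def IsNewtonNondegenerate (f : MvPowerSeries (Fin 2) k) : Prop :=
  Squarefree f ∧ ∀ Φ, IsNewtonFace f Φ → ∀ p : Fin 2 → k, (∀ v, p v ≠ 0) →
    ¬ (MvPolynomial.eval p (facePart f Φ) = 0 ∧
      ∀ v, MvPolynomial.eval p (MvPolynomial.pderiv v (facePart f Φ)) = 0)

/-- A closed half-line of the plane that starts at the origin. -/
def IsSemiLine (L : Set (Fin 2 → ℝ)) : Prop :=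
  ∃ w : Fin 2 → ℝ, w ≠ 0 ∧ L = {u | ∃ s : ℝ, 0 ≤ s ∧ u = s • w}

/-- A tropical decomposition `f = f₁ ⋯ f_t`: every `T(f_i)` is a semi-line from the origin, and
`T(f_i) ∩ T(f_j) = {(0, 0)}` for `i ≠ j`. -/
def IsTropicalDecomposition (f : MvPowerSeries (Fin 2) k) {t : ℕ}
    (F : Fin t → MvPowerSeries (Fin 2) k) : Prop :=
  f = ∏ i, F i ∧ (∀ i, IsSemiLine (tropicalVariety (F i))) ∧
    ∀ i j, i ≠ j → tropicalVariety (F i) ∩ tropicalVariety (F j) = {0}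

/-- `ν_α(f) ∈ ℕ`, the minimum of `α · η` over `η ∈ supp f`, for an integral weight `α`
(and `f ≠ 0`). -/
def nu (α : Fin 2 → ℕ) (f : MvPowerSeries (Fin 2) k) : ℕ :=
  (f.weightedOrder α).toNat

/-- `A_m(i)` for a factor `fi = f_i` of `f`: the integral vectors `α ∈ T(f_i)` with positive
coordinates and `ν_α(f) ≤ m`. -/
def setA (f fi : MvPowerSeries (Fin 2) k) (m : ℕ) : Set (Fin 2 → ℕ) :=
  {α | (∀ v, 1 ≤ α v) ∧ castPlane α ∈ tropicalVariety fi ∧ nu α f ≤ m}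

/-- `B_m`: the integral vectors `γ` with positive coordinates and `ν_γ(f) > m` that are minimal
for the componentwise order. -/
def setB (f : MvPowerSeries (Fin 2) k) (m : ℕ) : Set (Fin 2 → ℕ) :=
  {γ | Minimal (fun γ : Fin 2 → ℕ => (∀ v, 1 ≤ γ v) ∧ m < nu γ f) γ}

/-- `B*_m`: remove from `B_m` every `α + (1, 1)` such that `m = ν_α(f)` and
`α ∈ B_{m-1} ∩ ∂σ`, where `σ` is the convex hull of `T(f)` and `∂σ` its boundary in the plane
(nothing is removed for `m = 0`). -/
def setBstar (f : MvPowerSeries (Fin 2) k) (m : ℕ) : Set (Fin 2 → ℕ) :=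
  {γ | γ ∈ setB f m ∧ ¬ ∃ (n : ℕ) (α : Fin 2 → ℕ), m = n + 1 ∧ m = nu α f ∧ α ∈ setB f n ∧
    castPlane α ∈ frontier (convexHull ℝ (tropicalVariety f)) ∧ γ = α + 1}

/-! ### Jet spaces -/

/-- The coordinate ring `k[x^{(0)}, …, x^{(m)}, y^{(0)}, …, y^{(m)}]` of the space of `m`-jets of
the plane. -/
abbrev JetRing (k : Type*) [Field k] (m : ℕ) : Type _ := MvPolynomial (Fin 2 × Fin (m + 1)) k

/-- The space `𝐀²_m` of `m`-jets of the plane, with its Zariski topology. -/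
abbrev JetSpace (k : Type*) [Field k] (m : ℕ) : Type _ := PrimeSpectrum (JetRing k m)

variable (k) in
/-- The coordinate functions on `𝐀²_m`: `jetVar k m 0 n = x^{(n)}` and `jetVar k m 1 n = y^{(n)}`,
which vanish on `𝐀²_m` for `n > m`. -/
def jetVar (m : ℕ) (v : Fin 2) (n : ℕ) : JetRing k m :=
  if h : n < m + 1 then MvPolynomial.X (v, ⟨n, h⟩) else 0

variable (k) in
/-- The universal `m`-jets over the origin, `x(t) = ∑_{n=1}^m x^{(n)} t^n` and
`y(t) = ∑_{n=1}^m y^{(n)} t^n`. The constant terms `x^{(0)}`, `y^{(0)}` are left out since all sets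
below lie in the locus `x^{(0)} = y^{(0)} = 0`. -/
def jetSeries (m : ℕ) (v : Fin 2) : PowerSeries (JetRing k m) :=
  PowerSeries.mk fun n => if n = 0 then 0 else jetVar k m v n

theorem hasSubst_jetSeries (m : ℕ) :
    MvPowerSeries.HasSubst (S := JetRing k m) (jetSeries k m) := by
  refine MvPowerSeries.hasSubst_of_constantCoeff_zero fun v => ?_
  have h : PowerSeries.constantCoeff (jetSeries k m v) = 0 := by
    rw [← PowerSeries.coeff_zero_eq_constantCoeff_apply]
    simp [jetSeries]
  exact h

/-- `f^{(n)}`, the coefficient of `t^n` in `f(x(t), y(t))` (restricted to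
`x^{(0)} = y^{(0)} = 0`). -/
def jetCoeff (f : MvPowerSeries (Fin 2) k) (m n : ℕ) : JetRing k m :=
  PowerSeries.coeff n (MvPowerSeries.subst (jetSeries k m) f : PowerSeries (JetRing k m))

/-- For a polynomial `f`, the element `f^{(n)}` is the coefficient of `t^n` of the usual value of
`f` at `(x(t), y(t))`. -/
theorem jetCoeff_coe (p : MvPolynomial (Fin 2) k) (m n : ℕ) :
    jetCoeff (p : MvPowerSeries (Fin 2) k) m n =
      PowerSeries.coeff n (MvPolynomial.aeval (jetSeries k m) p) := by
  rw [jetCoeff, MvPowerSeries.subst_coe]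

/-- The closed set `𝓗^α_m ⊆ 𝐀²_m` given by `x^{(i)} = 0` for `i < α₁` and `y^{(j)} = 0` for
`j < α₂`. -/
def setH (k : Type*) [Field k] (m : ℕ) (α : Fin 2 → ℕ) : Set (JetSpace k m) :=
  PrimeSpectrum.zeroLocus {a | ∃ v n, n < α v ∧ a = jetVar k m v n}

/-- `𝒞⁰_m`, the `m`-jet scheme of `{f = 0}` over the origin, as a closed subset of `𝐀²_m`:
`x^{(0)} = y^{(0)} = f^{(0)} = ⋯ = f^{(m)} = 0`. -/
def jetFibre (f : MvPowerSeries (Fin 2) k) (m : ℕ) : Set (JetSpace k m) :=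
  PrimeSpectrum.zeroLocus
    ({a | ∃ v, a = jetVar k m v 0} ∪ {a | ∃ n, n ≤ m ∧ a = jetCoeff f m n})

/-- The locally closed set `𝐀²_m ∩ G^α_l` of a power series `g` (for `α ≥ (1, 1)`): the jets in
`𝓗^α_m` with `x^{(α₁)} ≠ 0`, `y^{(α₂)} ≠ 0` and `g^{(0)} = ⋯ = g^{(l)} = 0`. -/
def setF (g : MvPowerSeries (Fin 2) k) (m : ℕ) (α : Fin 2 → ℕ) (l : ℕ) : Set (JetSpace k m) :=
  setH k m α ∩ PrimeSpectrum.zeroLocus {a | ∃ n, n ≤ l ∧ a = jetCoeff g m n} ∩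
    {P | ∀ v, jetVar k m v (α v) ∉ P.asIdeal}

/-- The closure of `𝐀²_m ∩ G^α_l`, `l = ν_α(g) + m - ν_α(f)`, for a factor `g` of `f` and
`m ≥ ν_α(f)`. -/
def infiniteComponent (f g : MvPowerSeries (Fin 2) k) (m : ℕ) (α : Fin 2 → ℕ) :
    Set (JetSpace k m) :=
  closure (setF g m α (nu α g + m - nu α f))

/-- The irreducible components of a subspace `C`, as subsets of the ambient space. -/
def componentsOf {Y : Type*} [TopologicalSpace Y] (C : Set Y) : Set (Set Y) :=
  (fun Z : Set C => Subtype.val '' Z) '' irreducibleComponents C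

end

end NewtonJets

namespace NewtonJets

noncomputable section

variable {k : Type*} [Field k]

/-! ### Weighted components and initial forms -/

/-! A point of the jet space over the origin is a jet over its residue field. With order vector `α`
it reads `(t^{α₀} X₀, t^{α₁} X₁)`, where `X₀(0)` and `X₁(0)` are nonzero, and `f` takes there the
value `t^{ν_α(f)}` times a series whose constant term is the initial form of `f` at `(X₀(0),
X₁(0))`. If `ν_α(f) > m`, the equations hold and the jet lies in some `𝓗^γ` with `γ ∈ B_m`.
Otherwise the initial form vanishes at a torus point. By non-degeneracy this zero is smooth, so it
belongs to exactly one irreducible factor `g`. The cofactor then has order exactly its `ν_α`, and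
the equations of `f` up to `m` become those of `g` up to `ν_α(g) + m - ν_α(f)`
(`exists_of_mem_jetFibre`).

A factorization in the style of Hensel shows that such a `g` has initial form `c ((x/p₀)^{e₀} -
(y/p₁)^{e₁})` with coprime exponents (`Irreducible.hasBranchForm`). Its torus zeros are parametrised
by one invertible `s`, and some `e_v` is nonzero in `k`, whatever the characteristic. Hensel's lemma
modulo a power of `t` therefore solves the equations for the `v`-th coordinate in terms of `s` and
free coefficients. So the stratum of `(α, g)` has a generic point (`HasBranchForm.exists_generic`),
of height `α₀ + α₁ + m - ν_α(f) + 1`.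

It remains to prove that the closures are incomparable. For two strata with `β ≤ α` and `β ≠ α`,
`nu_add_le` shows that the codimension at `α` is at most that at `β`, which excludes a strict
inclusion. No `𝓗^γ` contains a stratum, since `γ ≤ α` would give `ν_γ(f) ≤ ν_α(f) ≤ m`. If `𝓗^γ`
lies in the closure of a stratum, then `γ ≥ α + (1,1)`. When `ν_α(f) = m` this forces `γ = α +
(1,1)` with `α` on `∂σ`, an element that `B*_m` omits; conversely, `s → 0` puts every omitted `𝓗^γ`
inside such a closure. When `ν_α(f) < m`, codimensions leave only `α₀ = α₁`, `x²` and `y²` in the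
support of `f`, and a linear initial form of `g`, and then some equation of `g` fails on `𝓗^γ`
(`notMem_setBstar_of_genericF_le`). -/

theorem weight_eq (α : Fin 2 → ℕ) (η : Fin 2 →₀ ℕ) :
    Finsupp.weight α η = α 0 * η 0 + α 1 * η 1 := by
  rw [Finsupp.weight_apply, Finsupp.sum_fintype _ _ (by simp), Fin.sum_univ_two]
  simp [mul_comm]

theorem le_weight {α : Fin 2 → ℕ} (hα : ∀ v, 1 ≤ α v) (η : Fin 2 →₀ ℕ) (v : Fin 2) :
    η v ≤ Finsupp.weight α η := by
  rw [weight_eq]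
  have h0 := Nat.le_mul_of_pos_left (η 0) (hα 0)
  have h1 := Nat.le_mul_of_pos_left (η 1) (hα 1)
  fin_cases v
  · exact h0.trans (Nat.le_add_right _ _)
  · exact h1.trans (Nat.le_add_left _ _)

/-- The part of weight `d` of a power series. -/
def comp (α : Fin 2 → ℕ) (d : ℕ) (g : MvPowerSeries (Fin 2) k) : MvPolynomial (Fin 2) k :=
  MvPolynomial.weightedHomogeneousComponent α d
    (MvPowerSeries.trunc' k (Finsupp.equivFunOnFinite.symm fun _ => d) g)

/-- The truncation loses nothing: for positive weights, both coordinates of an exponent of weight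
`d` are at most `d`. -/
theorem coeff_comp {α : Fin 2 → ℕ} (hα : ∀ v, 1 ≤ α v) (d : ℕ) (g : MvPowerSeries (Fin 2) k)
    (η : Fin 2 →₀ ℕ) :
    MvPolynomial.coeff η (comp α d g) =
      if Finsupp.weight α η = d then MvPowerSeries.coeff η g else 0 := by
  rw [comp, MvPolynomial.coeff_weightedHomogeneousComponent, MvPowerSeries.coeff_trunc']
  split_ifs with h h1
  · rfl
  · exact absurd (fun v => by simpa [h] using le_weight hα η v) h1
  · rfl

theorem comp_add {α : Fin 2 → ℕ} (d : ℕ) (g h : MvPowerSeries (Fin 2) k) :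
    comp α d (g + h) = comp α d g + comp α d h := by
  simp [comp]

theorem comp_mul {α : Fin 2 → ℕ} (hα : ∀ v, 1 ≤ α v) (d : ℕ) (g h : MvPowerSeries (Fin 2) k) :
    comp α d (g * h) = ∑ p ∈ Finset.HasAntidiagonal.antidiagonal d, comp α p.1 g * comp α p.2 h := by
  classical
  ext η
  rw [coeff_comp hα, MvPowerSeries.coeff_mul, MvPolynomial.coeff_sum]
  simp_rw [MvPolynomial.coeff_mul, coeff_comp hα]
  rw [Finset.sum_comm]
  have key : ∀ x ∈ Finset.HasAntidiagonal.antidiagonal η,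
      (∑ p ∈ Finset.HasAntidiagonal.antidiagonal d,
        (if Finsupp.weight α x.1 = p.1 then MvPowerSeries.coeff x.1 g else 0) *
          (if Finsupp.weight α x.2 = p.2 then MvPowerSeries.coeff x.2 h else 0)) =
      if Finsupp.weight α η = d then MvPowerSeries.coeff x.1 g * MvPowerSeries.coeff x.2 h
        else 0 := by
    intro x hx
    have hw : Finsupp.weight α x.1 + Finsupp.weight α x.2 = Finsupp.weight α η := by
      rw [← map_add, Finset.HasAntidiagonal.mem_antidiagonal.1 hx]
    split_ifs with h1
    · rw [Finset.sum_eq_single (Finsupp.weight α x.1, Finsupp.weight α x.2)]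
      · simp
      · rintro ⟨i, j⟩ - hne
        by_cases hi : Finsupp.weight α x.1 = i
        · by_cases hj : Finsupp.weight α x.2 = j
          · exact absurd (by rw [hi, hj]) hne
          · simp [hj]
        · simp [hi]
      · intro hn
        exact absurd (Finset.HasAntidiagonal.mem_antidiagonal.2 (by omega)) hn
    · refine Finset.sum_eq_zero ?_
      rintro ⟨i, j⟩ hij
      have hij : i + j = d := Finset.HasAntidiagonal.mem_antidiagonal.1 hij
      by_cases hi : Finsupp.weight α x.1 = i
      · by_cases hj : Finsupp.weight α x.2 = j
        · omega
        · simp [hj]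
      · simp [hi]
  rw [Finset.sum_congr rfl key]
  split_ifs <;> simp

theorem isWeightedHomogeneous_comp (α : Fin 2 → ℕ) (d : ℕ) (g : MvPowerSeries (Fin 2) k) :
    MvPolynomial.IsWeightedHomogeneous α (comp α d g) d :=
  MvPolynomial.weightedHomogeneousComponent_isWeightedHomogeneous (w := α) d _

theorem comp_of_isWeightedHomogeneous {α : Fin 2 → ℕ} (hα : ∀ v, 1 ≤ α v) {e : ℕ}
    {p : MvPolynomial (Fin 2) k} (hp : MvPolynomial.IsWeightedHomogeneous α p e) (d : ℕ) :
    comp α d (p : MvPowerSeries (Fin 2) k) = if d = e then p else 0 := by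
  ext η
  rw [coeff_comp hα, MvPolynomial.coeff_coe]
  by_cases h : MvPolynomial.coeff η p = 0
  · split_ifs <;> simp [h]
  · have := hp h
    split_ifs with h1 h2 h2 <;> first | rfl | omega

/-- `g(x₀ t^{α₀}, x₁ t^{α₁})` as a power series in `t`. -/
def grading (α : Fin 2 → ℕ) (hα : ∀ v, 1 ≤ α v) :
    MvPowerSeries (Fin 2) k →+* PowerSeries (MvPolynomial (Fin 2) k) where
  toFun g := PowerSeries.mk fun d => comp α d g
  map_one' := by
    ext1 d
    have h : MvPolynomial.IsWeightedHomogeneous α (1 : MvPolynomial (Fin 2) k) 0 :=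
      MvPolynomial.isWeightedHomogeneous_one k α
    rw [PowerSeries.coeff_mk, PowerSeries.coeff_one, ← MvPolynomial.coe_one,
      comp_of_isWeightedHomogeneous hα h]
  map_zero' := by
    ext1 d
    simp [comp]
  map_add' g h := by
    ext1 d
    simp [comp_add]
  map_mul' g h := by
    ext1 d
    simp [PowerSeries.coeff_mul, comp_mul hα]

theorem coeff_grading {α : Fin 2 → ℕ} (hα : ∀ v, 1 ≤ α v) (d : ℕ) (g : MvPowerSeries (Fin 2) k) :
    PowerSeries.coeff d (grading α hα g) = comp α d g := by
  simp [grading]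

theorem nu_le (α : Fin 2 → ℕ) {g : MvPowerSeries (Fin 2) k} {η : Fin 2 →₀ ℕ} (h : η ∈ supp g) :
    nu α g ≤ Finsupp.weight α η := by
  have := MvPowerSeries.weightedOrder_le α h
  exact ENat.toNat_le_of_le_natCast this

theorem exists_weight_eq_nu (α : Fin 2 → ℕ) {g : MvPowerSeries (Fin 2) k} (hg : g ≠ 0) :
    ∃ η ∈ supp g, Finsupp.weight α η = nu α g := by
  obtain ⟨η, h1, h2⟩ := MvPowerSeries.exists_coeff_ne_zero_and_weightedOrder (w := α)
    (f := g) ((MvPowerSeries.ne_zero_iff_weightedOrder_finite α).1 hg)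
  exact ⟨η, h1, by rw [nu, ← h2]; simp⟩

theorem comp_eq_zero_of_lt {α : Fin 2 → ℕ} (hα : ∀ v, 1 ≤ α v) {g : MvPowerSeries (Fin 2) k}
    {d : ℕ} (hd : d < nu α g) : comp α d g = 0 := by
  ext η
  rw [coeff_comp hα, MvPolynomial.coeff_zero]
  split_ifs with h
  · by_contra h1
    have := nu_le α (show η ∈ supp g from h1)
    omega
  · rfl

theorem comp_nu_ne_zero {α : Fin 2 → ℕ} (hα : ∀ v, 1 ≤ α v) {g : MvPowerSeries (Fin 2) k}
    (hg : g ≠ 0) : comp α (nu α g) g ≠ 0 := by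
  obtain ⟨η, h1, h2⟩ := exists_weight_eq_nu α hg
  intro h
  have := congrArg (MvPolynomial.coeff η) h
  rw [coeff_comp hα, if_pos h2] at this
  exact h1 this

theorem le_nu {α : Fin 2 → ℕ} {g : MvPowerSeries (Fin 2) k} (hg : g ≠ 0) {n : ℕ}
    (h : ∀ η ∈ supp g, n ≤ Finsupp.weight α η) : n ≤ nu α g := by
  obtain ⟨η, h1, h2⟩ := exists_weight_eq_nu α hg
  exact h2 ▸ h η h1

theorem order_grading {α : Fin 2 → ℕ} (hα : ∀ v, 1 ≤ α v) {g : MvPowerSeries (Fin 2) k}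
    (hg : g ≠ 0) : (grading α hα g).order = nu α g := by
  rw [PowerSeries.order_eq_nat]
  exact ⟨by rw [coeff_grading]; exact comp_nu_ne_zero hα hg,
    fun i hi => by rw [coeff_grading]; exact comp_eq_zero_of_lt hα hi⟩

/-- The initial form of `g` for the weight `α`. -/
def initForm (α : Fin 2 → ℕ) (g : MvPowerSeries (Fin 2) k) : MvPolynomial (Fin 2) k :=
  comp α (nu α g) g

/-- `grading` turns `ν_α` into the order in `t` of a power series over the domain `k[x, y]`, and
that order is additive. -/
theorem nu_mul {α : Fin 2 → ℕ} (hα : ∀ v, 1 ≤ α v) {g h : MvPowerSeries (Fin 2) k}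
    (hg : g ≠ 0) (hh : h ≠ 0) : nu α (g * h) = nu α g + nu α h := by
  have := order_grading hα (mul_ne_zero hg hh)
  rw [map_mul, PowerSeries.order_mul, order_grading hα hg, order_grading hα hh] at this
  exact_mod_cast this.symm

theorem initForm_mul {α : Fin 2 → ℕ} (hα : ∀ v, 1 ≤ α v) {g h : MvPowerSeries (Fin 2) k}
    (hg : g ≠ 0) (hh : h ≠ 0) : initForm α (g * h) = initForm α g * initForm α h := by
  rw [initForm, nu_mul hα hg hh, comp_mul hα,
    Finset.sum_eq_single (nu α g, nu α h)]
  · rfl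
  · rintro ⟨i, j⟩ hij hne
    rw [Finset.HasAntidiagonal.mem_antidiagonal] at hij
    rcases lt_trichotomy i (nu α g) with h1 | h1 | h1
    · simp [comp_eq_zero_of_lt hα h1]
    · exact absurd (Prod.ext h1 (by simp at hij ⊢; omega)) hne
    · have : j < nu α h := by simp at hij; omega
      simp [comp_eq_zero_of_lt hα this]
  · simp

theorem nu_one (α : Fin 2 → ℕ) : nu α (1 : MvPowerSeries (Fin 2) k) = 0 := by
  simp [nu, MvPowerSeries.weightedOrder_one]

theorem initForm_one {α : Fin 2 → ℕ} (hα : ∀ v, 1 ≤ α v) :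
    initForm α (1 : MvPowerSeries (Fin 2) k) = 1 := by
  rw [initForm, nu_one, ← coeff_grading hα, map_one, PowerSeries.coeff_zero_one]

theorem initForm_prod {ι : Type*} {α : Fin 2 → ℕ} (hα : ∀ v, 1 ≤ α v) (s : Finset ι)
    (g : ι → MvPowerSeries (Fin 2) k) (hg : ∀ i ∈ s, g i ≠ 0) :
    initForm α (∏ i ∈ s, g i) = ∏ i ∈ s, initForm α (g i) := by
  classical
  induction s using Finset.induction_on with
  | empty => simp [initForm_one hα]
  | insert a s ha ih =>
    have h1 : ∀ i ∈ s, g i ≠ 0 := fun i hi => hg i (Finset.mem_insert_of_mem hi)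
    rw [Finset.prod_insert ha, Finset.prod_insert ha,
      initForm_mul hα (hg a (Finset.mem_insert_self a s)) (Finset.prod_ne_zero_iff.2 h1), ih h1]

theorem coeff_initForm {α : Fin 2 → ℕ} (hα : ∀ v, 1 ≤ α v) (g : MvPowerSeries (Fin 2) k)
    (η : Fin 2 →₀ ℕ) :
    MvPolynomial.coeff η (initForm α g) =
      if Finsupp.weight α η = nu α g then MvPowerSeries.coeff η g else 0 :=
  coeff_comp hα _ _ _

theorem initForm_ne_zero {α : Fin 2 → ℕ} (hα : ∀ v, 1 ≤ α v) {g : MvPowerSeries (Fin 2) k}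
    (hg : g ≠ 0) : initForm α g ≠ 0 := comp_nu_ne_zero hα hg

theorem mem_support_initForm {α : Fin 2 → ℕ} (hα : ∀ v, 1 ≤ α v) {g : MvPowerSeries (Fin 2) k}
    {η : Fin 2 →₀ ℕ} :
    η ∈ (initForm α g).support ↔ η ∈ supp g ∧ Finsupp.weight α η = nu α g := by
  rw [MvPolynomial.mem_support_iff, coeff_initForm hα]
  by_cases h : Finsupp.weight α η = nu α g <;> simp [h, supp]


/-! ### Newton faces and tropical varieties for integral weights -/

theorem castPlane_dotProduct (α : Fin 2 → ℕ) (v : Fin 2 → ℝ) :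
    castPlane α ⬝ᵥ v = α 0 * v 0 + α 1 * v 1 := by
  simp [dotProduct, castPlane, Fin.sum_univ_two]

theorem castPlane_dotProduct_toPlane (α : Fin 2 → ℕ) (η : Fin 2 →₀ ℕ) :
    castPlane α ⬝ᵥ toPlane η = (Finsupp.weight α η : ℕ) := by
  rw [castPlane_dotProduct, weight_eq]
  simp [toPlane]

theorem toPlane_injective : Function.Injective toPlane := by
  intro η η' h
  ext v
  have := congrFun h v
  simpa [toPlane] using this

theorem realNu_castPlane (α : Fin 2 → ℕ) {g : MvPowerSeries (Fin 2) k} (hg : g ≠ 0) :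
    realNu (castPlane α) g = nu α g := by
  refine IsLeast.csInf_eq ⟨?_, ?_⟩
  · obtain ⟨η, h1, h2⟩ := exists_weight_eq_nu α hg
    exact ⟨η, h1, (castPlane_dotProduct_toPlane α η).trans (by rw [h2])⟩
  · rintro _ ⟨η, h, rfl⟩
    exact (Nat.cast_le.2 (nu_le α h)).trans (castPlane_dotProduct_toPlane α η).ge

/-- The exponents at which a power series attains its minimal weight. -/
def minSet (α : Fin 2 → ℕ) (g : MvPowerSeries (Fin 2) k) : Set (Fin 2 →₀ ℕ) :=
  {η | η ∈ supp g ∧ Finsupp.weight α η = nu α g}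

theorem minSet_finite {α : Fin 2 → ℕ} (hα : ∀ v, 1 ≤ α v) (g : MvPowerSeries (Fin 2) k) :
    (minSet α g).Finite := by
  refine (Finset.finite_toSet (initForm α g).support).subset fun η hη => ?_
  exact (mem_support_initForm hα).2 hη

/-- The points with `l > c`, together with the hull of the level part of `S`, form a convex set that
contains `S`. -/
theorem convexHull_inter_level_subset {E : Type*} [AddCommGroup E] [Module ℝ E] (l : E →ₗ[ℝ] ℝ)
    (S : Set E) (c : ℝ) (h : ∀ v ∈ S, c ≤ l v) :
    convexHull ℝ S ∩ {v | l v = c} ⊆ convexHull ℝ (S ∩ {v | l v = c}) := by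
  have hC : Convex ℝ ({v | c < l v} ∪ convexHull ℝ (S ∩ {v | l v = c})) := by
    have hge : ∀ v ∈ convexHull ℝ (S ∩ {v | l v = c}), c = l v := by
      have h1 : Convex ℝ {v | l v = c} := by
        have := (convex_singleton c).linear_preimage l
        exact this
      have h2 := convexHull_min (Set.inter_subset_right : S ∩ {v | l v = c} ⊆ _) h1
      exact fun v hv => (h2 hv).symm
    intro x hx y hy a b ha hb hab
    have hbb : b = 1 - a := by linarith
    rcases ha.eq_or_lt with rfl | ha
    · simpa [hbb] using hy
    rcases hb.eq_or_lt with rfl | hb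
    · have : a = 1 := by linarith
      simpa [this] using hx
    rcases hx with hx | hx
    · left
      have hx : c < l x := hx
      have hy : c ≤ l y := by
        rcases hy with hy | hy
        · exact le_of_lt hy
        · exact (hge y hy).le
      simp only [Set.mem_ofPred_eq, map_add, map_smul, smul_eq_mul]
      subst hbb
      nlinarith
    · rcases hy with hy | hy
      · left
        have hy : c < l y := hy
        have hx := (hge x hx)
        simp only [Set.mem_ofPred_eq, map_add, map_smul, smul_eq_mul]
        subst hbb
        rw [← hx]
        nlinarith
      · exact Or.inr (convex_convexHull ℝ _ hx hy ha.le hb.le hab)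
  have hS : S ⊆ {v | c < l v} ∪ convexHull ℝ (S ∩ {v | l v = c}) := by
    intro v hv
    rcases (h v hv).lt_or_eq with h1 | h1
    · exact Or.inl h1
    · exact Or.inr (subset_convexHull ℝ _ ⟨hv, h1.symm⟩)
  rintro v ⟨hv, hv1⟩
  rcases convexHull_min hS hC hv with h1 | h1
  · exact absurd hv1 (ne_of_gt h1)
  · exact h1

/-- Moving up from an exponent strictly increases a positive weight, so only the finitely many
exponents of minimal weight contribute to the face; this makes it compact. -/
theorem newtonPolyhedron_inter_supportLine {α : Fin 2 → ℕ} (hα : ∀ v, 1 ≤ α v)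
    {g : MvPowerSeries (Fin 2) k} (hg : g ≠ 0) :
    newtonPolyhedron g ∩ supportLine (castPlane α) g = convexHull ℝ (toPlane '' minSet α g) := by
  have hα' : ∀ v, (1 : ℝ) ≤ α v := fun v => by exact_mod_cast hα v
  let l : (Fin 2 → ℝ) →ₗ[ℝ] ℝ := dotProductBilin ℝ ℝ (castPlane α)
  have hl : ∀ v, l v = castPlane α ⬝ᵥ v := fun v => rfl
  have hmono : ∀ (η : Fin 2 →₀ ℕ) (v : Fin 2 → ℝ), toPlane η ≤ v →
      (Finsupp.weight α η : ℝ) ≤ castPlane α ⬝ᵥ v ∧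
      (castPlane α ⬝ᵥ v ≤ Finsupp.weight α η → toPlane η = v) := by
    intro η v hv
    rw [← castPlane_dotProduct_toPlane, castPlane_dotProduct, castPlane_dotProduct]
    have h0 := hv 0
    have h1 := hv 1
    have a0 := hα' 0
    have a1 := hα' 1
    have e0 := mul_le_mul_of_nonneg_left h0 (by linarith : (0 : ℝ) ≤ α 0)
    have e1 := mul_le_mul_of_nonneg_left h1 (by linarith : (0 : ℝ) ≤ α 1)
    refine ⟨by linarith, fun h => ?_⟩
    ext i
    fin_cases i
    · have : (α 0 : ℝ) * toPlane η 0 = α 0 * v 0 := by linarith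
      exact mul_left_cancel₀ (by linarith : (α 0 : ℝ) ≠ 0) this
    · have : (α 1 : ℝ) * toPlane η 1 = α 1 * v 1 := by linarith
      exact mul_left_cancel₀ (by linarith : (α 1 : ℝ) ≠ 0) this
  apply Set.Subset.antisymm
  · have h1 := convexHull_inter_level_subset l {v | ∃ η ∈ supp g, toPlane η ≤ v} (nu α g) (by
      rintro v ⟨η, hη, hv⟩
      rw [hl]
      have : (nu α g : ℝ) ≤ Finsupp.weight α η := by exact_mod_cast nu_le α hη
      exact this.trans (hmono η v hv).1)
    rintro v ⟨hv, hv1⟩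
    have h2 : l v = nu α g := by rw [hl, ← realNu_castPlane α hg]; exact hv1
    refine convexHull_mono ?_ (h1 ⟨hv, h2⟩)
    rintro u ⟨⟨η, hη, hu⟩, hu1⟩
    have hu1 : castPlane α ⬝ᵥ u = nu α g := hu1
    have h3 : (nu α g : ℝ) ≤ Finsupp.weight α η := by exact_mod_cast nu_le α hη
    have h4 := hmono η u hu
    refine ⟨η, ⟨hη, ?_⟩, h4.2 (by linarith)⟩
    have : (Finsupp.weight α η : ℝ) = nu α g := by linarith
    exact_mod_cast this
  · refine Set.subset_inter (convexHull_mono ?_) (convexHull_min ?_ ?_)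
    · rintro _ ⟨η, hη, rfl⟩
      exact ⟨η, hη.1, le_refl _⟩
    · rintro _ ⟨η, hη, rfl⟩
      exact (castPlane_dotProduct_toPlane α η).trans (by rw [hη.2, realNu_castPlane α hg])
    · exact (convex_singleton (realNu (castPlane α) g)).linear_preimage l

theorem isNewtonFace_castPlane {α : Fin 2 → ℕ} (hα : ∀ v, 1 ≤ α v)
    {g : MvPowerSeries (Fin 2) k} (hg : g ≠ 0) :
    IsNewtonFace g (newtonPolyhedron g ∩ supportLine (castPlane α) g) := by
  refine ⟨?_, castPlane α, fun v => by simp [castPlane], rfl⟩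
  rw [newtonPolyhedron_inter_supportLine hα hg]
  exact ((minSet_finite hα g).image _).isCompact_convexHull ℝ

/-- A face on the support line of `α` lies in the hull of `minSet α g`, which cannot contain a
segment if there is only one minimal exponent. -/
theorem castPlane_mem_tropicalVariety_iff {α : Fin 2 → ℕ} (hα : ∀ v, 1 ≤ α v)
    {g : MvPowerSeries (Fin 2) k} (hg : g ≠ 0) :
    castPlane α ∈ tropicalVariety g ↔ (minSet α g).Nontrivial := by
  constructor
  · rintro ⟨Φ, ⟨-, ω, -, hΦ⟩, hnt, -, hsub⟩
    by_contra hn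
    rw [Set.not_nontrivial_iff] at hn
    have h1 : Φ ⊆ convexHull ℝ (toPlane '' minSet α g) := by
      rw [← newtonPolyhedron_inter_supportLine hα hg]
      exact Set.subset_inter (hΦ ▸ Set.inter_subset_left) hsub
    have h2 : (convexHull ℝ (toPlane '' minSet α g)).Subsingleton := by
      rcases (hn.image toPlane).eq_empty_or_singleton with h | ⟨x, h⟩ <;> rw [h] <;> simp
    exact Set.not_nontrivial_iff.2 h2 (hnt.mono h1)
  · intro h
    refine ⟨_, isNewtonFace_castPlane hα hg, ?_, fun v => by simp [castPlane],
      Set.inter_subset_right⟩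
    rw [newtonPolyhedron_inter_supportLine hα hg]
    exact (h.image toPlane_injective).mono (subset_convexHull ℝ _)

/-- The bridge from the non-degeneracy hypothesis, stated for faces, to initial forms. -/
theorem facePart_castPlane {α : Fin 2 → ℕ} (hα : ∀ v, 1 ≤ α v)
    {g : MvPowerSeries (Fin 2) k} (hg : g ≠ 0) :
    facePart g (newtonPolyhedron g ∩ supportLine (castPlane α) g) = initForm α g := by
  classical
  have hfin := finite_exponents (isNewtonFace_castPlane hα hg).1
  ext η
  rw [facePart, finsum_mem_eq_finite_toFinset_sum _ hfin, MvPolynomial.coeff_sum,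
    coeff_initForm hα]
  simp only [MvPolynomial.coeff_monomial, Finset.sum_ite_eq', Set.Finite.mem_toFinset,
    Set.mem_ofPred_eq]
  by_cases hc : MvPowerSeries.coeff η g = 0
  · simp [hc]
  · have : toPlane η ∈ newtonPolyhedron g ∩ supportLine (castPlane α) g ↔
        Finsupp.weight α η = nu α g := by
      have h1 : toPlane η ∈ newtonPolyhedron g :=
        subset_convexHull ℝ _ ⟨η, hc, le_refl _⟩
      rw [Set.mem_inter_iff, and_iff_right h1, supportLine, Set.mem_ofPred_eq,
        castPlane_dotProduct_toPlane, realNu_castPlane α hg]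
      exact Nat.cast_inj
    simp [this]

theorem IsNewtonNondegenerate.exists_pderiv_ne_zero {f : MvPowerSeries (Fin 2) k}
    (hf : IsNewtonNondegenerate f) {α : Fin 2 → ℕ} (hα : ∀ v, 1 ≤ α v) {p : Fin 2 → k}
    (hp : ∀ v, p v ≠ 0) (h : MvPolynomial.eval p (initForm α f) = 0) :
    ∃ v, MvPolynomial.eval p (MvPolynomial.pderiv v (initForm α f)) ≠ 0 := by
  have hf0 : f ≠ 0 := hf.1.ne_zero
  have := hf.2 _ (isNewtonFace_castPlane hα hf0) p hp
  rw [facePart_castPlane hα hf0] at this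
  by_contra hn
  push Not at hn
  exact this ⟨h, hn⟩

theorem minSet_eq_of_parallel {α β : Fin 2 → ℕ} (hα : ∀ v, 1 ≤ α v) (hβ : ∀ v, 1 ≤ β v)
    (h : α 0 * β 1 = α 1 * β 0) {g : MvPowerSeries (Fin 2) k} (hg : g ≠ 0) :
    minSet α g = minSet β g := by
  have key : ∀ η : Fin 2 →₀ ℕ, Finsupp.weight α η * β 0 = Finsupp.weight β η * α 0 := by
    intro η
    rw [weight_eq, weight_eq]
    calc (α 0 * η 0 + α 1 * η 1) * β 0 = α 0 * η 0 * β 0 + (α 1 * β 0) * η 1 := by ring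
      _ = (β 0 * η 0 + β 1 * η 1) * α 0 := by rw [← h]; ring
  obtain ⟨η, hη, hη1⟩ := exists_weight_eq_nu α hg
  obtain ⟨θ, hθ, hθ1⟩ := exists_weight_eq_nu β hg
  have hnu : nu α g * β 0 = nu β g * α 0 := by
    apply le_antisymm
    · rw [← hθ1, ← key]; exact Nat.mul_le_mul_right _ (nu_le α hθ)
    · rw [← hη1, key]; exact Nat.mul_le_mul_right _ (nu_le β hη)
  ext ζ
  refine and_congr_right fun _ => ?_
  constructor
  · intro h1
    exact Nat.eq_of_mul_eq_mul_right (hα 0) (by rw [← key, h1, hnu])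
  · intro h1
    exact Nat.eq_of_mul_eq_mul_right (hβ 0) (by rw [key, h1, hnu])

theorem IsSemiLine.parallel {L : Set (Fin 2 → ℝ)} (hL : IsSemiLine L) {α β : Fin 2 → ℕ}
    (hα : castPlane α ∈ L) (hβ : castPlane β ∈ L) : α 0 * β 1 = α 1 * β 0 := by
  obtain ⟨w, -, rfl⟩ := hL
  obtain ⟨s, -, hs⟩ := hα
  obtain ⟨r, -, hr⟩ := hβ
  have a := fun v => congrFun hs v
  have b := fun v => congrFun hr v
  simp only [castPlane, Pi.smul_apply, smul_eq_mul] at a b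
  have : (α 0 : ℝ) * β 1 = α 1 * β 0 := by rw [a, a, b, b]; ring
  exact_mod_cast this

/-! ### Zeros of initial forms in the torus -/

theorem minSet_nontrivial_of_aeval_eq_zero {α : Fin 2 → ℕ} (hα : ∀ v, 1 ≤ α v)
    {g : MvPowerSeries (Fin 2) k} (hg : g ≠ 0) {K : Type*} [Field K] [Algebra k K]
    {p : Fin 2 → K} (hp : ∀ v, p v ≠ 0) (h : MvPolynomial.aeval p (initForm α g) = 0) :
    (minSet α g).Nontrivial := by
  by_contra hn
  rw [Set.not_nontrivial_iff] at hn
  obtain ⟨η, hη⟩ := exists_weight_eq_nu α hg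
  have hs : (initForm α g).support = {η} := by
    ext θ
    rw [mem_support_initForm hα, Finset.mem_singleton]
    exact ⟨fun h1 => hn h1 hη, fun h1 => h1 ▸ hη⟩
  rw [MvPolynomial.aeval_def, MvPolynomial.eval₂_eq, hs, Finset.sum_singleton] at h
  have hc : MvPolynomial.coeff η (initForm α g) ≠ 0 := by
    rw [← MvPolynomial.mem_support_iff, hs]; simp
  rcases mul_eq_zero.1 h with h1 | h1
  · exact hc ((map_eq_zero _).1 h1)
  · exact Finset.prod_ne_zero_iff.2 (fun v _ => pow_ne_zero _ (hp v)) h1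

/-- Put `x = 1`. Exponents of equal weight with the same `y`-degree coincide, so no terms merge and
at least two survive. After division by the largest power of `y` a nonconstant polynomial remains,
and its roots are nonzero. -/
theorem exists_torus_zero [IsAlgClosed k] {α : Fin 2 → ℕ} (hα : ∀ v, 1 ≤ α v)
    {g : MvPowerSeries (Fin 2) k} (h : (minSet α g).Nontrivial) :
    ∃ p : Fin 2 → k, (∀ v, p v ≠ 0) ∧ MvPolynomial.eval p (initForm α g) = 0 := by
  classical
  set q : Polynomial k := MvPolynomial.aeval ![1, Polynomial.X] (initForm α g) with hq
  have hcoeff : ∀ η ∈ minSet α g, q.coeff (η 1) ≠ 0 := by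
    intro η hη
    have hη' := (mem_support_initForm hα).2 hη
    have : q.coeff (η 1) = MvPolynomial.coeff η (initForm α g) := by
      rw [hq, MvPolynomial.aeval_def, MvPolynomial.eval₂_eq', Polynomial.finsetSum_coeff,
        Finset.sum_eq_single η]
      · simp [Fin.prod_univ_two, Polynomial.coeff_X_pow]
      · intro θ hθ hne
        have hθ := (mem_support_initForm hα).1 hθ
        have : η 1 ≠ θ 1 := by
          intro h1
          apply hne
          have e := hθ.2.trans hη.2.symm
          rw [weight_eq, weight_eq, h1] at e
          have e0 : θ 0 = η 0 := Nat.eq_of_mul_eq_mul_left (hα 0) (by omega)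
          ext v
          fin_cases v
          · exact e0
          · exact h1.symm
        simp [Fin.prod_univ_two, Polynomial.coeff_X_pow, this]
      · exact fun h1 => absurd hη' h1
    rw [this]
    exact MvPolynomial.mem_support_iff.1 hη'
  obtain ⟨η, hη, θ, hθ, hne⟩ := h
  have hne1 : η 1 ≠ θ 1 := by
    intro h1
    apply hne
    have e := hη.2.trans hθ.2.symm
    rw [weight_eq, weight_eq, h1] at e
    have e0 : η 0 = θ 0 := Nat.eq_of_mul_eq_mul_left (hα 0) (by omega)
    ext v
    fin_cases v
    · exact e0
    · exact h1
  have hq0 : q ≠ 0 := fun h0 => hcoeff η hη (by simp [h0])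
  obtain ⟨r, hr, hr0⟩ := Polynomial.exists_eq_pow_rootMultiplicity_mul_and_not_dvd q hq0 0
  rw [Polynomial.C_0, sub_zero] at hr hr0
  have hdeg : r.degree ≠ 0 := by
    intro hd
    rw [Polynomial.eq_C_of_degree_eq_zero hd] at hr
    have h1 := hcoeff η hη
    have h2 := hcoeff θ hθ
    rw [hr, Polynomial.coeff_mul_C, Polynomial.coeff_X_pow] at h1 h2
    split_ifs at h1 h2 with h3 h4
    · exact hne1 (h3.trans h4.symm)
    all_goals simp at h1 h2
  obtain ⟨z, hz⟩ := IsAlgClosed.exists_root r hdeg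
  have hz0 : z ≠ 0 := by
    rintro rfl
    exact hr0 (by rw [Polynomial.X_dvd_iff, Polynomial.coeff_zero_eq_eval_zero]; exact hz)
  refine ⟨![1, z], fun v => by fin_cases v <;> simp [hz0], ?_⟩
  have h1 : q.eval z = 0 := by rw [hr, Polynomial.eval_mul, hz.eq_zero, mul_zero]
  have h2 : (Polynomial.evalRingHom z).comp
      (MvPolynomial.aeval ![1, Polynomial.X] : MvPolynomial (Fin 2) k →ₐ[k] _).toRingHom =
      MvPolynomial.eval ![1, z] := by
    refine MvPolynomial.ringHom_ext (fun r => by simp) fun v => ?_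
    fin_cases v <;> simp
  rw [← h2]
  exact h1

/-- Over an algebraically closed field, `α ∈ T(g)` means that the initial form has a torus zero, and
the initial form of a product is the product of the initial forms. -/
theorem castPlane_mem_tropicalVariety_prod [IsAlgClosed k] {ι : Type*} {α : Fin 2 → ℕ}
    (hα : ∀ v, 1 ≤ α v) (s : Finset ι) (g : ι → MvPowerSeries (Fin 2) k)
    (hg : ∀ i ∈ s, g i ≠ 0) :
    castPlane α ∈ tropicalVariety (∏ i ∈ s, g i) ↔
      ∃ i ∈ s, castPlane α ∈ tropicalVariety (g i) := by
  have hp := Finset.prod_ne_zero_iff.2 hg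
  rw [castPlane_mem_tropicalVariety_iff hα hp]
  constructor
  · intro h
    obtain ⟨p, hp0, hp1⟩ := exists_torus_zero hα h
    rw [initForm_prod hα s g hg, map_prod, Finset.prod_eq_zero_iff] at hp1
    obtain ⟨i, hi, h1⟩ := hp1
    exact ⟨i, hi, (castPlane_mem_tropicalVariety_iff hα (hg i hi)).2
      (minSet_nontrivial_of_aeval_eq_zero hα (hg i hi) hp0 h1)⟩
  · rintro ⟨i, hi, h⟩
    rw [castPlane_mem_tropicalVariety_iff hα (hg i hi)] at h
    obtain ⟨p, hp0, hp1⟩ := exists_torus_zero hα h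
    refine minSet_nontrivial_of_aeval_eq_zero hα hp (K := k) hp0 ?_
    rw [initForm_prod hα s g hg, map_prod, Finset.prod_eq_zero_iff]
    exact ⟨i, hi, hp1⟩


/-! ### Tropical varieties and the axes: the boundary of `σ`, compact edges -/

theorem newtonPolyhedron_add_mem (g : MvPowerSeries (Fin 2) k) {v w : Fin 2 → ℝ}
    (hv : v ∈ newtonPolyhedron g) (hw : 0 ≤ w) : w + v ∈ newtonPolyhedron g := by
  have h1 : Convex ℝ ((fun x => w + x) ⁻¹' newtonPolyhedron g) :=
    (convex_convexHull ℝ _).translate_preimage_right w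
  refine convexHull_min ?_ h1 hv
  rintro u ⟨η, hη, hu⟩
  exact subset_convexHull ℝ _ ⟨η, hη, hu.trans (le_add_of_nonneg_left hw)⟩

theorem newtonPolyhedron_subset (α : Fin 2 → ℕ) {g : MvPowerSeries (Fin 2) k}
    {v : Fin 2 → ℝ} (hv : v ∈ newtonPolyhedron g) :
    0 ≤ v ∧ (nu α g : ℝ) ≤ castPlane α ⬝ᵥ v := by
  have hp : ∀ (η : Fin 2 →₀ ℕ) (i : Fin 2), 0 ≤ toPlane η i := fun η i => by simp [toPlane]
  refine ⟨?_, ?_⟩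
  · refine convexHull_min ?_ (convex_Ici (0 : Fin 2 → ℝ)) hv
    rintro u ⟨η, hη, hu⟩ i
    exact (hp η i).trans (hu i)
  · let l : (Fin 2 → ℝ) →ₗ[ℝ] ℝ := dotProductBilin ℝ ℝ (castPlane α)
    refine convexHull_min ?_ ((convex_Ici (nu α g : ℝ)).linear_preimage l) hv
    rintro u ⟨η, hη, hu⟩
    have h1 : (nu α g : ℝ) ≤ castPlane α ⬝ᵥ toPlane η := by
      rw [castPlane_dotProduct_toPlane]
      exact Nat.cast_le.2 (nu_le α hη)
    refine h1.trans ?_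
    change _ ≤ castPlane α ⬝ᵥ u
    rw [castPlane_dotProduct, castPlane_dotProduct]
    have h0 := hu 0
    have h1 := hu 1
    gcongr

theorem realNu_le {ω : Fin 2 → ℝ} (hω : 0 ≤ ω) {g : MvPowerSeries (Fin 2) k} {η : Fin 2 →₀ ℕ}
    (hη : η ∈ supp g) : realNu ω g ≤ ω ⬝ᵥ toPlane η := by
  refine csInf_le ⟨0, ?_⟩ ⟨η, hη, rfl⟩
  rintro _ ⟨θ, -, rfl⟩
  exact dotProduct_nonneg_of_nonneg hω fun i => by simp [toPlane]

/-- A minimal exponent for `α` on the `i`-th axis bounds the slopes in `T(f)` from one side. For a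
weight `ω` beyond `α`, all points of minimal `ω`-value lie on that axis, and a segment along the
axis is not a compact face. The indices `i`, `j` allow either axis. -/
theorem not_lt_of_mem_tropicalVariety {i j : Fin 2} (hij : ∀ v, v = i ∨ v = j)
    (hdot : ∀ a b : Fin 2 → ℝ, a ⬝ᵥ b = a i * b i + a j * b j)
    {α : Fin 2 → ℕ} (hα : ∀ v, 1 ≤ α v)
    {f : MvPowerSeries (Fin 2) k} {η : Fin 2 →₀ ℕ} (hη : η ∈ minSet α f) (hη1 : η j = 0)
    {ω : Fin 2 → ℝ} (hω : ω ∈ tropicalVariety f) : ¬ ω i * α j < ω j * α i := by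
  intro hlt
  obtain ⟨Φ, ⟨hc, τ, hτ, hΦ⟩, ⟨u, hu, v, hv, huv⟩, hω0, hsub⟩ := hω
  have hnu : (nu α f : ℝ) = α i * η i := by
    have h1 : ((Finsupp.weight α η : ℕ) : ℝ) = α i * η i := by
      rw [← castPlane_dotProduct_toPlane, hdot]
      simp [toPlane, castPlane, hη1]
    rw [← h1, hη.2]
  have hαi : (0 : ℝ) < α i := by exact_mod_cast hα i
  have hαj : (0 : ℝ) < α j := by exact_mod_cast hα j
  have key : ∀ x ∈ Φ, x j = 0 ∧ ω i * (x i - η i) = 0 := by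
    intro x hx
    have hxΓ : x ∈ newtonPolyhedron f := by
      rw [hΦ] at hx; exact hx.1
    obtain ⟨h0, h1⟩ := newtonPolyhedron_subset α hxΓ
    have h2 : ω ⬝ᵥ x = realNu ω f := hsub hx
    have h3 := realNu_le hω0 hη.1
    rw [← h2, hdot, hdot] at h3
    rw [hdot, hnu] at h1
    simp only [castPlane, toPlane, hη1, Nat.cast_zero, mul_zero, add_zero] at h1 h3
    have h4 := h0 j
    have h5 := hω0 i
    simp only [Pi.zero_apply] at h4 h5
    have h6 : x j * (ω j * α i - ω i * α j) ≤ 0 := by nlinarith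
    have h7 : x j = 0 := by
      by_contra hne
      have : 0 < x j := lt_of_le_of_ne h4 (Ne.symm hne)
      have := mul_pos this (sub_pos.2 hlt)
      linarith
    refine ⟨h7, ?_⟩
    rw [h7] at h1 h3
    simp only [mul_zero, add_zero] at h1 h3
    have h8 : (η i : ℝ) ≤ x i := le_of_mul_le_mul_left h1 hαi
    have := mul_nonneg h5 (sub_nonneg.2 h8)
    nlinarith
  have hui : u i ≠ v i := by
    intro h
    apply huv
    ext x
    rcases hij x with rfl | rfl
    · exact h
    · rw [(key u hu).1, (key v hv).1]
  -- The weight `τ` that cuts out the segment is constant along the axis, so the face contains a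
  -- whole ray in that direction.
  have hτi : τ i = 0 := by
    have h1 : τ ⬝ᵥ u = τ ⬝ᵥ v := by
      rw [hΦ] at hu hv
      exact hu.2.trans hv.2.symm
    rw [hdot, hdot, (key u hu).1, (key v hv).1] at h1
    have h2 : τ i * (u i - v i) = 0 := by linarith
    exact (mul_eq_zero.1 h2).resolve_right (sub_ne_zero.2 hui)
  have hij' : i ≠ j := by
    rintro rfl
    exact hui ((key u hu).1.trans (key v hv).1.symm)
  obtain ⟨C, hC⟩ := hc.isBounded.exists_norm_le
  -- A translation along the ray, long enough to leave the ball that bounds `Φ`.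
  let w : Fin 2 → ℝ := Pi.single i (|C| + 1)
  have hw : 0 ≤ w := by
    intro x
    by_cases h : x = i
    · subst h; simp [w]; positivity
    · simp [w, h]
  have hmem : w + u ∈ Φ := by
    have hu' := hu
    rw [hΦ] at hu' ⊢
    refine ⟨newtonPolyhedron_add_mem f hu'.1 hw, ?_⟩
    have : τ ⬝ᵥ w = 0 := by
      rw [hdot, hτi]; simp [w, hij'.symm]
    change τ ⬝ᵥ (w + u) = _
    rw [dotProduct_add, this, zero_add]
    exact hu'.2
  have h1 := (norm_le_pi_norm (w + u) i).trans (hC _ hmem)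
  have h2 : 0 ≤ u i := by
    rw [hΦ] at hu
    exact (newtonPolyhedron_subset α hu.1).1 i
  have h3 : (w + u) i = |C| + 1 + u i := by simp [w]
  rw [h3, Real.norm_eq_abs, abs_of_nonneg (by positivity)] at h1
  linarith [le_abs_self C]

/-- Minimal exponents on both axes bound the slopes from both sides. Hence `T(f)`, and so `σ`, lies
in the line through `α`, which has empty interior. -/
theorem mem_frontier_of_axes {α : Fin 2 → ℕ} (hα : ∀ v, 1 ≤ α v)
    {f : MvPowerSeries (Fin 2) k} {η θ : Fin 2 →₀ ℕ} (hη : η ∈ minSet α f) (hη1 : η 1 = 0)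
    (hθ : θ ∈ minSet α f) (hθ0 : θ 0 = 0) (hmem : castPlane α ∈ tropicalVariety f) :
    castPlane α ∈ frontier (convexHull ℝ (tropicalVariety f)) := by
  have hline : ∀ ω ∈ tropicalVariety f, ω 0 * α 1 = ω 1 * α 0 := by
    intro ω hω
    apply le_antisymm
    · exact not_lt.1 (not_lt_of_mem_tropicalVariety (i := 1) (j := 0)
        (fun v => by fin_cases v <;> simp)
        (fun a b => by simp [dotProduct, Fin.sum_univ_two, add_comm]) hα hθ hθ0 hω)
    · exact not_lt.1 (not_lt_of_mem_tropicalVariety (i := 0) (j := 1)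
        (fun v => by fin_cases v <;> simp)
        (fun a b => by simp [dotProduct, Fin.sum_univ_two]) hα hη hη1 hω)
  let l : (Fin 2 → ℝ) →ₗ[ℝ] ℝ :=
    (α 1 : ℝ) • LinearMap.proj 0 - (α 0 : ℝ) • LinearMap.proj 1
  have hsub : convexHull ℝ (tropicalVariety f) ⊆ LinearMap.ker l := by
    refine convexHull_min (fun ω hω => ?_) (LinearMap.ker l).convex
    have := hline ω hω
    simp only [SetLike.mem_coe, LinearMap.mem_ker, l, LinearMap.sub_apply, LinearMap.smul_apply,
      LinearMap.proj_apply, smul_eq_mul]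
    linarith
  refine ⟨subset_closure (subset_convexHull ℝ _ hmem), fun hint => ?_⟩
  have h1 : (interior ((LinearMap.ker l : Submodule ℝ (Fin 2 → ℝ)) : Set (Fin 2 → ℝ))).Nonempty :=
    ⟨_, interior_mono hsub hint⟩
  have h2 := Submodule.eq_top_of_nonempty_interior' _ h1
  have h3 : (Pi.single 0 1 : Fin 2 → ℝ) ∈ LinearMap.ker l := h2 ▸ Submodule.mem_top
  have h4 : (α 1 : ℝ) = 0 := by
    simpa [l] using h3
  have := hα 1
  have h5 : α 1 = 0 := by exact_mod_cast h4
  omega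

/-- A non-unit divisible by neither variable has exponents on both axes. From the lowest one on the
`y`-axis, `b`, the steepest descent to another exponent spans a compact edge. -/
theorem exists_minSet_nontrivial {g : MvPowerSeries (Fin 2) k} (hg : g ≠ 0)
    (h0 : MvPowerSeries.constantCoeff g = 0)
    (hX : ∀ v, ¬ MvPowerSeries.X v ∣ g) :
    ∃ β : Fin 2 → ℕ, (∀ v, 1 ≤ β v) ∧ (minSet β g).Nontrivial := by
  have hax : ∀ v : Fin 2, ∃ η ∈ supp g, η v = 0 := by
    intro v
    have := hX v
    rw [MvPowerSeries.X_dvd_iff] at this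
    push Not at this
    obtain ⟨η, h1, h2⟩ := this
    exact ⟨η, h2, h1⟩
  have hz : ∀ η ∈ supp g, ¬ (η 0 = 0 ∧ η 1 = 0) := by
    rintro η hη ⟨h1, h2⟩
    apply hη
    have : η = 0 := by ext v; fin_cases v <;> simp [h1, h2]
    rw [this, MvPowerSeries.coeff_zero_eq_constantCoeff_apply, h0]
  obtain ⟨a, ha, ha1⟩ := hax 1
  obtain ⟨b', hb', hb0'⟩ := hax 0
  have hex : ∃ n, ∃ η ∈ supp g, η 0 = 0 ∧ η 1 = n := ⟨_, b', hb', hb0', rfl⟩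
  classical
  obtain ⟨b, hb, hb0, hb1⟩ := Nat.find_spec hex
  have hbmin : ∀ η ∈ supp g, η 0 = 0 → b 1 ≤ η 1 := by
    intro η hη h
    rw [hb1]
    exact Nat.find_min' hex ⟨η, hη, h, rfl⟩
  have hbpos : 0 < b 1 := Nat.pos_of_ne_zero fun h => hz b hb ⟨hb0, h⟩
  have hapos : 0 < a 0 := Nat.pos_of_ne_zero fun h => hz a ha ⟨h, ha1⟩
  -- Exponents to the right of `a`, which lies on the `x`-axis, give slopes no steeper than `a`, so
  -- a maximum over a finite set suffices.
  let S : Set (Fin 2 →₀ ℕ) := {η | η ∈ supp g ∧ η 1 < b 1 ∧ η 0 ≤ a 0}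
  have hSfin : S.Finite := by
    refine (Set.finite_Iic (Finsupp.equivFunOnFinite.symm ![a 0, b 1])).subset ?_
    rintro η ⟨-, h1, h2⟩ v
    fin_cases v
    · simpa using h2
    · simpa using h1.le
  obtain ⟨η, ⟨hη, hη1, hη0⟩, hmax⟩ := Set.exists_max_image S
    (fun η => ((b 1 : ℚ) - η 1) / η 0) hSfin ⟨a, ha, by omega, le_refl _⟩
  have hpos : ∀ θ ∈ supp g, θ 1 < b 1 → 0 < θ 0 := by
    intro θ hθ h
    refine Nat.pos_of_ne_zero fun h1 => ?_
    have := hbmin θ hθ h1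
    omega
  have hηpos := hpos η hη hη1
  have hineq : ∀ θ ∈ supp g, ((b 1 : ℚ) - θ 1) * η 0 ≤ (b 1 - η 1) * θ 0 := by
    intro θ hθ
    have e1 : (0 : ℚ) < η 0 := by exact_mod_cast hηpos
    have e3 : (η 1 : ℚ) < b 1 := by exact_mod_cast hη1
    by_cases h : θ 1 < b 1
    · have e2 : (0 : ℚ) < θ 0 := by exact_mod_cast hpos θ hθ h
      have e4 : (0 : ℚ) < a 0 := by exact_mod_cast hapos
      have hm : ((b 1 : ℚ) - θ 1) / θ 0 ≤ (b 1 - η 1) / η 0 := by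
        by_cases h2 : θ 0 ≤ a 0
        · exact hmax θ ⟨hθ, h, h2⟩
        · have h3 := hmax a ⟨ha, by omega, le_refl _⟩
          refine le_trans ?_ h3
          push Not at h2
          have e5 : (a 0 : ℚ) ≤ θ 0 := by exact_mod_cast h2.le
          have e6 : (0 : ℚ) ≤ θ 1 := by positivity
          have e7 : (0 : ℚ) ≤ b 1 := by positivity
          simp only [ha1, Nat.cast_zero, sub_zero]
          gcongr
          linarith
      rwa [div_le_div_iff₀ e2 e1] at hm
    · have e4 : (b 1 : ℚ) ≤ θ 1 := by exact_mod_cast not_lt.1 h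
      have e5 : (0 : ℚ) ≤ θ 0 := by positivity
      have := mul_nonneg (sub_nonneg.2 e3.le) e5
      have := mul_nonneg (sub_nonneg.2 e4) e1.le
      linarith
  have hineq' : ∀ θ ∈ supp g, b 1 * η 0 ≤ (b 1 - η 1) * θ 0 + η 0 * θ 1 := by
    intro θ hθ
    have h1 := hineq θ hθ
    have : ((b 1 * η 0 : ℕ) : ℚ) ≤ ((b 1 - η 1) * θ 0 + η 0 * θ 1 : ℕ) := by
      push_cast [Nat.cast_sub hη1.le]
      linarith
    exact_mod_cast this
  -- The normal vector of the segment from `b` to `η`.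
  let β : Fin 2 → ℕ := ![b 1 - η 1, η 0]
  have hw : ∀ θ : Fin 2 →₀ ℕ, Finsupp.weight β θ = (b 1 - η 1) * θ 0 + η 0 * θ 1 := by
    intro θ
    rw [weight_eq]; rfl
  have hwb : Finsupp.weight β b = b 1 * η 0 := by rw [hw, hb0]; ring
  have hnu : nu β g = b 1 * η 0 := by
    apply le_antisymm
    · rw [← hwb]; exact nu_le β hb
    · exact le_nu hg fun θ hθ => by rw [hw]; exact hineq' θ hθ
  refine ⟨β, fun v => ?_, b, ⟨hb, by rw [hwb, hnu]⟩, η, ⟨hη, ?_⟩, ?_⟩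
  · fin_cases v
    · change 1 ≤ b 1 - η 1; omega
    · exact hηpos
  · rw [hw, hnu, Nat.sub_mul]
    have := Nat.mul_le_mul_right (η 0) hη1.le
    rw [mul_comm (η 0) (η 1)]
    omega
  · rintro rfl
    omega

/-- A factor divisible by neither variable puts some weight `β` into `T(F)`. As `T(F)` is a
half-line, `α` is parallel to `β`, and parallel weights have the same minimal exponents. -/
theorem minSet_nontrivial_of_isSemiLine [IsAlgClosed k] {g F : MvPowerSeries (Fin 2) k}
    (hF : F ≠ 0) (hgF : g ∣ F) (hL : IsSemiLine (tropicalVariety F))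
    (h0 : MvPowerSeries.constantCoeff g = 0) (hX : ∀ v, ¬ MvPowerSeries.X v ∣ g)
    {α : Fin 2 → ℕ} (hα : ∀ v, 1 ≤ α v) (h : castPlane α ∈ tropicalVariety F) :
    (minSet α g).Nontrivial := by
  obtain ⟨h', rfl⟩ := hgF
  have hg : g ≠ 0 := left_ne_zero_of_mul hF
  have hh : h' ≠ 0 := right_ne_zero_of_mul hF
  obtain ⟨β, hβ, hn⟩ := exists_minSet_nontrivial hg h0 hX
  have h1 : castPlane β ∈ tropicalVariety (g * h') := by
    have := (castPlane_mem_tropicalVariety_prod hβ Finset.univ ![g, h'] (fun i _ => by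
      fin_cases i <;> simp [hg, hh])).2 ⟨0, Finset.mem_univ _,
        (castPlane_mem_tropicalVariety_iff hβ hg).2 hn⟩
    simpa [Fin.prod_univ_two] using this
  rw [minSet_eq_of_parallel hα hβ (hL.parallel h h1) hg]
  exact hn


/-! ### Hensel's lemma for weighted initial forms -/

/-- The binomial `(x/p₀)^{e₀} - (y/p₁)^{e₁}`. -/
def branchPoly (e : Fin 2 → ℕ) (p : Fin 2 → k) : MvPolynomial (Fin 2) k :=
  (MvPolynomial.C (p 0)⁻¹ * MvPolynomial.X 0) ^ e 0 -
    (MvPolynomial.C (p 1)⁻¹ * MvPolynomial.X 1) ^ e 1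

/-- The monomial of exponent `η`, scaled so that it takes the value `1` at `p`. -/
def scaledMonomial (p : Fin 2 → k) (η : Fin 2 →₀ ℕ) : MvPolynomial (Fin 2) k :=
  (MvPolynomial.C (p 0)⁻¹ * MvPolynomial.X 0) ^ η 0 *
    (MvPolynomial.C (p 1)⁻¹ * MvPolynomial.X 1) ^ η 1

theorem eval_scaledMonomial {p : Fin 2 → k} (hp : ∀ v, p v ≠ 0) (η : Fin 2 →₀ ℕ) :
    MvPolynomial.eval p (scaledMonomial p η) = 1 := by
  simp [scaledMonomial, hp]

theorem monomial_eq_scaledMonomial {p : Fin 2 → k} (hp : ∀ v, p v ≠ 0) (η : Fin 2 →₀ ℕ) (c : k) :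
    MvPolynomial.monomial η c =
      MvPolynomial.C (MvPolynomial.eval p (MvPolynomial.monomial η c)) * scaledMonomial p η := by
  rw [MvPolynomial.monomial_eq, Finsupp.prod_fintype _ _ (by simp), Fin.prod_univ_two,
    scaledMonomial]
  simp only [map_mul, map_pow, MvPolynomial.eval_C, MvPolynomial.eval_X, mul_pow]
  have h : ∀ (v : Fin 2) (n : ℕ), (MvPolynomial.C (p v) : MvPolynomial (Fin 2) k) ^ n *
      MvPolynomial.C (p v)⁻¹ ^ n = 1 := by
    intro v n
    rw [← mul_pow, ← map_mul, mul_inv_cancel₀ (hp v), map_one, one_pow]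
  linear_combination (-MvPolynomial.C c * MvPolynomial.X 0 ^ η 0 * MvPolynomial.X 1 ^ η 1 *
    MvPolynomial.C (p 1) ^ η 1 * MvPolynomial.C (p 1)⁻¹ ^ η 1) * h 0 (η 0) +
    (-MvPolynomial.C c * MvPolynomial.X 0 ^ η 0 * MvPolynomial.X 1 ^ η 1) * h 1 (η 1)

theorem isWeightedHomogeneous_scaled_pow (w : Fin 2 → ℕ) (p : Fin 2 → k) (v : Fin 2) (n : ℕ) :
    MvPolynomial.IsWeightedHomogeneous w
      ((MvPolynomial.C (p v)⁻¹ * MvPolynomial.X v : MvPolynomial (Fin 2) k) ^ n) (n * w v) := by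
  have := ((MvPolynomial.isWeightedHomogeneous_C w (p v)⁻¹).mul
    (MvPolynomial.isWeightedHomogeneous_X k w v)).pow n
  simpa using this

theorem isWeightedHomogeneous_scaledMonomial (w : Fin 2 → ℕ) (p : Fin 2 → k) (η : Fin 2 →₀ ℕ) :
    MvPolynomial.IsWeightedHomogeneous w (scaledMonomial p η) (Finsupp.weight w η) := by
  have := (isWeightedHomogeneous_scaled_pow w p 0 (η 0)).mul
    (isWeightedHomogeneous_scaled_pow w p 1 (η 1))
  rw [weight_eq, mul_comm (w 0), mul_comm (w 1)]
  exact this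

theorem isWeightedHomogeneous_branchPoly {w e : Fin 2 → ℕ} (h : e 0 * w 0 = e 1 * w 1)
    (p : Fin 2 → k) : MvPolynomial.IsWeightedHomogeneous w (branchPoly e p) (e 0 * w 0) := by
  refine (MvPolynomial.weightedHomogeneousSubmodule k w _).sub_mem ?_ ?_
  · exact isWeightedHomogeneous_scaled_pow w p 0 (e 0)
  · rw [h]; exact isWeightedHomogeneous_scaled_pow w p 1 (e 1)

theorem eval_branchPoly {p : Fin 2 → k} (hp : ∀ v, p v ≠ 0) (e : Fin 2 → ℕ) :
    MvPolynomial.eval p (branchPoly e p) = 0 := by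
  simp [branchPoly, hp]

/-- By coprimality, two exponents of equal weight differ by a multiple of `(w₁, -w₀)`, and `u - v`
divides `uⁿ - vⁿ`. -/
theorem branchPoly_dvd_scaledMonomial_sub {w : Fin 2 → ℕ} (hw : ∀ v, 1 ≤ w v)
    (hco : (w 0).Coprime (w 1)) (p : Fin 2 → k) {η θ : Fin 2 →₀ ℕ}
    (h : Finsupp.weight w η = Finsupp.weight w θ) :
    branchPoly ![w 1, w 0] p ∣ scaledMonomial p η - scaledMonomial p θ := by
  wlog hle : θ 0 ≤ η 0 generalizing η θ
  · rw [← neg_sub, dvd_neg]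
    exact this h.symm (not_le.1 hle).le
  obtain ⟨i, hi⟩ := Nat.exists_eq_add_of_le hle
  rw [weight_eq, weight_eq, hi] at h
  have h1 : w 1 * η 1 ≤ w 1 * θ 1 := by nlinarith
  obtain ⟨j, hj⟩ := Nat.exists_eq_add_of_le (Nat.le_of_mul_le_mul_left h1 (hw 1))
  have h2 : w 0 * i = w 1 * j := by rw [hj] at h; nlinarith
  obtain ⟨n, rfl⟩ : w 1 ∣ i := hco.symm.dvd_of_dvd_mul_left ⟨j, h2⟩
  have h3 : j = w 0 * n :=
    Nat.eq_of_mul_eq_mul_left (hw 1) (by rw [← h2]; ring)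
  have h4 : scaledMonomial p η - scaledMonomial p θ =
      (MvPolynomial.C (p 0)⁻¹ * MvPolynomial.X 0) ^ θ 0 *
      (MvPolynomial.C (p 1)⁻¹ * MvPolynomial.X 1) ^ η 1 *
      (((MvPolynomial.C (p 0)⁻¹ * MvPolynomial.X 0) ^ w 1) ^ n -
        ((MvPolynomial.C (p 1)⁻¹ * MvPolynomial.X 1) ^ w 0) ^ n) := by
    rw [scaledMonomial, scaledMonomial, hi, hj, h3]
    ring
  rw [h4]
  exact Dvd.dvd.mul_left (sub_dvd_pow_sub_pow _ _ n) _

/-- Modulo the binomial, all monomials of weight `d` scaled to the value `1` at `p` coincide, so a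
homogeneous `h` is determined by its value at `p`. -/
theorem branchPoly_dvd_sub {w : Fin 2 → ℕ} (hw : ∀ v, 1 ≤ w v)
    (hco : (w 0).Coprime (w 1)) {p : Fin 2 → k} (hp : ∀ v, p v ≠ 0)
    {h : MvPolynomial (Fin 2) k} {d : ℕ} (hh : MvPolynomial.IsWeightedHomogeneous w h d)
    {θ : Fin 2 →₀ ℕ} (hθ : Finsupp.weight w θ = d) :
    branchPoly ![w 1, w 0] p ∣
      h - MvPolynomial.C (MvPolynomial.eval p h) * scaledMonomial p θ := by
  have h1 : h - MvPolynomial.C (MvPolynomial.eval p h) * scaledMonomial p θ =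
      ∑ η ∈ h.support, MvPolynomial.C (MvPolynomial.eval p
        (MvPolynomial.monomial η (MvPolynomial.coeff η h))) *
          (scaledMonomial p η - scaledMonomial p θ) := by
    simp_rw [mul_sub]
    rw [Finset.sum_sub_distrib, ← Finset.sum_mul, ← map_sum, ← map_sum, ← h.as_sum]
    congr 1
    conv_lhs => rw [h.as_sum]
    exact Finset.sum_congr rfl fun η _ => monomial_eq_scaledMonomial hp η _
  rw [h1]
  refine Finset.dvd_sum fun η hη => Dvd.dvd.mul_left ?_ _
  exact branchPoly_dvd_scaledMonomial_sub hw hco p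
    ((hh (MvPolynomial.mem_support_iff.1 hη)).trans hθ.symm)

/-- The quotient given by `branchPoly_dvd_sub` need not be homogeneous; comparing weighted
components allows its component of weight `M` to replace it, and shows `h = 0` if `d < w₁ w₀`. -/
theorem exists_quotient_branchPoly {w : Fin 2 → ℕ} (hw : ∀ v, 1 ≤ w v)
    (hco : (w 0).Coprime (w 1)) {p : Fin 2 → k} (hp : ∀ v, p v ≠ 0)
    {h : MvPolynomial (Fin 2) k} {d : ℕ} (hh : MvPolynomial.IsWeightedHomogeneous w h d)
    (h0 : MvPolynomial.eval p h = 0) (hne : h ≠ 0) :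
    ∃ (M : ℕ) (q : MvPolynomial (Fin 2) k), d = w 1 * w 0 + M ∧
      MvPolynomial.IsWeightedHomogeneous w q M ∧ h = branchPoly ![w 1, w 0] p * q := by
  obtain ⟨θ, hθ⟩ := MvPolynomial.support_nonempty.2 hne
  have h1 := branchPoly_dvd_sub hw hco hp hh (hh (MvPolynomial.mem_support_iff.1 hθ))
  rw [h0, map_zero, zero_mul, sub_zero] at h1
  obtain ⟨q, hq⟩ := h1
  have hP := isWeightedHomogeneous_branchPoly (w := w) (e := ![w 1, w 0])
    (show w 1 * w 0 = w 0 * w 1 from mul_comm _ _) p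
  have h2 := comp_of_isWeightedHomogeneous hw hh d
  rw [if_pos rfl, congrArg MvPolynomial.toMvPowerSeries hq, MvPolynomial.coe_mul,
    comp_mul hw] at h2
  simp_rw [comp_of_isWeightedHomogeneous hw hP] at h2
  by_cases hd : w 1 * w 0 ≤ d
  · obtain ⟨M, rfl⟩ := Nat.exists_eq_add_of_le hd
    refine ⟨M, comp w M (q : MvPowerSeries (Fin 2) k), rfl, isWeightedHomogeneous_comp _ _ _, ?_⟩
    rw [← h2, Finset.sum_eq_single (w 1 * w 0, M)]
    · simp
    · rintro ⟨i, j⟩ hij hn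
      have hij := Finset.HasAntidiagonal.mem_antidiagonal.1 hij
      have : i ≠ w 1 * w 0 := by
        rintro rfl
        exact hn (Prod.ext rfl (by simpa using hij))
      simp [this]
    · simp
  · exfalso
    apply hne
    rw [← h2]
    refine Finset.sum_eq_zero ?_
    rintro ⟨i, j⟩ hij
    have hij := Finset.HasAntidiagonal.mem_antidiagonal.1 hij
    have : i ≠ w 1 * w 0 := by
      rintro rfl
      simp at hij; omega
    simp [this]

/-- From `w₁ w₀` on, every integer lies in the semigroup generated by the coprime weights. -/
theorem exists_weight_eq {w : Fin 2 → ℕ} (hw : ∀ v, 1 ≤ w v) (hco : (w 0).Coprime (w 1)) {d : ℕ}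
    (hd : w 1 * w 0 ≤ d) : ∃ η : Fin 2 →₀ ℕ, Finsupp.weight w η = d := by
  have : NeZero (w 1) := ⟨by have := hw 1; omega⟩
  -- The solution `i < w₁` of `w₀ i ≡ d` modulo `w₁`; then `w₀ i ≤ d` and the rest is a multiple of
  -- `w₁`.
  let i : ℕ := ((d : ZMod (w 1)) * (w 0 : ZMod (w 1))⁻¹).val
  have hi : i < w 1 := ZMod.val_lt _
  have h1 : ((w 0 * i : ℕ) : ZMod (w 1)) = (d : ℕ) := by
    rw [Nat.cast_mul, ZMod.natCast_zmod_val, mul_comm, mul_assoc, mul_comm _ (w 0 : ZMod (w 1)),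
      ZMod.coe_mul_inv_eq_one _ hco, mul_one]
  have h2 : w 0 * i ≤ d := by nlinarith
  rw [ZMod.natCast_eq_natCast_iff] at h1
  obtain ⟨j, hj⟩ := (Nat.modEq_iff_dvd' h2).1 h1
  refine ⟨Finsupp.equivFunOnFinite.symm ![i, j], ?_⟩
  rw [weight_eq]
  simp
  omega

/-- Strong recursion in a form where the step may mention the whole sequence but depends only on the
earlier terms. -/
theorem exists_eq_strong_rec {β : Type*} [Inhabited β] (step : ℕ → (ℕ → β) → β)
    (h : ∀ n f g, (∀ i < n, f i = g i) → step n f = step n g) :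
    ∃ f : ℕ → β, ∀ n, f n = step n f := by
  let G : (n : ℕ) → ((m : ℕ) → m < n → β) → β :=
    fun n ih => step n fun i => if hi : i < n then ih i hi else default
  refine ⟨fun n => Nat.lt_wfRel.wf.fix G n, fun n => ?_⟩
  change Nat.lt_wfRel.wf.fix G n = _
  rw [WellFounded.fix_eq]
  exact h n _ _ fun i hi => by simp [hi]

/-- The power series with prescribed weighted components. -/
def ofComp (w : Fin 2 → ℕ) (c : ℕ → MvPolynomial (Fin 2) k) : MvPowerSeries (Fin 2) k :=
  fun η => MvPolynomial.coeff η (c (Finsupp.weight w η))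

theorem comp_ofComp {w : Fin 2 → ℕ} (hw : ∀ v, 1 ≤ w v) {c : ℕ → MvPolynomial (Fin 2) k}
    {d : ℕ} (hc : MvPolynomial.IsWeightedHomogeneous w (c d) d) : comp w d (ofComp w c) = c d := by
  ext η
  rw [coeff_comp hw]
  split_ifs with h
  · rw [← h]; rfl
  · by_contra h1
    exact h (hc (Ne.symm h1))

theorem exists_grading_eq {w : Fin 2 → ℕ} (hw : ∀ v, 1 ≤ w v) (D : ℕ)
    {a : ℕ → MvPolynomial (Fin 2) k}
    (ha : ∀ n, MvPolynomial.IsWeightedHomogeneous w (a n) (D + n)) :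
    ∃ A : MvPowerSeries (Fin 2) k,
      grading w hw A = PowerSeries.X ^ D * PowerSeries.mk a := by
  refine ⟨ofComp w fun d => if D ≤ d then a (d - D) else 0, ?_⟩
  ext1 d
  rw [coeff_grading, PowerSeries.coeff_X_pow_mul', comp_ofComp hw]
  · simp
  · split_ifs with h
    · have := ha (d - D)
      rwa [Nat.add_sub_cancel' h] at this
    · exact MvPolynomial.isWeightedHomogeneous_zero _ _ _

theorem grading_injective {w : Fin 2 → ℕ} (hw : ∀ v, 1 ≤ w v) :
    Function.Injective (grading (k := k) w hw) := by
  intro g h hgh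
  ext η
  have := congrArg (fun q => MvPolynomial.coeff η (PowerSeries.coeff (Finsupp.weight w η) q)) hgh
  simpa [coeff_grading, coeff_comp hw] using this

/-- The correction step of the lifting. Take `x.1` a multiple of one monomial, with scalar such that
`h - x.1 Q` vanishes at `p`; the difference is then divisible by the binomial. The monomial exists
since its weight is at least `w₁ w₀`. -/
theorem solve_branchPoly {w : Fin 2 → ℕ} (hw : ∀ v, 1 ≤ w v)
    (hco : (w 0).Coprime (w 1)) {p : Fin 2 → k} (hp : ∀ v, p v ≠ 0)
    {Q : MvPolynomial (Fin 2) k} {M : ℕ} (hQ : MvPolynomial.IsWeightedHomogeneous w Q M)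
    (hQp : MvPolynomial.eval p Q ≠ 0) (n : ℕ) {h : MvPolynomial (Fin 2) k}
    (hh : MvPolynomial.IsWeightedHomogeneous w h (w 1 * w 0 + M + n)) :
    ∃ x : MvPolynomial (Fin 2) k × MvPolynomial (Fin 2) k,
      MvPolynomial.IsWeightedHomogeneous w x.1 (w 1 * w 0 + n) ∧
      MvPolynomial.IsWeightedHomogeneous w x.2 (M + n) ∧
      branchPoly ![w 1, w 0] p * x.2 + x.1 * Q = h := by
  obtain ⟨η, hη⟩ := exists_weight_eq hw hco (Nat.le_add_right (w 1 * w 0) n)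
  set x : MvPolynomial (Fin 2) k := MvPolynomial.C
    (MvPolynomial.eval p h / MvPolynomial.eval p Q) * scaledMonomial p η with hxdef
  have hx : MvPolynomial.IsWeightedHomogeneous w x (w 1 * w 0 + n) := by
    have := (MvPolynomial.isWeightedHomogeneous_C w
      (MvPolynomial.eval p h / MvPolynomial.eval p Q)).mul
        (isWeightedHomogeneous_scaledMonomial w p η)
    rwa [hη, zero_add] at this
  have hd : MvPolynomial.IsWeightedHomogeneous w (h - x * Q) (w 1 * w 0 + M + n) := by
    refine (MvPolynomial.weightedHomogeneousSubmodule k w _).sub_mem hh ?_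
    have := hx.mul hQ
    rwa [show w 1 * w 0 + n + M = w 1 * w 0 + M + n by ring] at this
  have h0 : MvPolynomial.eval p (h - x * Q) = 0 := by
    simp [x, eval_scaledMonomial hp, hQp]
  by_cases hne : h - x * Q = 0
  · exact ⟨(x, 0), hx, MvPolynomial.isWeightedHomogeneous_zero _ _ _, by
      simpa using (sub_eq_zero.1 hne).symm⟩
  · obtain ⟨M', q, h1, h2, h3⟩ := exists_quotient_branchPoly hw hco hp hd h0 hne
    have : M' = M + n := by omega
    subst this
    exact ⟨(x, q), hx, h2, by simp only; rw [← h3]; ring⟩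

/-- Hensel lifting by weights instead of degrees: the factorization of the initial form extends
component by component, `Q(p) ≠ 0` playing the role of coprimality. -/
theorem exists_lift_factorization {w : Fin 2 → ℕ} (hw : ∀ v, 1 ≤ w v)
    (hco : (w 0).Coprime (w 1)) {p : Fin 2 → k} (hp : ∀ v, p v ≠ 0)
    {g : MvPowerSeries (Fin 2) k} {Q : MvPolynomial (Fin 2) k} {M : ℕ}
    (hQ : MvPolynomial.IsWeightedHomogeneous w Q M) (hnu : nu w g = w 1 * w 0 + M)
    (hin : initForm w g = branchPoly ![w 1, w 0] p * Q) (hQp : MvPolynomial.eval p Q ≠ 0) :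
    ∃ A B : MvPowerSeries (Fin 2) k, g = A * B ∧
      (∃ a, grading w hw A = PowerSeries.X ^ (w 1 * w 0) * a) ∧
      ∃ b, grading w hw B = PowerSeries.X ^ M * b := by
  set P := branchPoly ![w 1, w 0] p with hPdef
  have hP : MvPolynomial.IsWeightedHomogeneous w P (w 1 * w 0) :=
    isWeightedHomogeneous_branchPoly (w := w) (e := ![w 1, w 0])
      (show w 1 * w 0 = w 0 * w 1 from mul_comm _ _) p
  -- Homogeneity is moved inside the conclusion so that the choice of solutions is a total function.
  have hsol : ∀ (n : ℕ) (h : MvPolynomial (Fin 2) k),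
      ∃ x : MvPolynomial (Fin 2) k × MvPolynomial (Fin 2) k,
        MvPolynomial.IsWeightedHomogeneous w h (w 1 * w 0 + M + n) →
        MvPolynomial.IsWeightedHomogeneous w x.1 (w 1 * w 0 + n) ∧
        MvPolynomial.IsWeightedHomogeneous w x.2 (M + n) ∧ P * x.2 + x.1 * Q = h := by
    intro n h
    by_cases hh : MvPolynomial.IsWeightedHomogeneous w h (w 1 * w 0 + M + n)
    · obtain ⟨x, hx⟩ := solve_branchPoly hw hco hp hQ hQp n hh
      exact ⟨x, fun _ => hx⟩
    · exact ⟨0, fun h => absurd h hh⟩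
  choose sol hsol using hsol
  -- The component of `g` minus the products of earlier terms; the two extreme products, with `P`
  -- and with `Q`, contain the unknowns.
  let rem : ℕ → (ℕ → MvPolynomial (Fin 2) k × MvPolynomial (Fin 2) k) → MvPolynomial (Fin 2) k :=
    fun n f => comp w (w 1 * w 0 + M + n) g -
      ∑ i ∈ Finset.range (n - 1), (f (i + 1)).1 * (f (n - 1 - i)).2
  obtain ⟨f, hf⟩ := exists_eq_strong_rec
    (fun n f => if n = 0 then (P, Q) else sol n (rem n f)) (by
      intro n f g hfg
      by_cases hn : n = 0
      · simp [hn]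
      · simp only [hn, if_false, rem]
        congr 2
        refine Finset.sum_congr rfl fun i hi => ?_
        have := Finset.mem_range.1 hi
        rw [hfg _ (by omega), hfg _ (by omega)])
  have hf0 : f 0 = (P, Q) := by rw [hf]; simp
  have hwh : ∀ n, MvPolynomial.IsWeightedHomogeneous w (f n).1 (w 1 * w 0 + n) ∧
      MvPolynomial.IsWeightedHomogeneous w (f n).2 (M + n) ∧
      ∑ q ∈ Finset.HasAntidiagonal.antidiagonal n, (f q.1).1 * (f q.2).2 =
        comp w (w 1 * w 0 + M + n) g := by
    intro n
    induction n using Nat.strong_induction_on with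
    | _ n ih =>
      rcases n with - | n
      · rw [hf0]
        refine ⟨hP, hQ, ?_⟩
        simp only [Finset.HasAntidiagonal.antidiagonal_zero, Finset.sum_singleton, hf0, add_zero]
        rw [← hnu]
        exact hin.symm
      · have hrem : MvPolynomial.IsWeightedHomogeneous w (rem (n + 1) f)
            (w 1 * w 0 + M + (n + 1)) := by
          refine (MvPolynomial.weightedHomogeneousSubmodule k w _).sub_mem
            (isWeightedHomogeneous_comp _ _ _) (Submodule.sum_mem _ fun i hi => ?_)
          have hi := Finset.mem_range.1 hi
          have := (ih (i + 1) (by omega)).1.mul (ih (n + 1 - 1 - i) (by omega)).2.1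
          rwa [show w 1 * w 0 + (i + 1) + (M + (n + 1 - 1 - i)) = w 1 * w 0 + M + (n + 1) by
            omega] at this
        have h1 := hsol (n + 1) (rem (n + 1) f) hrem
        have h2 : f (n + 1) = sol (n + 1) (rem (n + 1) f) := by rw [hf]; simp
        rw [← h2] at h1
        refine ⟨h1.1, h1.2.1, ?_⟩
        rw [Finset.Nat.sum_antidiagonal_eq_sum_range_succ (fun i j => (f i).1 * (f j).2),
          Finset.sum_range_succ, Finset.sum_range_succ', Nat.sub_self, Nat.sub_zero, hf0]
        have h3 := h1.2.2
        simp only [rem, Nat.add_sub_cancel] at h3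
        have h4 : ∑ i ∈ Finset.range n, (f (i + 1)).1 * (f (n + 1 - (i + 1))).2 =
            ∑ i ∈ Finset.range n, (f (i + 1)).1 * (f (n - i)).2 :=
          Finset.sum_congr rfl fun i _ => by rw [Nat.add_sub_add_right]
        rw [h4]
        linear_combination h3
  obtain ⟨A, hA⟩ := exists_grading_eq hw (w 1 * w 0) (a := fun n => (f n).1) fun n => (hwh n).1
  obtain ⟨B, hB⟩ := exists_grading_eq hw M (a := fun n => (f n).2) fun n => (hwh n).2.1
  refine ⟨A, B, grading_injective hw ?_, ⟨_, hA⟩, ⟨_, hB⟩⟩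
  rw [map_mul, hA, hB]
  have h1 : (PowerSeries.mk fun n => (f n).1) * (PowerSeries.mk fun n => (f n).2) =
      PowerSeries.mk fun n => comp w (w 1 * w 0 + M + n) g := by
    ext1 n
    rw [PowerSeries.coeff_mul, PowerSeries.coeff_mk, ← (hwh n).2.2]
    simp
  calc grading w hw g = PowerSeries.X ^ (w 1 * w 0 + M) *
        PowerSeries.mk fun n => comp w (w 1 * w 0 + M + n) g := by
        ext1 d
        rw [coeff_grading, PowerSeries.coeff_X_pow_mul']
        split_ifs with hd
        · rw [PowerSeries.coeff_mk, Nat.add_sub_cancel' hd]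
        · exact comp_eq_zero_of_lt hw (by omega)
    _ = _ := by rw [← h1]; ring

theorem constantCoeff_eq_grading {w : Fin 2 → ℕ} (hw : ∀ v, 1 ≤ w v)
    (g : MvPowerSeries (Fin 2) k) : MvPowerSeries.constantCoeff g =
      MvPolynomial.coeff 0 (PowerSeries.coeff 0 (grading w hw g)) := by
  rw [coeff_grading, coeff_comp hw]
  simp

/-- The zero is smooth, so the binomial divides the initial form only once and the factorization
lifts. The factor belonging to the binomial is not a unit, so the other one is, and `Q` is a
constant. -/
theorem Irreducible.initForm_eq {w : Fin 2 → ℕ} (hw : ∀ v, 1 ≤ w v)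
    (hco : (w 0).Coprime (w 1)) {p : Fin 2 → k} (hp : ∀ v, p v ≠ 0)
    {g : MvPowerSeries (Fin 2) k} (hg : Irreducible g)
    (h0 : MvPolynomial.eval p (initForm w g) = 0)
    (hsm : ∃ v, MvPolynomial.eval p (MvPolynomial.pderiv v (initForm w g)) ≠ 0) :
    ∃ c : k, c ≠ 0 ∧ initForm w g = MvPolynomial.C c * branchPoly ![w 1, w 0] p := by
  have hne := initForm_ne_zero hw hg.ne_zero
  obtain ⟨M, Q, hM, hQ, hin⟩ := exists_quotient_branchPoly hw hco hp
    (isWeightedHomogeneous_comp w (nu w g) g) h0 hne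
  have hin : initForm w g = branchPoly ![w 1, w 0] p * Q := hin
  have hQp : MvPolynomial.eval p Q ≠ 0 := by
    intro hQ0
    obtain ⟨v, hv⟩ := hsm
    apply hv
    rw [hin, Derivation.leibniz]
    simp [hQ0, eval_branchPoly hp]
  obtain ⟨A, B, rfl, ⟨a, ha⟩, ⟨b, hb⟩⟩ := exists_lift_factorization hw hco hp hQ hM hin hQp
  have hApos : 0 < w 1 * w 0 := Nat.mul_pos (hw 1) (hw 0)
  have hA : ¬ IsUnit A := by
    rw [MvPowerSeries.isUnit_iff_constantCoeff, constantCoeff_eq_grading hw, ha,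
      PowerSeries.coeff_X_pow_mul', if_neg (by omega)]
    simp
  have hB := (hg.isUnit_or_isUnit rfl).resolve_left hA
  rw [MvPowerSeries.isUnit_iff_constantCoeff, constantCoeff_eq_grading hw, hb,
      PowerSeries.coeff_X_pow_mul'] at hB
  have hM0 : M = 0 := by
    by_contra h
    rw [if_neg (by omega)] at hB
    simp at hB
  subst hM0
  have hQC : Q = MvPolynomial.C (MvPolynomial.coeff 0 Q) := by
    ext η
    rw [MvPolynomial.coeff_C]
    split_ifs with h
    · rw [h]
    · by_contra h1
      apply h
      have h2 := hQ h1
      ext v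
      have := le_weight hw η v
      simp; omega
  refine ⟨MvPolynomial.coeff 0 Q, fun h => hQp (by rw [hQC, h]; simp), ?_⟩
  rw [hin, mul_comm, ← hQC]

/-- The initial form of `g` for the weight `α` is `c ((x/p₀)^{e₀} - (y/p₁)^{e₁})` with coprime
exponents. -/
structure HasBranchForm (α : Fin 2 → ℕ) (g : MvPowerSeries (Fin 2) k) (e : Fin 2 → ℕ)
    (p : Fin 2 → k) (c : k) : Prop where
  pos : ∀ v, 1 ≤ α v
  one_le : ∀ v, 1 ≤ e v
  coprime : (e 0).Coprime (e 1)
  weight : e 0 * α 0 = e 1 * α 1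
  torus : ∀ v, p v ≠ 0
  ne_zero : c ≠ 0
  eq : initForm α g = MvPolynomial.C c * branchPoly e p
  nu_eq : nu α g = e 0 * α 0

theorem initForm_eq_of_parallel {α β : Fin 2 → ℕ} (hα : ∀ v, 1 ≤ α v) (hβ : ∀ v, 1 ≤ β v)
    (h : α 0 * β 1 = α 1 * β 0) {g : MvPowerSeries (Fin 2) k} (hg : g ≠ 0) :
    initForm α g = initForm β g := by
  ext η
  rw [coeff_initForm hα, coeff_initForm hβ]
  have := minSet_eq_of_parallel hα hβ h hg
  by_cases hη : η ∈ supp g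
  · have h1 : (Finsupp.weight α η = nu α g) ↔ Finsupp.weight β η = nu β g := by
      have := Set.ext_iff.1 this η
      simpa [minSet, hη] using this
    simp [h1]
  · have : MvPowerSeries.coeff η g = 0 := not_not.1 hη
    simp [this]

/-- The initial form depends only on the direction of `α`, so `α` is divided by its gcd; the
exponents are the primitive weights interchanged. -/
theorem Irreducible.hasBranchForm {α : Fin 2 → ℕ} (hα : ∀ v, 1 ≤ α v)
    {p : Fin 2 → k} (hp : ∀ v, p v ≠ 0) {g : MvPowerSeries (Fin 2) k} (hg : Irreducible g)
    (h0 : MvPolynomial.eval p (initForm α g) = 0)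
    (hsm : ∃ v, MvPolynomial.eval p (MvPolynomial.pderiv v (initForm α g)) ≠ 0) :
    ∃ (e : Fin 2 → ℕ) (c : k), HasBranchForm α g e p c := by
  have hs : 0 < (α 0).gcd (α 1) := Nat.gcd_pos_of_pos_left _ (hα 0)
  obtain ⟨s, a, b, hs, hco, ha, hb⟩ := Nat.exists_coprime' hs
  have ha1 : 1 ≤ a := Nat.pos_of_ne_zero fun h => by
    have := hα 0; rw [ha, h] at this; omega
  have hb1 : 1 ≤ b := Nat.pos_of_ne_zero fun h => by
    have := hα 1; rw [hb, h] at this; omega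
  have hw : ∀ v, 1 ≤ (![a, b] : Fin 2 → ℕ) v := fun v => by fin_cases v <;> simp [ha1, hb1]
  have hin := initForm_eq_of_parallel (α := α) (β := ![a, b]) hα hw (by
    simp [ha, hb]; ring) hg.ne_zero
  rw [hin] at h0 hsm
  obtain ⟨c, hc, h1⟩ := Irreducible.initForm_eq hw hco hp hg h0 hsm
  refine ⟨![b, a], c, hα, fun v => by fin_cases v <;> simp [ha1, hb1], hco.symm, ?_, hp, hc,
    hin.trans h1, ?_⟩
  · simp [ha, hb]; ring
  · have h2 : initForm α g ≠ 0 := initForm_ne_zero hα hg.ne_zero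
    have h3 : MvPolynomial.IsWeightedHomogeneous α (initForm α g) (nu α g) :=
      isWeightedHomogeneous_comp _ _ _
    have h4 : MvPolynomial.IsWeightedHomogeneous α (initForm α g) (b * α 0) := by
      rw [hin, h1]
      have := (MvPolynomial.isWeightedHomogeneous_C α c).mul
        (isWeightedHomogeneous_branchPoly (w := α) (e := ![b, a])
          (show b * α 0 = a * α 1 by rw [ha, hb]; ring) p)
      simpa using this
    exact h3.inj_right h2 h4


/-! ### Values of power series at jets -/

section Jets

variable {m : ℕ} {A : Type*} [CommRing A] [Algebra k A]

/-- The value `g(x(t), y(t))` of a power series at the jet with coordinates given by `φ`. -/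
def jetEval (φ : JetRing k m →ₐ[k] A) : MvPowerSeries (Fin 2) k →+* PowerSeries A :=
  (PowerSeries.map φ.toRingHom).comp
    (MvPowerSeries.substAlgHom (hasSubst_jetSeries (k := k) m)).toRingHom

theorem jetEval_apply (φ : JetRing k m →ₐ[k] A) (g : MvPowerSeries (Fin 2) k) :
    jetEval φ g = PowerSeries.map φ.toRingHom
      (MvPowerSeries.subst (jetSeries k m) g : PowerSeries (JetRing k m)) := by
  rw [← MvPowerSeries.coe_substAlgHom (hasSubst_jetSeries (k := k) m)]
  rfl

theorem coeff_jetEval (φ : JetRing k m →ₐ[k] A) (g : MvPowerSeries (Fin 2) k) (n : ℕ) :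
    PowerSeries.coeff n (jetEval φ g) = φ (jetCoeff g m n) := by
  rw [jetEval_apply, PowerSeries.coeff_map]
  rfl

theorem jetEval_coe (φ : JetRing k m →ₐ[k] A) (q : MvPolynomial (Fin 2) k) :
    jetEval φ (q : MvPowerSeries (Fin 2) k) =
      MvPolynomial.aeval (fun v => PowerSeries.map φ.toRingHom (jetSeries k m v)) q := by
  rw [jetEval_apply, MvPowerSeries.subst_coe]
  have := MvPolynomial.comp_aeval_apply (R := k) (f := jetSeries k m)
    (PowerSeries.mapAlgHom φ) q
  exact this

theorem X_dvd_map_jetSeries (φ : JetRing k m →ₐ[k] A) (v : Fin 2) :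
    PowerSeries.X ∣ PowerSeries.map φ.toRingHom (jetSeries k m v) := by
  rw [PowerSeries.X_dvd_iff, ← PowerSeries.coeff_zero_eq_constantCoeff_apply,
    PowerSeries.coeff_map]
  simp [jetSeries]

theorem jetEval_X (φ : JetRing k m →ₐ[k] A) (v : Fin 2) :
    jetEval φ (MvPowerSeries.X v) = PowerSeries.map φ.toRingHom (jetSeries k m v) := by
  have := jetEval_coe φ (MvPolynomial.X v)
  rwa [MvPolynomial.coe_X, MvPolynomial.aeval_X] at this

/-- Such a `g` lies in the ideal `(x^N, y^N)`, and both coordinates of the jet are divisible by `t`.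
-/
theorem X_pow_dvd_jetEval (φ : JetRing k m →ₐ[k] A) {g : MvPowerSeries (Fin 2) k} {N : ℕ}
    (hg : ∀ η : Fin 2 →₀ ℕ, (∀ v, η v < N) → MvPowerSeries.coeff η g = 0) :
    PowerSeries.X ^ N ∣ jetEval φ g := by
  let g₀ : MvPowerSeries (Fin 2) k := fun η => if N ≤ η 0 then MvPowerSeries.coeff η g else 0
  let g₁ : MvPowerSeries (Fin 2) k := fun η => if N ≤ η 0 then 0 else MvPowerSeries.coeff η g
  have h0 : ∀ η, MvPowerSeries.coeff η g₀ =
    if N ≤ η 0 then MvPowerSeries.coeff η g else 0 := fun η => rfl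
  have h1 : ∀ η, MvPowerSeries.coeff η g₁ =
    if N ≤ η 0 then 0 else MvPowerSeries.coeff η g := fun η => rfl
  have hsum : g = g₀ + g₁ := by
    ext η
    rw [map_add, h0, h1]
    split_ifs <;> simp
  have key : ∀ v : Fin 2, PowerSeries.X ^ N ∣ jetEval φ (MvPowerSeries.X v ^ N) := by
    intro v
    rw [map_pow, jetEval_X]
    exact pow_dvd_pow_of_dvd (X_dvd_map_jetSeries φ v) N
  have d0 : MvPowerSeries.X 0 ^ N ∣ g₀ := by
    rw [MvPowerSeries.X_pow_dvd_iff]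
    intro η hη
    rw [h0, if_neg (not_le.2 hη)]
  have d1 : MvPowerSeries.X 1 ^ N ∣ g₁ := by
    rw [MvPowerSeries.X_pow_dvd_iff]
    intro η hη
    rw [h1]
    split_ifs with h
    · rfl
    · exact hg η fun v => by
        fin_cases v
        · exact not_le.1 h
        · exact hη
  rw [hsum, map_add]
  exact dvd_add ((key 0).trans (map_dvd _ d0)) ((key 1).trans (map_dvd _ d1))

theorem dvd_aeval_sub_aeval {σ B : Type*} [CommRing B] [Algebra k B] {a b : σ → B} {z : B}
    (h : ∀ v, z ∣ a v - b v) (q : MvPolynomial σ k) :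
    z ∣ MvPolynomial.aeval a q - MvPolynomial.aeval b q := by
  rw [← Ideal.mem_span_singleton, ← Ideal.Quotient.eq]
  have h1 := MvPolynomial.comp_aeval_apply (R := k) (f := a)
    (Ideal.Quotient.mkₐ k (Ideal.span {z})) q
  have h2 := MvPolynomial.comp_aeval_apply (R := k) (f := b)
    (Ideal.Quotient.mkₐ k (Ideal.span {z})) q
  rw [Ideal.Quotient.mkₐ_eq_mk] at h1 h2
  rw [h1, h2]
  congr 2
  funext v
  exact Ideal.Quotient.eq.2 (Ideal.mem_span_singleton.2 (h v))

/-- The sum of the values at `X` of the parts of weight at most `m`, each times the power of `t`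
given by its weight. -/
def gradedEval (α : Fin 2 → ℕ) (g : MvPowerSeries (Fin 2) k) (m : ℕ) (X : Fin 2 → PowerSeries A) :
    PowerSeries A :=
  ∑ d ∈ Finset.range (m + 1), PowerSeries.X ^ d * MvPolynomial.aeval X (comp α d g)

theorem gradedEval_add (α : Fin 2 → ℕ) (g h : MvPowerSeries (Fin 2) k) (m : ℕ)
    (X : Fin 2 → PowerSeries A) :
    gradedEval α (g + h) m X = gradedEval α g m X + gradedEval α h m X := by
  simp [gradedEval, comp_add, mul_add, Finset.sum_add_distrib]

theorem dvd_aeval_sub_gradedEval {α : Fin 2 → ℕ} (hα : ∀ v, 1 ≤ α v) (m : ℕ)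
    (X : Fin 2 → PowerSeries A) (q : MvPolynomial (Fin 2) k) :
    PowerSeries.X ^ (m + 1) ∣
      MvPolynomial.aeval (fun v => PowerSeries.X ^ α v * X v) q -
        gradedEval α (q : MvPowerSeries (Fin 2) k) m X := by
  induction q using MvPolynomial.induction_on' with
  | add p q hp hq =>
    rw [map_add, MvPolynomial.coe_add, gradedEval_add, add_sub_add_comm]
    exact dvd_add hp hq
  | monomial η c =>
    have hwt := MvPolynomial.isWeightedHomogeneous_monomial α η c rfl
    have h1 : MvPolynomial.aeval (fun v => PowerSeries.X ^ α v * X v)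
        (MvPolynomial.monomial η c) = PowerSeries.X ^ Finsupp.weight α η *
          MvPolynomial.aeval X (MvPolynomial.monomial η c) := by
      rw [MvPolynomial.aeval_monomial, MvPolynomial.aeval_monomial,
        Finsupp.prod_fintype _ _ (by simp), Finsupp.prod_fintype _ _ (by simp),
        Fin.prod_univ_two, Fin.prod_univ_two, weight_eq]
      ring
    have h2 : gradedEval α (MvPolynomial.monomial η c : MvPowerSeries (Fin 2) k) m X =
        if Finsupp.weight α η ≤ m then PowerSeries.X ^ Finsupp.weight α η *
          MvPolynomial.aeval X (MvPolynomial.monomial η c) else 0 := by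
      rw [gradedEval]
      simp_rw [comp_of_isWeightedHomogeneous hα hwt]
      have h3 : ∀ d ∈ Finset.range (m + 1), (PowerSeries.X ^ d * MvPolynomial.aeval X
          (if d = Finsupp.weight α η then MvPolynomial.monomial η c else 0) : PowerSeries A) =
          if d = Finsupp.weight α η then PowerSeries.X ^ Finsupp.weight α η *
          MvPolynomial.aeval X (MvPolynomial.monomial η c) else 0 := by
        intro d _
        split_ifs with h
        · rw [h]
        · simp
      rw [Finset.sum_congr rfl h3, Finset.sum_ite_eq']
      simp
    rw [h1, h2]
    split_ifs with h
    · simp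
    · rw [sub_zero]
      exact Dvd.dvd.mul_right (pow_dvd_pow _ (by omega)) _

/-- The jet with coordinates given by `φ` is `(t^{α₀} X₀, t^{α₁} X₁)`, up to terms of order greater
than `m`. -/
structure IsJet (φ : JetRing k m →ₐ[k] A) (α : Fin 2 → ℕ) (X : Fin 2 → PowerSeries A) :
    Prop where
  one_le : ∀ v, 1 ≤ α v
  lt : ∀ v n, n < α v → φ (jetVar k m v n) = 0
  add : ∀ v i, α v + i ≤ m → φ (jetVar k m v (α v + i)) = PowerSeries.coeff i (X v)

theorem IsJet.dvd {φ : JetRing k m →ₐ[k] A} {α : Fin 2 → ℕ} {X : Fin 2 → PowerSeries A}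
    (h : IsJet φ α X) (v : Fin 2) :
    PowerSeries.X ^ (m + 1) ∣
      PowerSeries.map φ.toRingHom (jetSeries k m v) - PowerSeries.X ^ α v * X v := by
  rw [PowerSeries.X_pow_dvd_iff]
  intro n hn
  rw [map_sub, PowerSeries.coeff_map, PowerSeries.coeff_X_pow_mul', jetSeries,
    PowerSeries.coeff_mk, sub_eq_zero]
  have := h.one_le v
  by_cases h0 : n < α v
  · rw [if_neg (not_le.2 h0)]
    split_ifs with h1
    · simp
    · exact h.lt v n h0
  · rw [if_neg (by omega), if_pos (not_lt.1 h0)]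
    obtain ⟨i, rfl⟩ := Nat.exists_eq_add_of_le (not_lt.1 h0)
    rw [Nat.add_sub_cancel_left]
    exact h.add v i (by omega)

/-- Up to order `m` only finitely many monomials of `g` matter: the tail `r` contributes multiples
of `t^{m+1}`, and for the polynomial `q` the substitution is computed monomial by monomial. -/
theorem IsJet.coeff_jetEval {φ : JetRing k m →ₐ[k] A} {α : Fin 2 → ℕ}
    {X : Fin 2 → PowerSeries A} (h : IsJet φ α X) (g : MvPowerSeries (Fin 2) k) {n : ℕ}
    (hn : n ≤ m) : φ (jetCoeff g m n) = PowerSeries.coeff n (gradedEval α g m X) := by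
  classical
  set q := MvPowerSeries.trunc' k (Finsupp.equivFunOnFinite.symm fun _ => m) g with hq
  set r := g - (q : MvPowerSeries (Fin 2) k) with hr
  have hr0 : ∀ η : Fin 2 →₀ ℕ, (∀ v, η v < m + 1) → MvPowerSeries.coeff η r = 0 := by
    intro η hη
    rw [hr, map_sub, MvPolynomial.coeff_coe, hq, MvPowerSeries.coeff_trunc', if_pos, sub_self]
    intro v
    simpa using Nat.lt_succ_iff.1 (hη v)
  have hg : g = q + r := by rw [hr]; ring
  have hr1 : gradedEval α r m X = 0 := by
    rw [gradedEval]
    refine Finset.sum_eq_zero fun d hd => ?_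
    have : comp α d r = 0 := by
      ext η
      rw [coeff_comp h.one_le, MvPolynomial.coeff_zero]
      split_ifs with h1
      · refine hr0 η fun v => ?_
        have := le_weight h.one_le η v
        have := Finset.mem_range.1 hd
        omega
      · rfl
    rw [this, map_zero, mul_zero]
  rw [← NewtonJets.coeff_jetEval]
  have h1 : PowerSeries.X ^ (m + 1) ∣ jetEval φ g - gradedEval α g m X := by
    rw [hg, map_add, gradedEval_add, hr1, add_zero, jetEval_coe, add_sub_right_comm]
    refine dvd_add ?_ (X_pow_dvd_jetEval φ hr0)
    rw [← sub_add_sub_cancel]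
    exact dvd_add (dvd_aeval_sub_aeval h.dvd q) (dvd_aeval_sub_gradedEval h.one_le m X q)
  have h2 := PowerSeries.X_pow_dvd_iff.1 h1 n (by omega)
  rwa [map_sub, sub_eq_zero] at h2

/-- The value of `g` at `(t^{α₀} X₀, t^{α₁} X₁)`, up to terms of order greater than `m`,
divided by the power of `t` of exponent `ν_α(g)`. -/
def reducedEval (α : Fin 2 → ℕ) (g : MvPowerSeries (Fin 2) k) (m : ℕ)
    (X : Fin 2 → PowerSeries A) : PowerSeries A :=
  ∑ i ∈ Finset.range (m + 1 - nu α g),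
    PowerSeries.X ^ i * MvPolynomial.aeval X (comp α (nu α g + i) g)

theorem gradedEval_eq {α : Fin 2 → ℕ} (hα : ∀ v, 1 ≤ α v) (g : MvPowerSeries (Fin 2) k)
    {m : ℕ} (hm : nu α g ≤ m) (X : Fin 2 → PowerSeries A) :
    gradedEval α g m X = PowerSeries.X ^ nu α g * reducedEval α g m X := by
  rw [gradedEval, reducedEval, Finset.mul_sum, show m + 1 = nu α g + (m + 1 - nu α g) by omega,
    Finset.sum_range_add, Nat.add_sub_cancel_left, Finset.sum_eq_zero, zero_add]
  · exact Finset.sum_congr rfl fun i _ => by ring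
  · intro d hd
    rw [comp_eq_zero_of_lt hα (Finset.mem_range.1 hd), map_zero, mul_zero]

theorem constantCoeff_reducedEval {α : Fin 2 → ℕ} (g : MvPowerSeries (Fin 2) k)
    {m : ℕ} (hm : nu α g ≤ m) (X : Fin 2 → PowerSeries A) :
    PowerSeries.constantCoeff (reducedEval α g m X) =
      MvPolynomial.aeval (fun v => PowerSeries.constantCoeff (X v)) (initForm α g) := by
  rw [reducedEval, show m + 1 - nu α g = (m - nu α g) + 1 by omega, Finset.sum_range_succ',
    map_add, map_sum, Finset.sum_eq_zero, zero_add, pow_zero, one_mul, add_zero]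
  · have := MvPolynomial.map_aeval X (PowerSeries.constantCoeff (R := A)) (initForm α g)
    have h2 : (PowerSeries.constantCoeff (R := A)).comp (algebraMap k (PowerSeries A)) =
        algebraMap k A := by
      ext c
      simp [PowerSeries.algebraMap_apply]
    rw [h2] at this
    exact this
  · intro i _
    simp [pow_succ]

theorem IsJet.eq_zero_of_lt_nu {φ : JetRing k m →ₐ[k] A} {α : Fin 2 → ℕ}
    {X : Fin 2 → PowerSeries A} (h : IsJet φ α X) (g : MvPowerSeries (Fin 2) k) {n : ℕ}
    (hn : n ≤ m) (hlt : n < nu α g) : φ (jetCoeff g m n) = 0 := by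
  rw [h.coeff_jetEval g hn, gradedEval, map_sum]
  refine Finset.sum_eq_zero fun d _ => ?_
  rcases lt_or_ge n d with h1 | h1
  · rw [PowerSeries.coeff_X_pow_mul', if_neg (not_le.2 h1)]
  · rw [comp_eq_zero_of_lt h.one_le (h1.trans_lt hlt), map_zero, mul_zero, map_zero]

theorem IsJet.apply_nu_add {φ : JetRing k m →ₐ[k] A} {α : Fin 2 → ℕ}
    {X : Fin 2 → PowerSeries A} (h : IsJet φ α X) (g : MvPowerSeries (Fin 2) k) {i : ℕ}
    (hi : nu α g + i ≤ m) :
    φ (jetCoeff g m (nu α g + i)) = PowerSeries.coeff i (reducedEval α g m X) := by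
  rw [h.coeff_jetEval g hi, gradedEval_eq h.one_le g (by omega), PowerSeries.coeff_X_pow_mul',
    if_pos (Nat.le_add_right _ _), Nat.add_sub_cancel_left]

theorem IsJet.apply_nu {φ : JetRing k m →ₐ[k] A} {α : Fin 2 → ℕ}
    {X : Fin 2 → PowerSeries A} (h : IsJet φ α X) (g : MvPowerSeries (Fin 2) k)
    (hm : nu α g ≤ m) :
    φ (jetCoeff g m (nu α g)) =
      MvPolynomial.aeval (fun v => PowerSeries.constantCoeff (X v)) (initForm α g) := by
  rw [← constantCoeff_reducedEval g hm, ← PowerSeries.coeff_zero_eq_constantCoeff_apply]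
  exact h.apply_nu_add g (i := 0) hm

end Jets


/-! ### Solving for one of the two coordinates -/

section Solve

variable {A : Type*} [CommRing A] [Algebra k A]

/-- Substitution of the variable `T` for the `v`-th coordinate and of `Y` for the other one. -/
def partialSubst (k : Type*) [Field k] {B : Type*} [CommRing B] [Algebra k B] (v : Fin 2) (Y : B) :
    MvPolynomial (Fin 2) k →ₐ[k] Polynomial B :=
  MvPolynomial.aeval (Function.update (fun _ => Polynomial.C Y) v Polynomial.X)

theorem derivative_partialSubst {B : Type*} [CommRing B] [Algebra k B] (v : Fin 2) (Y : B)
    (q : MvPolynomial (Fin 2) k) :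
    Polynomial.derivative (partialSubst k v Y q) =
      partialSubst k v Y (MvPolynomial.pderiv v q) := by
  classical
  induction q using MvPolynomial.induction_on with
  | C c => simp [partialSubst, Polynomial.algebraMap_apply]
  | add p q hp hq => rw [map_add, Polynomial.derivative_add, hp, hq, map_add, map_add]
  | mul_X p u hp =>
    rw [map_mul, Polynomial.derivative_mul, hp, Derivation.leibniz, map_add, smul_eq_mul,
      smul_eq_mul, map_mul, map_mul, MvPolynomial.pderiv_X]
    have : Polynomial.derivative (partialSubst k v Y (MvPolynomial.X u)) =
        partialSubst k v Y
          ((Pi.single v 1 : Fin 2 → MvPolynomial (Fin 2) k) u) := by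
      rw [partialSubst, MvPolynomial.aeval_X]
      by_cases h : u = v
      · subst h; simp
      · simp [h]
    rw [this]
    ring

theorem eval_partialSubst {B : Type*} [CommRing B] [Algebra k B] (v : Fin 2) (Y Z : B)
    (q : MvPolynomial (Fin 2) k) :
    Polynomial.eval Z (partialSubst k v Y q) =
      MvPolynomial.aeval (Function.update (fun _ => Y) v Z) q := by
  have : ((Polynomial.aeval Z : Polynomial B →ₐ[B] B).restrictScalars k).comp
      (partialSubst k v Y) = MvPolynomial.aeval (Function.update (fun _ => Y) v Z) := by
    apply MvPolynomial.algHom_ext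
    intro u
    by_cases h : u = v
    · subst h; simp [partialSubst]
    · simp [partialSubst, h]
  rw [← this]
  simp

/-- The equation `reducedEval α g m = 0` as a polynomial in the `v`-th coordinate. -/
def solvePoly (α : Fin 2 → ℕ) (g : MvPowerSeries (Fin 2) k) (m : ℕ) (v : Fin 2)
    (Y : PowerSeries A) : Polynomial (PowerSeries A) :=
  ∑ i ∈ Finset.range (m + 1 - nu α g),
    Polynomial.C (PowerSeries.X ^ i) * partialSubst k v Y (comp α (nu α g + i) g)

theorem eval_solvePoly (α : Fin 2 → ℕ) (g : MvPowerSeries (Fin 2) k) (m : ℕ) (v : Fin 2)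
    (Y Z : PowerSeries A) :
    (solvePoly α g m v Y).eval Z =
      reducedEval α g m (Function.update (fun _ => Y) v Z) := by
  rw [solvePoly, reducedEval, Polynomial.eval_finsetSum]
  exact Finset.sum_congr rfl fun i _ => by
    rw [Polynomial.eval_mul, Polynomial.eval_C, eval_partialSubst]

theorem constantCoeff_update (v : Fin 2) (Y Z : PowerSeries A) :
    (fun u => PowerSeries.constantCoeff (Function.update (fun _ => Y) v Z u)) =
      Function.update (fun _ => PowerSeries.constantCoeff Y) v
        (PowerSeries.constantCoeff Z) := by
  funext u
  by_cases h : u = v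
  · subst h; simp
  · simp [h]

theorem constantCoeff_eval_derivative_solvePoly (α : Fin 2 → ℕ) (g : MvPowerSeries (Fin 2) k)
    {m : ℕ} (hm : nu α g ≤ m) (v : Fin 2) (Y Z : PowerSeries A) :
    PowerSeries.constantCoeff ((Polynomial.derivative (solvePoly α g m v Y)).eval Z) =
      MvPolynomial.aeval (Function.update (fun _ => PowerSeries.constantCoeff Y) v
        (PowerSeries.constantCoeff Z)) (MvPolynomial.pderiv v (initForm α g)) := by
  rw [solvePoly, show m + 1 - nu α g = (m - nu α g) + 1 by omega, Finset.sum_range_succ',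
    Polynomial.derivative_add, Polynomial.derivative_sum, Polynomial.eval_add,
    Polynomial.eval_finsetSum, map_add, map_sum, Finset.sum_eq_zero, zero_add]
  · rw [pow_zero, Polynomial.C_1, one_mul, add_zero, derivative_partialSubst, eval_partialSubst]
    have := MvPolynomial.map_aeval (Function.update (fun _ => Y) v Z)
      (PowerSeries.constantCoeff (R := A)) (MvPolynomial.pderiv v (initForm α g))
    have h2 : (PowerSeries.constantCoeff (R := A)).comp (algebraMap k (PowerSeries A)) =
        algebraMap k A := by
      ext c
      simp [PowerSeries.algebraMap_apply]
    rw [h2] at this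
    rw [show comp α (nu α g) g = initForm α g from rfl, this, constantCoeff_update]
    rfl
  · intro i _
    rw [Polynomial.derivative_C_mul, Polynomial.eval_mul, Polynomial.eval_C, map_mul]
    simp [pow_succ]

theorem isNilpotent_mk_of_constantCoeff {E : ℕ} {Z : PowerSeries A}
    (h : PowerSeries.constantCoeff Z = 0) :
    IsNilpotent (Ideal.Quotient.mk (Ideal.span {(PowerSeries.X : PowerSeries A) ^ E}) Z) := by
  refine ⟨E, ?_⟩
  rw [← map_pow, Ideal.Quotient.eq_zero_iff_mem, Ideal.mem_span_singleton]
  exact pow_dvd_pow_of_dvd (PowerSeries.X_dvd_iff.2 h) E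

/-- Hensel's lemma in `A[[t]]/(t^E)`, where `t` is nilpotent: `Z` is a root modulo nilpotents by
`h0`, a simple one by `h1`. -/
theorem exists_solution [IsDomain A] {α : Fin 2 → ℕ} (g : MvPowerSeries (Fin 2) k)
    {m : ℕ} (hm : nu α g ≤ m) (v : Fin 2) (Y Z : PowerSeries A) {E : ℕ} (hE : 1 ≤ E)
    (h0 : MvPolynomial.aeval (Function.update (fun _ => PowerSeries.constantCoeff Y) v
      (PowerSeries.constantCoeff Z)) (initForm α g) = 0)
    (h1 : IsUnit (MvPolynomial.aeval (Function.update (fun _ => PowerSeries.constantCoeff Y) v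
      (PowerSeries.constantCoeff Z)) (MvPolynomial.pderiv v (initForm α g)))) :
    ∃ Z' : PowerSeries A, PowerSeries.constantCoeff Z' = PowerSeries.constantCoeff Z ∧
      (∀ i, E ≤ i → PowerSeries.coeff i Z' = PowerSeries.coeff i Z) ∧
      PowerSeries.X ^ E ∣ reducedEval α g m (Function.update (fun _ => Y) v Z') := by
  set I := Ideal.span {(PowerSeries.X : PowerSeries A) ^ E} with hI
  have haev : ∀ (q : Polynomial (PowerSeries A)) (W : PowerSeries A),
      Polynomial.aeval (Ideal.Quotient.mk I W) q = Ideal.Quotient.mk I (q.eval W) := by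
    intro q W
    rw [← Ideal.Quotient.algebraMap_eq, Polynomial.aeval_algebraMap_apply,
      Polynomial.coe_aeval_eq_eval]
  obtain ⟨r, ⟨hr1, hr2⟩, -⟩ := Polynomial.existsUnique_nilpotent_sub_and_aeval_eq_zero
    (P := solvePoly α g m v Y) (x := Ideal.Quotient.mk I Z) (by
      rw [haev]
      apply isNilpotent_mk_of_constantCoeff
      rw [eval_solvePoly, constantCoeff_reducedEval g hm, constantCoeff_update, h0]) (by
      rw [haev]
      refine IsUnit.map _ ?_
      rw [PowerSeries.isUnit_iff_constantCoeff, constantCoeff_eval_derivative_solvePoly α g hm]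
      exact h1)
  obtain ⟨W, rfl⟩ := Ideal.Quotient.mk_surjective r
  -- The equation modulo `t^E` does not see the coefficients from `E` on. They are copied from `Z`,
  -- so that they stay free parameters in the generic jet.
  let Z' : PowerSeries A := PowerSeries.mk fun i =>
    if E ≤ i then PowerSeries.coeff i Z else PowerSeries.coeff i W
  have hZW : Ideal.Quotient.mk I Z' = Ideal.Quotient.mk I W := by
    rw [Ideal.Quotient.eq, hI, Ideal.mem_span_singleton, PowerSeries.X_pow_dvd_iff]
    intro i hi
    simp [Z', not_le.2 hi]
  refine ⟨Z', ?_, fun i hi => by simp [Z', hi], ?_⟩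
  · obtain ⟨N, hN⟩ := hr1
    rw [← map_sub, ← map_pow, Ideal.Quotient.eq_zero_iff_mem, hI, Ideal.mem_span_singleton] at hN
    have h2 : PowerSeries.constantCoeff ((Z - W) ^ N) = 0 :=
      PowerSeries.X_dvd_iff.1 ((dvd_pow_self _ (by omega)).trans hN)
    rw [map_pow, map_sub] at h2
    have h4 : PowerSeries.constantCoeff Z - PowerSeries.constantCoeff W = 0 :=
      eq_zero_of_pow_eq_zero h2
    rw [← PowerSeries.coeff_zero_eq_constantCoeff_apply]
    simp only [Z', PowerSeries.coeff_mk, if_neg (show ¬ E ≤ 0 by omega)]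
    rw [PowerSeries.coeff_zero_eq_constantCoeff_apply]
    exact (sub_eq_zero.1 h4).symm
  · rw [← hZW, haev, Ideal.Quotient.eq_zero_iff_mem, hI, Ideal.mem_span_singleton,
      eval_solvePoly] at hr2
    exact hr2

/-- The uniqueness half of the same Hensel argument, used to compare an arbitrary jet with the
generic one. -/
theorem solution_unique {α : Fin 2 → ℕ} (g : MvPowerSeries (Fin 2) k)
    {m : ℕ} (hm : nu α g ≤ m) (v : Fin 2) (Y Z Z' : PowerSeries A) {E : ℕ}
    (hZ : PowerSeries.constantCoeff Z = PowerSeries.constantCoeff Z')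
    (h1 : IsUnit (MvPolynomial.aeval (Function.update (fun _ => PowerSeries.constantCoeff Y) v
      (PowerSeries.constantCoeff Z)) (MvPolynomial.pderiv v (initForm α g))))
    (h : PowerSeries.X ^ E ∣ reducedEval α g m (Function.update (fun _ => Y) v Z))
    (h' : PowerSeries.X ^ E ∣ reducedEval α g m (Function.update (fun _ => Y) v Z'))
    {i : ℕ} (hi : i < E) : PowerSeries.coeff i Z = PowerSeries.coeff i Z' := by
  set I := Ideal.span {(PowerSeries.X : PowerSeries A) ^ E} with hI
  have haev : ∀ (q : Polynomial (PowerSeries A)) (W : PowerSeries A),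
      Polynomial.aeval (Ideal.Quotient.mk I W) q = Ideal.Quotient.mk I (q.eval W) := by
    intro q W
    rw [← Ideal.Quotient.algebraMap_eq, Polynomial.aeval_algebraMap_apply,
      Polynomial.coe_aeval_eq_eval]
  have hroot : ∀ W, PowerSeries.X ^ E ∣ reducedEval α g m (Function.update (fun _ => Y) v W) →
      Polynomial.aeval (Ideal.Quotient.mk I W) (solvePoly α g m v Y) = 0 := by
    intro W hW
    rw [haev, Ideal.Quotient.eq_zero_iff_mem, hI, Ideal.mem_span_singleton, eval_solvePoly]
    exact hW
  have hu := Polynomial.existsUnique_nilpotent_sub_and_aeval_eq_zero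
    (P := solvePoly α g m v Y) (x := Ideal.Quotient.mk I Z) (by
      rw [hroot Z h]; exact IsNilpotent.zero) (by
      rw [haev]
      refine IsUnit.map _ ?_
      rw [PowerSeries.isUnit_iff_constantCoeff, constantCoeff_eval_derivative_solvePoly α g hm]
      exact h1)
  have h2 := hu.unique (y₁ := Ideal.Quotient.mk I Z) (y₂ := Ideal.Quotient.mk I Z')
    ⟨by rw [sub_self]; exact IsNilpotent.zero, hroot Z h⟩
    ⟨by rw [← map_sub]; exact isNilpotent_mk_of_constantCoeff (by rw [map_sub, hZ, sub_self]),
      hroot Z' h'⟩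
  rw [Ideal.Quotient.eq, hI, Ideal.mem_span_singleton, PowerSeries.X_pow_dvd_iff] at h2
  have h3 := h2 i hi
  rwa [map_sub, sub_eq_zero] at h3

end Solve


/-! ### Points of the jet space -/

section Points

variable {m : ℕ} {A : Type*} [CommRing A] [Algebra k A]

/-- The point of the jet space given by a jet over a domain. -/
def pointOf [IsDomain A] (φ : JetRing k m →ₐ[k] A) : JetSpace k m :=
  ⟨RingHom.ker φ, RingHom.ker_isPrime φ⟩

theorem mem_pointOf [IsDomain A] {φ : JetRing k m →ₐ[k] A} {a : JetRing k m} :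
    a ∈ (pointOf φ).asIdeal ↔ φ a = 0 := Iff.rfl

/-- The jet over the residue field at a point of the jet space. -/
def residueJet (Q : JetSpace k m) : JetRing k m →ₐ[k] Q.asIdeal.ResidueField :=
  Algebra.algHom k (JetRing k m) Q.asIdeal.ResidueField

theorem mem_iff_residueJet {Q : JetSpace k m} {a : JetRing k m} :
    a ∈ Q.asIdeal ↔ residueJet Q a = 0 :=
  Ideal.algebraMap_residueField_eq_zero.symm

/-- The jet with coordinates `(t^{α₀} X₀, t^{α₁} X₁)`. -/
def jetHom (m : ℕ) (α : Fin 2 → ℕ) (X : Fin 2 → PowerSeries A) : JetRing k m →ₐ[k] A :=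
  MvPolynomial.aeval fun q =>
    if (q.2 : ℕ) < α q.1 then 0 else PowerSeries.coeff (q.2 - α q.1) (X q.1)

theorem isJet_jetHom {α : Fin 2 → ℕ} (hα : ∀ v, 1 ≤ α v) (X : Fin 2 → PowerSeries A) :
    IsJet (jetHom (k := k) m α X) α X where
  one_le := hα
  lt v n hn := by
    rw [jetVar]
    split_ifs
    · simp [jetHom, hn]
    · simp
  add v i hi := by
    rw [jetVar, dif_pos (by omega)]
    simp [jetHom]

/-- The series `X_v` such that a given jet is `(t^{α₀} X₀, t^{α₁} X₁)`. -/
def jetTail (φ : JetRing k m →ₐ[k] A) (α : Fin 2 → ℕ) (v : Fin 2) : PowerSeries A :=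
  PowerSeries.mk fun i => φ (jetVar k m v (α v + i))

theorem isJet_jetTail {φ : JetRing k m →ₐ[k] A} {α : Fin 2 → ℕ} (hα : ∀ v, 1 ≤ α v)
    (h : ∀ v n, n < α v → φ (jetVar k m v n) = 0) : IsJet φ α (jetTail φ α) where
  one_le := hα
  lt := h
  add v i _ := by simp [jetTail]

theorem mem_setH {Q : JetSpace k m} {γ : Fin 2 → ℕ} :
    Q ∈ setH k m γ ↔ ∀ v n, n < γ v → jetVar k m v n ∈ Q.asIdeal := by
  rw [setH, PrimeSpectrum.mem_zeroLocus]
  constructor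
  · intro h v n hn
    exact h ⟨v, n, hn, rfl⟩
  · rintro h _ ⟨v, n, hn, rfl⟩
    exact h v n hn

theorem mem_setF {Q : JetSpace k m} {g : MvPowerSeries (Fin 2) k} {α : Fin 2 → ℕ} {l : ℕ} :
    Q ∈ setF g m α l ↔ Q ∈ setH k m α ∧ (∀ n ≤ l, jetCoeff g m n ∈ Q.asIdeal) ∧
      ∀ v, jetVar k m v (α v) ∉ Q.asIdeal := by
  rw [setF, Set.mem_inter_iff, Set.mem_inter_iff, and_assoc, PrimeSpectrum.mem_zeroLocus]
  refine and_congr_right fun _ => and_congr ?_ Iff.rfl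
  constructor
  · intro h n hn
    exact h ⟨n, hn, rfl⟩
  · rintro h _ ⟨n, hn, rfl⟩
    exact h n hn

theorem mem_jetFibre {Q : JetSpace k m} {f : MvPowerSeries (Fin 2) k} :
    Q ∈ jetFibre f m ↔ (∀ v, jetVar k m v 0 ∈ Q.asIdeal) ∧
      ∀ n ≤ m, jetCoeff f m n ∈ Q.asIdeal := by
  rw [jetFibre, PrimeSpectrum.mem_zeroLocus, Set.union_subset_iff]
  refine and_congr ?_ ?_
  · constructor
    · intro h v
      exact h ⟨v, rfl⟩
    · rintro h _ ⟨v, rfl⟩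
      exact h v
  · constructor
    · intro h n hn
      exact h ⟨n, hn, rfl⟩
    · rintro h _ ⟨n, hn, rfl⟩
      exact h n hn

/-- The jet obtained from the universal one by annihilating the coordinates that vanish on
`𝓗^γ_m`. -/
def truncJet (k : Type*) [Field k] (m : ℕ) (γ : Fin 2 → ℕ) : JetRing k m →ₐ[k] JetRing k m :=
  MvPolynomial.aeval fun q => if (q.2 : ℕ) < γ q.1 then 0 else MvPolynomial.X q

/-- The generic point of `𝓗^γ_m`. -/
def genericH (k : Type*) [Field k] (m : ℕ) (γ : Fin 2 → ℕ) : JetSpace k m :=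
  pointOf (truncJet k m γ)

theorem jetVar_mem_genericH {γ : Fin 2 → ℕ} {v : Fin 2} {n : ℕ} :
    jetVar k m v n ∈ (genericH k m γ).asIdeal ↔ n < γ v ∨ m < n := by
  rw [genericH, mem_pointOf, jetVar]
  split_ifs with h
  · by_cases h1 : n < γ v
    · simp [truncJet, h1]
    · simp [truncJet, h1]; omega
  · simp; omega

theorem genericH_le_iff {γ : Fin 2 → ℕ} {Q : JetSpace k m} :
    genericH k m γ ≤ Q ↔ Q ∈ setH k m γ := by
  rw [mem_setH]
  constructor
  · intro h v n hn
    exact h (jetVar_mem_genericH.2 (Or.inl hn))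
  · intro h a ha
    have h1 : (residueJet Q).comp (truncJet k m γ) = residueJet Q := by
      apply MvPolynomial.algHom_ext
      rintro ⟨v, n⟩
      rw [AlgHom.comp_apply, truncJet, MvPolynomial.aeval_X]
      split_ifs with h2
      · have := h v n h2
        rw [jetVar, dif_pos n.2, mem_iff_residueJet] at this
        rw [map_zero, this]
      · rfl
    rw [mem_iff_residueJet, ← h1, AlgHom.comp_apply,
      show truncJet k m γ a = 0 from ha, map_zero]

theorem setH_eq_closure (γ : Fin 2 → ℕ) : setH k m γ = closure {genericH k m γ} := by
  ext Q
  rw [← genericH_le_iff, PrimeSpectrum.le_iff_mem_closure]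

/-- The equations below `ν_α(g)` hold automatically; the other `E + 1` are the first coefficients of
`reducedEval`. -/
theorem IsJet.pointOf_mem_setF_iff [IsDomain A] {φ : JetRing k m →ₐ[k] A} {α : Fin 2 → ℕ}
    {X : Fin 2 → PowerSeries A} (h : IsJet φ α X) {g : MvPowerSeries (Fin 2) k} {E : ℕ}
    (hm : nu α g + E ≤ m) (hα : ∀ v, α v ≤ m) :
    pointOf φ ∈ setF g m α (nu α g + E) ↔
      PowerSeries.X ^ (E + 1) ∣ reducedEval α g m X ∧
        ∀ v, PowerSeries.constantCoeff (X v) ≠ 0 := by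
  rw [mem_setF, mem_setH]
  simp_rw [mem_pointOf]
  have h1 : ∀ v, φ (jetVar k m v (α v)) = PowerSeries.constantCoeff (X v) := fun v => by
    rw [← PowerSeries.coeff_zero_eq_constantCoeff_apply]
    exact h.add v 0 (hα v)
  simp_rw [h1, PowerSeries.X_pow_dvd_iff]
  constructor
  · rintro ⟨-, h2, h3⟩
    refine ⟨fun i hi => ?_, h3⟩
    rw [← h.apply_nu_add g (by omega)]
    exact h2 _ (by omega)
  · rintro ⟨h2, h3⟩
    refine ⟨h.lt, fun n hn => ?_, h3⟩
    rcases lt_or_ge n (nu α g) with h4 | h4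
    · exact h.eq_zero_of_lt_nu g (by omega) h4
    · obtain ⟨i, rfl⟩ := Nat.exists_eq_add_of_le h4
      rw [h.apply_nu_add g (by omega)]
      exact h2 i (by omega)

end Points

theorem reducedEval_map {A B : Type*} [CommRing A] [Algebra k A] [CommRing B] [Algebra k B]
    (ψ : A →ₐ[k] B) (α : Fin 2 → ℕ) (g : MvPowerSeries (Fin 2) k) (m : ℕ)
    (X : Fin 2 → PowerSeries A) :
    PowerSeries.mapAlgHom ψ (reducedEval α g m X) =
      reducedEval α g m fun v => PowerSeries.mapAlgHom ψ (X v) := by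
  rw [reducedEval, reducedEval, map_sum]
  refine Finset.sum_congr rfl fun i _ => ?_
  rw [map_mul, map_pow, MvPolynomial.comp_aeval_apply]
  congr 2
  exact PowerSeries.map_X _

/-! ### Branch forms -/

namespace HasBranchForm

variable {α : Fin 2 → ℕ} {g : MvPowerSeries (Fin 2) k} {e : Fin 2 → ℕ} {p : Fin 2 → k} {c : k}

theorem nu_eq' (h : HasBranchForm α g e p c) (v : Fin 2) : nu α g = e v * α v := by
  fin_cases v
  · exact h.nu_eq
  · exact h.nu_eq.trans h.weight

theorem le_nu (h : HasBranchForm α g e p c) (v : Fin 2) : α v ≤ nu α g := by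
  rw [h.nu_eq' v]
  exact Nat.le_mul_of_pos_left _ (h.one_le v)

theorem aeval_initForm (h : HasBranchForm α g e p c) {A : Type*} [CommRing A] [Algebra k A]
    (x : Fin 2 → A) : MvPolynomial.aeval x (initForm α g) = algebraMap k A c *
      ((algebraMap k A (p 0)⁻¹ * x 0) ^ e 0 - (algebraMap k A (p 1)⁻¹ * x 1) ^ e 1) := by
  rw [h.eq]
  simp [branchPoly]

/-- In `Fin 2`, `v + 1` is the other index, so `s ↦ (p₀ s^{e₁}, p₁ s^{e₀})` parametrises the
binomial curve. -/
theorem aeval_torus (h : HasBranchForm α g e p c) {A : Type*} [CommRing A] [Algebra k A]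
    (s : A) : MvPolynomial.aeval (fun v => algebraMap k A (p v) * s ^ e (v + 1))
      (initForm α g) = 0 := by
  have h1 : ∀ v, algebraMap k A (p v)⁻¹ * algebraMap k A (p v) = 1 := fun v => by
    rw [← map_mul, inv_mul_cancel₀ (h.torus v), map_one]
  rw [h.aeval_initForm, ← mul_assoc, ← mul_assoc, h1, h1, one_mul, one_mul, ← pow_mul, ← pow_mul,
    zero_add, show (1 + 1 : Fin 2) = 0 from rfl, mul_comm (e 1), sub_self, mul_zero]

/-- The characteristic cannot divide two coprime exponents. The index found here is that of the
coordinate to solve for. -/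
theorem exists_cast_ne_zero (h : HasBranchForm α g e p c) : ∃ v, (e v : k) ≠ 0 := by
  by_contra hn
  push Not at hn
  obtain ⟨a, b, hab⟩ := Nat.isCoprime_iff_coprime.2 h.coprime
  have := congrArg (Int.cast (R := k)) hab
  push_cast at this
  rw [hn, hn] at this
  simp at this

theorem isUnit_aeval_pderiv (h : HasBranchForm α g e p c) {A : Type*} [CommRing A] [Algebra k A]
    {v : Fin 2} (hv : (e v : k) ≠ 0) {x : Fin 2 → A} (hx : IsUnit (x v)) :
    IsUnit (MvPolynomial.aeval x (MvPolynomial.pderiv v (initForm α g))) := by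
  have hu : ∀ a : k, a ≠ 0 → IsUnit (algebraMap k A a) := fun a ha =>
    (IsUnit.mk0 a ha).map _
  have h2 := hu c h.ne_zero
  have h3 := hu _ hv
  have h4 := hu _ (inv_ne_zero (h.torus v))
  have h5 := ((h4.mul hx).pow (e v - 1)).mul h4
  rw [map_natCast] at h3
  rw [h.eq, Derivation.leibniz]
  fin_cases v
  · have : MvPolynomial.aeval x (MvPolynomial.pderiv 0 (branchPoly e p)) =
        (e 0 : A) * ((algebraMap k A (p 0)⁻¹ * x 0) ^ (e 0 - 1) * algebraMap k A (p 0)⁻¹) := by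
      simp [branchPoly, Derivation.leibniz_pow, MvPolynomial.pderiv_X, Derivation.leibniz]
      try ring
    simpa [this] using h2.mul (h3.mul h5)
  · have : MvPolynomial.aeval x (MvPolynomial.pderiv 1 (branchPoly e p)) =
        -((e 1 : A) * ((algebraMap k A (p 1)⁻¹ * x 1) ^ (e 1 - 1) * algebraMap k A (p 1)⁻¹)) := by
      simp [branchPoly, Derivation.leibniz_pow, MvPolynomial.pderiv_X, Derivation.leibniz]
      try ring
    simpa [this] using h2.mul (h3.mul h5)

/-- The scaled coordinates satisfy `a^{e₀} = b^{e₁}`; with Bézout coefficients `i e₀ + j e₁ = 1`,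
the parameter is `a^j b^i`. -/
theorem exists_torus_parameter (h : HasBranchForm α g e p c) {K : Type*} [Field K] [Algebra k K]
    {x : Fin 2 → K} (hx : ∀ v, x v ≠ 0) (h0 : MvPolynomial.aeval x (initForm α g) = 0) :
    ∃ s : K, s ≠ 0 ∧ ∀ v, x v = algebraMap k K (p v) * s ^ e (v + 1) := by
  have hp : ∀ v, algebraMap k K (p v) ≠ 0 := fun v => (map_ne_zero _).2 (h.torus v)
  rw [h.aeval_initForm] at h0
  have h1 := (mul_eq_zero.1 h0).resolve_left ((map_ne_zero _).2 h.ne_zero)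
  rw [sub_eq_zero] at h1
  set a := algebraMap k K (p 0)⁻¹ * x 0 with ha
  set b := algebraMap k K (p 1)⁻¹ * x 1 with hb
  have ha0 : a ≠ 0 := mul_ne_zero (by simp [h.torus]) (hx 0)
  have hb0 : b ≠ 0 := mul_ne_zero (by simp [h.torus]) (hx 1)
  have hxa : x 0 = algebraMap k K (p 0) * a := by
    rw [ha, map_inv₀, mul_inv_cancel_left₀ (hp 0)]
  have hxb : x 1 = algebraMap k K (p 1) * b := by
    rw [hb, map_inv₀, mul_inv_cancel_left₀ (hp 1)]
  obtain ⟨i, j, hij⟩ := Nat.isCoprime_iff_coprime.2 h.coprime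
  have h2 : a ^ (e 0 : ℤ) = b ^ (e 1 : ℤ) := by exact_mod_cast h1
  refine ⟨a ^ j * b ^ i, mul_ne_zero (zpow_ne_zero _ ha0) (zpow_ne_zero _ hb0), fun v => ?_⟩
  fin_cases v
  · change x 0 = algebraMap k K (p 0) * _ ^ e 1
    rw [hxa]
    congr 1
    rw [← zpow_natCast, mul_zpow, ← zpow_mul b, mul_comm i, zpow_mul, ← h2, ← zpow_mul, ← zpow_mul,
      ← zpow_add₀ ha0, show j * (e 1 : ℤ) + e 0 * i = 1 by rw [← hij]; ring, zpow_one]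
  · change x 1 = algebraMap k K (p 1) * _ ^ e 0
    rw [hxb]
    congr 1
    rw [← zpow_natCast, mul_zpow, ← zpow_mul a, mul_comm j, zpow_mul, h2, ← zpow_mul, ← zpow_mul,
      ← zpow_add₀ hb0, show (e 1 : ℤ) * j + i * e 0 = 1 by rw [← hij]; ring, zpow_one]

end HasBranchForm

theorem update_add_one {β : Type*} (v : Fin 2) (X : Fin 2 → β) :
    Function.update (fun _ => X (v + 1)) v (X v) = X := by
  funext u
  by_cases h : u = v
  · subst h; simp
  · rw [Function.update_of_ne h]
    congr 1
    omega


/-! ### The generic jet with a given initial form -/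

/-- Polynomials in the coefficients of the generic jet, with the torus parameter inverted. -/
abbrev ParamRing (k : Type*) [Field k] : Type _ :=
  Localization.Away (MvPolynomial.X none : MvPolynomial (Option (Fin 2 × ℕ)) k)

instance (k : Type*) [Field k] : IsDomain (ParamRing k) :=
  IsLocalization.isDomain_localization
    (powers_le_nonZeroDivisors_of_noZeroDivisors (MvPolynomial.X_ne_zero _))

/-- The torus parameter and the free coefficients of the generic jet. -/
def paramVar (k : Type*) [Field k] (o : Option (Fin 2 × ℕ)) : ParamRing k :=
  algebraMap (MvPolynomial (Option (Fin 2 × ℕ)) k) (ParamRing k) (MvPolynomial.X o)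

theorem isUnit_paramVar_none : IsUnit (paramVar k none) :=
  IsLocalization.Away.algebraMap_isUnit _

theorem exists_paramRing_hom {K : Type*} [Field K] [Algebra k K] (x : Option (Fin 2 × ℕ) → K)
    (hx : x none ≠ 0) : ∃ ψ : ParamRing k →ₐ[k] K, ∀ o, ψ (paramVar k o) = x o := by
  have hu : ∀ y : Submonoid.powers (MvPolynomial.X none : MvPolynomial (Option (Fin 2 × ℕ)) k),
      IsUnit (MvPolynomial.aeval (R := k) x (y : MvPolynomial (Option (Fin 2 × ℕ)) k)) := by
    rintro ⟨_, n, rfl⟩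
    simp [hx]
  refine ⟨IsLocalization.liftAlgHom hu, fun o => ?_⟩
  rw [paramVar, IsLocalization.liftAlgHom_apply, IsLocalization.lift_eq]
  simp

/-- The first approximation of the generic jet. -/
def paramSeries (e : Fin 2 → ℕ) (p : Fin 2 → k) (v : Fin 2) : PowerSeries (ParamRing k) :=
  PowerSeries.mk fun i =>
    if i = 0 then algebraMap k (ParamRing k) (p v) * paramVar k none ^ e (v + 1)
    else paramVar k (some (v, i))

theorem constantCoeff_paramSeries (e : Fin 2 → ℕ) (p : Fin 2 → k) (v : Fin 2) :
    PowerSeries.constantCoeff (paramSeries e p v) =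
      algebraMap k (ParamRing k) (p v) * paramVar k none ^ e (v + 1) := by
  rw [← PowerSeries.coeff_zero_eq_constantCoeff_apply]
  simp [paramSeries]

namespace HasBranchForm

variable {α : Fin 2 → ℕ} {g : MvPowerSeries (Fin 2) k} {e : Fin 2 → ℕ} {p : Fin 2 → k} {c : k}

/-- The universal jet over `ParamRing k` has `s` and all later coefficients free, except that the
first ones in direction `v` are solved for. A jet in the stratum has a torus parameter and
coefficients of its own. Specialising to them carries the universal jet to it, by uniqueness of the
solution, so the kernel of the universal jet is the least prime of the stratum. -/
theorem exists_generic (h : HasBranchForm α g e p c) {m E : ℕ} (hm : nu α g + E ≤ m) :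
    ∃ P ∈ setF g m α (nu α g + E), ∀ Q ∈ setF g m α (nu α g + E), P ≤ Q := by
  obtain ⟨v, hv⟩ := h.exists_cast_ne_zero
  have hαm : ∀ v, α v ≤ m := fun v => by have := h.le_nu v; omega
  have hνm : nu α g ≤ m := by omega
  set Y := paramSeries e p (v + 1)
  have hcst : Function.update (fun _ => PowerSeries.constantCoeff Y) v
      (PowerSeries.constantCoeff (paramSeries e p v)) =
      fun v => algebraMap k (ParamRing k) (p v) * paramVar k none ^ e (v + 1) := by
    rw [← update_add_one v
      (fun v => algebraMap k (ParamRing k) (p v) * paramVar k none ^ e (v + 1))]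
    simp only [Y, constantCoeff_paramSeries]
  have hunit : ∀ v, IsUnit (algebraMap k (ParamRing k) (p v) * paramVar k none ^ e (v + 1)) :=
    fun v => ((IsUnit.mk0 _ (h.torus v)).map _).mul (isUnit_paramVar_none.pow _)
  obtain ⟨Z, hZ0, hZE, hZ⟩ := exists_solution g hνm v Y (paramSeries e p v) (E := E + 1)
    (by omega) (by rw [hcst]; exact h.aeval_torus _)
    (by rw [hcst]; exact h.isUnit_aeval_pderiv hv (hunit v))
  set X := Function.update (fun _ => Y) v Z with hX
  have hXv : X v = Z := by simp [X]
  have hXu : X (v + 1) = Y := by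
    have : v + 1 ≠ v := by omega
    simp [X, this]
  have hjet := isJet_jetHom (k := k) (m := m) h.pos X
  refine ⟨pointOf (jetHom m α X), ?_, ?_⟩
  · rw [hjet.pointOf_mem_setF_iff hm hαm]
    refine ⟨hZ, fun w => ?_⟩
    have : PowerSeries.constantCoeff (X w) =
        algebraMap k (ParamRing k) (p w) * paramVar k none ^ e (w + 1) := by
      by_cases hw : w = v
      · rw [hw, hXv, hZ0, constantCoeff_paramSeries]
      · have hw' : w = v + 1 := by omega
        rw [hw', hXu, constantCoeff_paramSeries]
    rw [this]
    exact (hunit w).ne_zero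
  · intro Q hQ
    set φ := residueJet Q
    have hQφ : pointOf φ = Q := by
      ext a
      exact mem_iff_residueJet.symm
    have hφ : IsJet φ α (jetTail φ α) := isJet_jetTail h.pos fun w n hn =>
      mem_iff_residueJet.1 (mem_setH.1 (mem_setF.1 hQ).1 w n hn)
    rw [← hQφ, hφ.pointOf_mem_setF_iff hm hαm] at hQ
    have h0 : MvPolynomial.aeval (fun w => PowerSeries.constantCoeff (jetTail φ α w))
        (initForm α g) = 0 := by
      rw [← constantCoeff_reducedEval g hνm, ← PowerSeries.X_dvd_iff]
      exact (dvd_pow_self _ (by omega)).trans hQ.1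
    obtain ⟨s, hs, hs1⟩ := h.exists_torus_parameter hQ.2 h0
    obtain ⟨ψ, hψ⟩ := exists_paramRing_hom (k := k)
      (fun o => o.elim s fun q => PowerSeries.coeff q.2 (jetTail φ α q.1)) hs
    have hpar : ∀ w, PowerSeries.mapAlgHom ψ (paramSeries e p w) = jetTail φ α w := by
      intro w
      ext i
      rw [PowerSeries.mapAlgHom_apply, PowerSeries.coeff_map, paramSeries, PowerSeries.coeff_mk]
      by_cases hi : i = 0
      · rw [if_pos hi, hi, PowerSeries.coeff_zero_eq_constantCoeff_apply, hs1 w]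
        simp [hψ]
      · rw [if_neg hi]
        simp [hψ]
    have hXQ : ∀ w, PowerSeries.mapAlgHom ψ (X w) = jetTail φ α w := by
      intro w
      by_cases hw : w = v
      · rw [hw, hXv]
        have hconst : PowerSeries.constantCoeff (PowerSeries.mapAlgHom ψ Z) =
            PowerSeries.constantCoeff (jetTail φ α v) := by
          rw [← hpar v, PowerSeries.mapAlgHom_apply, PowerSeries.mapAlgHom_apply]
          simp only [← PowerSeries.coeff_zero_eq_constantCoeff_apply, PowerSeries.coeff_map] at hZ0 ⊢
          rw [hZ0]
        have hup : (fun u => PowerSeries.mapAlgHom ψ (X u)) =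
            Function.update (fun _ => jetTail φ α (v + 1)) v (PowerSeries.mapAlgHom ψ Z) := by
          refine (update_add_one v (fun u => PowerSeries.mapAlgHom ψ (X u))).symm.trans ?_
          rw [hXv, hXu, hpar]
        have hup2 : (Function.update (fun _ => PowerSeries.constantCoeff (jetTail φ α (v + 1))) v
            (PowerSeries.constantCoeff (PowerSeries.mapAlgHom ψ Z))) =
            fun u => PowerSeries.constantCoeff (jetTail φ α u) := by
          rw [hconst]
          exact update_add_one v fun u => PowerSeries.constantCoeff (jetTail φ α u)
        ext i
        -- Below `E + 1` both series solve the same equation with the same constant term; from `E +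
        -- 1` on the coefficients were left free.
        rcases lt_or_ge i (E + 1) with hi | hi
        · refine solution_unique g hνm v (jetTail φ α (v + 1)) _ _ hconst ?_ ?_ ?_ hi
          · rw [hup2]
            exact h.isUnit_aeval_pderiv hv (IsUnit.mk0 _ (hQ.2 v))
          · rw [← hup, ← reducedEval_map]
            have := map_dvd (PowerSeries.mapAlgHom ψ) hZ
            rw [map_pow] at this
            have hmx : PowerSeries.mapAlgHom ψ PowerSeries.X = PowerSeries.X :=
              PowerSeries.map_X _
            rwa [hmx] at this
          · rw [update_add_one]
            exact hQ.1
        · rw [← hpar v, PowerSeries.mapAlgHom_apply, PowerSeries.mapAlgHom_apply,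
            PowerSeries.coeff_map, PowerSeries.coeff_map, hZE i hi]
      · have hw' : w = v + 1 := by omega
        rw [hw', hXu, hpar]
    have hcomp : ψ.comp (jetHom m α X) = φ := by
      apply MvPolynomial.algHom_ext
      rintro ⟨w, n⟩
      rw [AlgHom.comp_apply, jetHom, MvPolynomial.aeval_X]
      have hvar : jetVar k m w n = MvPolynomial.X (w, n) := by
        rw [jetVar, dif_pos n.2]
      rw [← hvar]
      simp only
      split_ifs with hn
      · rw [map_zero, hφ.lt w n hn]
      · have := congrArg (PowerSeries.coeff (n - α w)) (hXQ w)
        rw [PowerSeries.mapAlgHom_apply, PowerSeries.coeff_map] at this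
        refine this.trans ?_
        rw [jetTail, PowerSeries.coeff_mk, Nat.add_sub_cancel' (not_lt.1 hn)]
    rw [← hQφ]
    intro a ha
    rw [mem_pointOf] at ha ⊢
    rw [← hcomp, AlgHom.comp_apply, ha, map_zero]

/-- The generic point of `𝐀²_m ∩ G^α_l` for `l = ν_α(g) + E`. -/
def genericF (h : HasBranchForm α g e p c) {m E : ℕ} (hm : nu α g + E ≤ m) : JetSpace k m :=
  (h.exists_generic hm).choose

theorem genericF_mem (h : HasBranchForm α g e p c) {m E : ℕ} (hm : nu α g + E ≤ m) :
    h.genericF hm ∈ setF g m α (nu α g + E) :=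
  (h.exists_generic hm).choose_spec.1

theorem genericF_le (h : HasBranchForm α g e p c) {m E : ℕ} (hm : nu α g + E ≤ m)
    {Q : JetSpace k m} (hQ : Q ∈ setF g m α (nu α g + E)) : h.genericF hm ≤ Q :=
  (h.exists_generic hm).choose_spec.2 Q hQ

theorem closure_setF (h : HasBranchForm α g e p c) {m E : ℕ} (hm : nu α g + E ≤ m) :
    closure (setF g m α (nu α g + E)) = closure {h.genericF hm} := by
  apply Set.Subset.antisymm
  · refine closure_minimal (fun Q hQ => ?_) isClosed_closure
    rw [← PrimeSpectrum.le_iff_mem_closure]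
    exact h.genericF_le hm hQ
  · exact closure_mono (Set.singleton_subset_iff.2 (h.genericF_mem hm))

theorem mem_setF_of_genericF_le (h : HasBranchForm α g e p c) {m E : ℕ} (hm : nu α g + E ≤ m)
    {Q : JetSpace k m} (hQ : h.genericF hm ≤ Q) (hQ' : ∀ v, jetVar k m v (α v) ∉ Q.asIdeal) :
    Q ∈ setF g m α (nu α g + E) := by
  have h1 := mem_setF.1 (h.genericF_mem hm)
  exact mem_setF.2 ⟨mem_setH.2 fun v n hn => hQ (mem_setH.1 h1.1 v n hn),
    fun n hn => hQ (h1.2.1 n hn), hQ'⟩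

/-- Solve to order `E + 2` and add `t^{E+1}`: the equations up to `ν_α(g) + E` survive, and the next
one fails by uniqueness. -/
theorem exists_mem_diff (h : HasBranchForm α g e p c) {m E : ℕ} (hm : nu α g + (E + 1) ≤ m) :
    ∃ Q ∈ setF g m α (nu α g + E), Q ∉ setF g m α (nu α g + (E + 1)) := by
  obtain ⟨v, hv⟩ := h.exists_cast_ne_zero
  have hαm : ∀ v, α v ≤ m := fun v => by have := h.le_nu v; omega
  have hνm : nu α g ≤ m := by omega
  have hcst : Function.update (fun _ => p (v + 1)) v (p v) =
      fun v => algebraMap k k (p v) * 1 ^ e (v + 1) := by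
    rw [update_add_one v p]
    simp
  have hroot : MvPolynomial.aeval (Function.update (fun _ => p (v + 1)) v (p v))
      (initForm α g) = 0 := by
    rw [hcst]; exact h.aeval_torus 1
  have hu : IsUnit (MvPolynomial.aeval (Function.update (fun _ => p (v + 1)) v (p v))
      (MvPolynomial.pderiv v (initForm α g))) := by
    rw [update_add_one]
    exact h.isUnit_aeval_pderiv hv (IsUnit.mk0 _ (h.torus v))
  obtain ⟨Z, hZ0, -, hZ⟩ := exists_solution g hνm v (PowerSeries.C (p (v + 1)))
    (PowerSeries.C (p v)) (E := E + 2) (by omega) (by simpa using hroot) (by simpa using hu)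
  rw [PowerSeries.constantCoeff_C] at hZ0
  set Z' : PowerSeries k := Z + PowerSeries.X ^ (E + 1) with hZ'
  have hZ'0 : PowerSeries.constantCoeff Z' = p v := by simp [Z', hZ0]
  have hjet := isJet_jetHom (k := k) (m := m) h.pos
    (Function.update (fun _ => PowerSeries.C (p (v + 1))) v Z')
  refine ⟨pointOf (jetHom m α (Function.update (fun _ => PowerSeries.C (p (v + 1))) v Z')), ?_, ?_⟩
  · rw [hjet.pointOf_mem_setF_iff (by omega) hαm]
    refine ⟨?_, fun w => ?_⟩
    · have h1 : PowerSeries.X ^ (E + 1) ∣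
          reducedEval α g m (Function.update (fun _ => PowerSeries.C (p (v + 1))) v Z') -
          reducedEval α g m (Function.update (fun _ => PowerSeries.C (p (v + 1))) v Z) := by
        rw [reducedEval, reducedEval, ← Finset.sum_sub_distrib]
        refine Finset.dvd_sum fun i _ => ?_
        rw [← mul_sub]
        refine Dvd.dvd.mul_left (dvd_aeval_sub_aeval (fun w => ?_) _) _
        by_cases hw : w = v
        · subst hw; simp [Z']
        · simp [hw]
      exact (dvd_sub_left ((pow_dvd_pow _ (by omega)).trans hZ)).1 h1
    · have := congrFun (constantCoeff_update v (PowerSeries.C (p (v + 1))) Z') w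
      rw [this, hZ'0, PowerSeries.constantCoeff_C, update_add_one]
      exact h.torus w
  · rw [hjet.pointOf_mem_setF_iff hm hαm]
    rintro ⟨h1, -⟩
    have h2 := solution_unique g hνm v (PowerSeries.C (p (v + 1))) Z Z'
      (hZ0.trans hZ'0.symm) (by simpa [hZ0] using hu) hZ h1
      (show E + 1 < E + 2 by omega)
    simp [Z'] at h2

/-! ### Heights -/

end HasBranchForm

/-- Krull's height theorem for the `γ₀ + γ₁` defining coordinates. -/
theorem height_genericH_le (m : ℕ) (γ : Fin 2 → ℕ) :
    (genericH k m γ).asIdeal.height ≤ (γ 0 + γ 1 : ℕ) := by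
  classical
  let s : Finset (JetRing k m) :=
    (Finset.univ.sigma fun v => Finset.range (γ v)).image fun q => jetVar k m q.1 q.2
  have hs : s.card ≤ γ 0 + γ 1 := by
    refine Finset.card_image_le.trans ?_
    rw [Finset.card_sigma, Fin.sum_univ_two]
    simp
  have hmin : (genericH k m γ).asIdeal ∈ (Ideal.span (s : Set (JetRing k m))).minimalPrimes := by
    refine ⟨⟨(genericH k m γ).isPrime, Ideal.span_le.2 ?_⟩, ?_⟩
    · intro a ha
      obtain ⟨⟨v, n⟩, hq, rfl⟩ := Finset.mem_image.1 (Finset.mem_coe.1 ha)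
      simp only [Finset.mem_sigma, Finset.mem_univ, true_and, Finset.mem_range] at hq
      exact jetVar_mem_genericH.2 (Or.inl hq)
    · rintro J ⟨hJ, hJs⟩ -
      refine (genericH_le_iff (Q := ⟨J, hJ⟩)).2 (mem_setH.2 fun v n hn => ?_)
      refine hJs (Ideal.subset_span (Finset.mem_coe.2 (Finset.mem_image.2 ⟨⟨v, n⟩, ?_, rfl⟩)))
      simpa using hn
  exact (Ideal.height_le_card_of_mem_minimalPrimes_span_finset hmin).trans (by exact_mod_cast hs)

theorem add_one_le_height {m : ℕ} {P Q : JetSpace k m} (h : P < Q) :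
    P.asIdeal.height + 1 ≤ Q.asIdeal.height :=
  Ideal.height_add_one_le_of_lt_of_isPrime h

/-- A chain that adds one vanishing coordinate at a time. Each of the two directions has only `m +
1` coordinates, whence the bound on `γ`. -/
theorem le_height_genericH {m : ℕ} {γ : Fin 2 → ℕ} (hγ : ∀ v, γ v ≤ m + 1) :
    ((γ 0 + γ 1 : ℕ) : ℕ∞) ≤ (genericH k m γ).asIdeal.height := by
  obtain ⟨N, hN⟩ : ∃ N, N = γ 0 + γ 1 := ⟨_, rfl⟩
  rw [← hN]
  induction N generalizing γ with
  | zero => simp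
  | succ N ih =>
    obtain ⟨v, hv⟩ : ∃ v, 1 ≤ γ v := by
      by_contra hn
      push Not at hn
      have h0 := hn 0
      have h1 := hn 1
      omega
    set δ := Function.update γ v (γ v - 1) with hδ
    have hδv : δ v = γ v - 1 := by simp [δ]
    have hδu : ∀ u, u ≠ v → δ u = γ u := fun u hu => by simp [δ, hu]
    have hle : ∀ u, δ u ≤ γ u := fun u => by
      by_cases hu : u = v
      · rw [hu, hδv]; omega
      · rw [hδu u hu]
    have hsum : N = δ 0 + δ 1 := by
      fin_cases v
      · have := hδu 1 (by simp)
        simp only [Fin.zero_eta] at hδv hv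
        omega
      · have := hδu 0 (by simp)
        simp only [Fin.mk_one] at hδv hv
        omega
    have h1 := ih (fun u => (hle u).trans (hγ u)) hsum
    have hlt : genericH k m δ < genericH k m γ := by
      rw [lt_iff_le_not_ge]
      constructor
      · rw [genericH_le_iff, mem_setH]
        exact fun u n hn => jetVar_mem_genericH.2 (Or.inl (hn.trans_le (hle u)))
      · intro hge
        have h2 : jetVar k m v (γ v - 1) ∈ (genericH k m δ).asIdeal :=
          hge (jetVar_mem_genericH.2 (Or.inl (by omega)))
        have := hγ v
        rcases jetVar_mem_genericH.1 h2 with h3 | h3 <;> omega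
    refine le_trans ?_ (add_one_le_height hlt)
    push_cast
    gcongr

namespace HasBranchForm

variable {α : Fin 2 → ℕ} {g : MvPowerSeries (Fin 2) k} {e : Fin 2 → ℕ} {p : Fin 2 → k} {c : k}

/-- Krull's height theorem for the `α₀ + α₁` coordinates and the `E + 1` equations that do not hold
automatically. -/
theorem height_genericF_le (h : HasBranchForm α g e p c) {m E : ℕ} (hm : nu α g + E ≤ m) :
    (h.genericF hm).asIdeal.height ≤ (α 0 + α 1 + (E + 1) : ℕ) := by
  classical
  have hF := mem_setF.1 (h.genericF_mem hm)
  let s : Finset (JetRing k m) :=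
    ((Finset.univ.sigma fun v => Finset.range (α v)).image fun q => jetVar k m q.1 q.2) ∪
      (Finset.range (E + 1)).image fun i => jetCoeff g m (nu α g + i)
  have hs : s.card ≤ α 0 + α 1 + (E + 1) := by
    refine (Finset.card_union_le _ _).trans (add_le_add (Finset.card_image_le.trans ?_)
      (Finset.card_image_le.trans (by simp)))
    rw [Finset.card_sigma, Fin.sum_univ_two]
    simp
  have hmin : (h.genericF hm).asIdeal ∈ (Ideal.span (s : Set (JetRing k m))).minimalPrimes := by
    refine ⟨⟨(h.genericF hm).isPrime, Ideal.span_le.2 ?_⟩, ?_⟩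
    · intro a ha
      rcases Finset.mem_union.1 (Finset.mem_coe.1 ha) with ha | ha
      · obtain ⟨⟨v, n⟩, hq, rfl⟩ := Finset.mem_image.1 ha
        simp only [Finset.mem_sigma, Finset.mem_univ, true_and, Finset.mem_range] at hq
        exact mem_setH.1 hF.1 v n hq
      · obtain ⟨i, hi, rfl⟩ := Finset.mem_image.1 ha
        have := Finset.mem_range.1 hi
        exact hF.2.1 _ (by omega)
    · rintro J ⟨hJ, hJs⟩ hJF
      have hJH : ∀ v n, n < α v → jetVar k m v n ∈ J := fun v n hn =>
        hJs (Ideal.subset_span (Finset.mem_coe.2 (Finset.mem_union_left _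
          (Finset.mem_image.2 ⟨⟨v, n⟩, by simpa using hn, rfl⟩))))
      -- A smaller prime still omits the leading coordinates, so it lies in the same stratum, above
      -- its generic point.
      refine h.genericF_le hm (Q := ⟨J, hJ⟩) (mem_setF.2 ⟨mem_setH.2 hJH, fun n hn => ?_,
        fun v hv => hF.2.2 v (hJF hv)⟩)
      rcases lt_or_ge n (nu α g) with h1 | h1
      · have hjet : IsJet (residueJet ⟨J, hJ⟩) α (jetTail (residueJet ⟨J, hJ⟩) α) :=
          isJet_jetTail h.pos fun v n hn =>
            (mem_iff_residueJet (Q := ⟨J, hJ⟩)).1 (hJH v n hn)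
        exact (mem_iff_residueJet (Q := ⟨J, hJ⟩)).2 (hjet.eq_zero_of_lt_nu g (by omega) h1)
      · obtain ⟨i, rfl⟩ := Nat.exists_eq_add_of_le h1
        exact hJs (Ideal.subset_span (Finset.mem_coe.2 (Finset.mem_union_right _
          (Finset.mem_image.2 ⟨i, by simp; omega, rfl⟩))))
  exact (Ideal.height_le_card_of_mem_minimalPrimes_span_finset hmin).trans (by exact_mod_cast hs)

/-- On the closure of `𝐀²_m ∩ G^α_l`, the leading coordinates vanish simultaneously. -/
theorem jetVar_mem_iff (h : HasBranchForm α g e p c) {m : ℕ} (hm : nu α g ≤ m)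
    {Q : JetSpace k m} (hH : Q ∈ setH k m α) (hQ : jetCoeff g m (nu α g) ∈ Q.asIdeal)
    (v w : Fin 2) (hv : jetVar k m v (α v) ∈ Q.asIdeal) : jetVar k m w (α w) ∈ Q.asIdeal := by
  have hjet : IsJet (residueJet Q) α (jetTail (residueJet Q) α) :=
    isJet_jetTail h.pos fun v n hn => mem_iff_residueJet.1 (mem_setH.1 hH v n hn)
  rw [mem_iff_residueJet, hjet.apply_nu g hm, h.aeval_initForm] at hQ
  have h1 := (mul_eq_zero.1 hQ).resolve_left ((map_ne_zero _).2 h.ne_zero)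
  have hc : ∀ u, PowerSeries.constantCoeff (jetTail (residueJet Q) α u) =
      residueJet Q (jetVar k m u (α u)) := fun u => by
    rw [← PowerSeries.coeff_zero_eq_constantCoeff_apply]
    simp [jetTail]
  rw [hc, hc] at h1
  rw [mem_iff_residueJet] at hv ⊢
  have he0 := h.one_le 0
  have he1 := h.one_le 1
  have hz : ∀ u, algebraMap k Q.asIdeal.ResidueField (p u)⁻¹ ≠ 0 := fun u =>
    (map_ne_zero _).2 (inv_ne_zero (h.torus u))
  by_cases hvw : v = w
  · rwa [← hvw]
  fin_cases v <;> fin_cases w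
  · exact absurd rfl hvw
  · simp only [Fin.zero_eta, Fin.mk_one] at hv ⊢
    rw [hv, mul_zero, zero_pow (by omega), zero_sub, neg_eq_zero] at h1
    exact (mul_eq_zero.1 (eq_zero_of_pow_eq_zero h1)).resolve_left (hz 1)
  · simp only [Fin.zero_eta, Fin.mk_one] at hv ⊢
    rw [hv, mul_zero, zero_pow (by omega), sub_zero] at h1
    exact (mul_eq_zero.1 (eq_zero_of_pow_eq_zero h1)).resolve_left (hz 0)
  · exact absurd rfl hvw

/-- A chain: the first equation cuts `𝓗^α_m` properly, and each later one cuts the previous stratum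
properly by `exists_mem_diff`. -/
theorem le_height_genericF (h : HasBranchForm α g e p c) {m E : ℕ} (hm : nu α g + E ≤ m) :
    ((α 0 + α 1 + (E + 1) : ℕ) : ℕ∞) ≤ (h.genericF hm).asIdeal.height := by
  have hαm : ∀ v, α v ≤ m := fun v => by have := h.le_nu v; omega
  induction E with
  | zero =>
    have hF := mem_setF.1 (h.genericF_mem hm)
    have hlt : genericH k m α < h.genericF hm := by
      refine lt_of_le_of_ne (genericH_le_iff.2 hF.1) fun heq => ?_
      have h1 : jetCoeff g m (nu α g) ∈ (genericH k m α).asIdeal := by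
        rw [heq]; exact hF.2.1 _ (by omega)
      -- A jet in `𝓗^α_m` at which only one term of the binomial survives, so its initial form is
      -- nonzero.
      let X : Fin 2 → PowerSeries k := ![PowerSeries.C (p 0), 0]
      have hjet := isJet_jetHom (k := k) (m := m) h.pos X
      have h2 : genericH k m α ≤ pointOf (jetHom m α X) :=
        genericH_le_iff.2 (mem_setH.2 hjet.lt)
      have h3 := h2 h1
      rw [mem_pointOf, hjet.apply_nu g (by omega), h.aeval_initForm] at h3
      have := h.one_le 1
      simp [X, h.ne_zero, h.torus 0, zero_pow (show e 1 ≠ 0 by omega)] at h3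
    have h1 := le_height_genericH (k := k) (m := m) (γ := α) fun v => by
      have := hαm v; omega
    refine le_trans ?_ (add_one_le_height hlt)
    push_cast at h1 ⊢
    gcongr
  | succ E ih =>
    have hm' : nu α g + E ≤ m := by omega
    have hlt : h.genericF hm' < h.genericF hm := by
      have hF := mem_setF.1 (h.genericF_mem hm)
      refine lt_of_le_of_ne (h.genericF_le hm' (mem_setF.2 ⟨hF.1,
        fun n hn => hF.2.1 n (by omega), hF.2.2⟩)) fun heq => ?_
      obtain ⟨Q, hQ, hQ'⟩ := h.exists_mem_diff hm
      have h1 := h.genericF_le hm' hQ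
      rw [heq] at h1
      exact hQ' (h.mem_setF_of_genericF_le hm h1 (mem_setF.1 hQ).2.2)
    refine le_trans ?_ (add_one_le_height hlt)
    have := ih hm'
    push_cast at this ⊢
    rw [← add_assoc]
    gcongr

end HasBranchForm


/-! ### Irreducible components -/

/-- No finiteness of the union is needed: the closure of an irreducible subset has a generic point,
and the `T j` that contains this point contains the whole subset. -/
theorem bijOn_componentsOf {Y ι : Type*} [TopologicalSpace Y] [QuasiSober Y] {C : Set Y}
    (hC : IsClosed C) {I : Set ι} {T : ι → Set Y} (hT : ∀ i ∈ I, ∃ x, T i = closure {x})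
    (hCT : C = ⋃ i ∈ I, T i) (hinc : ∀ i ∈ I, ∀ j ∈ I, T i ⊆ T j → i = j) :
    Set.BijOn T I (componentsOf C) := by
  have hsub : ∀ i ∈ I, T i ⊆ C := fun i hi => by
    rw [hCT]; exact Set.subset_biUnion_of_mem (u := T) hi
  have hirr : ∀ i ∈ I, IsIrreducible ((↑) ⁻¹' T i : Set C) := by
    intro i hi
    obtain ⟨x, hx⟩ := hT i hi
    have hxC : x ∈ C := hsub i hi (by rw [hx]; exact subset_closure rfl)
    have h1 : ((↑) ⁻¹' T i : Set C) = closure {⟨x, hxC⟩} := by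
      rw [Topology.IsInducing.subtypeVal.closure_eq_preimage_closure_image, Set.image_singleton, hx]
    rw [h1]
    exact isIrreducible_singleton.closure
  have hcov : ∀ s : Set C, IsIrreducible s → ∃ j ∈ I, s ⊆ (↑) ⁻¹' T j := by
    intro s hs
    have h1 : IsIrreducible ((↑) '' s : Set Y) := hs.image _ continuous_subtype_val.continuousOn
    obtain ⟨y, hy⟩ := QuasiSober.sober h1.closure isClosed_closure
    have hyC : y ∈ C := by
      have h2 : closure ((↑) '' s : Set Y) ⊆ C :=
        closure_minimal (by rintro _ ⟨z, -, rfl⟩; exact z.2) hC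
      exact h2 hy.mem
    rw [hCT] at hyC
    simp only [Set.mem_iUnion] at hyC
    obtain ⟨j, hj, hyj⟩ := hyC
    refine ⟨j, hj, fun z hz => ?_⟩
    have hcl : IsClosed (T j) := by
      obtain ⟨x, hx⟩ := hT j hj
      rw [hx]; exact isClosed_closure
    have h3 : closure {y} ⊆ T j := closure_minimal (Set.singleton_subset_iff.2 hyj) hcl
    rw [hy.def] at h3
    exact h3 (subset_closure ⟨z, hz, rfl⟩)
  have himg : ∀ i ∈ I, (Subtype.val '' ((↑) ⁻¹' T i : Set C)) = T i := by
    intro i hi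
    rw [Subtype.image_preimage_coe, Set.inter_eq_right.2 (hsub i hi)]
  refine ⟨fun i hi => ⟨(↑) ⁻¹' T i, ⟨hirr i hi, fun s hs hle => ?_⟩, himg i hi⟩,
    fun i hi j hj hij => hinc i hi j hj hij.le, ?_⟩
  · obtain ⟨j, hj, hsj⟩ := hcov s hs
    have h1 : T i ⊆ T j := by
      rw [← himg i hi, ← himg j hj]
      exact Set.image_mono (le_trans hle hsj)
    rw [hinc i hi j hj h1]
    exact hsj
  · rintro _ ⟨s, hs, rfl⟩
    obtain ⟨j, hj, hsj⟩ := hcov s hs.1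
    refine ⟨j, hj, ?_⟩
    rw [← himg j hj]
    exact congrArg _ (Set.Subset.antisymm (hs.2 (hirr j hj) hsj) hsj)

/-! ### Exponents and weights -/

theorem weight_mono {α β : Fin 2 → ℕ} (h : ∀ v, α v ≤ β v) (η : Fin 2 →₀ ℕ) :
    Finsupp.weight α η ≤ Finsupp.weight β η := by
  rw [weight_eq, weight_eq]
  exact add_le_add (Nat.mul_le_mul_right _ (h 0)) (Nat.mul_le_mul_right _ (h 1))

theorem nu_mono {α β : Fin 2 → ℕ} (h : ∀ v, α v ≤ β v) {g : MvPowerSeries (Fin 2) k}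
    (hg : g ≠ 0) : nu α g ≤ nu β g := by
  obtain ⟨η, h1, h2⟩ := exists_weight_eq_nu β hg
  rw [← h2]
  exact (nu_le α h1).trans (weight_mono h η)

theorem two_le_of_mem_supp {f : MvPowerSeries (Fin 2) k} (hf : 2 ≤ f.order) {η : Fin 2 →₀ ℕ}
    (hη : η ∈ supp f) : 2 ≤ η 0 + η 1 := by
  have h1 := hf.trans (MvPowerSeries.weightedOrder_le (fun _ => 1) hη)
  rw [weight_eq] at h1
  have : 2 ≤ 1 * η 0 + 1 * η 1 := by exact_mod_cast h1
  omega

/-- Two distinct exponents on the same axis have different weights, so an edge without exponents off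
the axes joins the two axes. -/
theorem exists_mem_minSet_axis {α : Fin 2 → ℕ} (hα : ∀ v, 1 ≤ α v)
    {f : MvPowerSeries (Fin 2) k} (hn : (minSet α f).Nontrivial) :
    (∃ η ∈ minSet α f, 1 ≤ η 0 ∧ 1 ≤ η 1) ∨
      (∃ η ∈ minSet α f, η 1 = 0) ∧ ∃ η ∈ minSet α f, η 0 = 0 := by
  by_contra hcon
  push Not at hcon
  obtain ⟨h1, h2⟩ := hcon
  obtain ⟨η, hη, θ, hθ, hne⟩ := hn
  have hw := hη.2.trans hθ.2.symm
  rw [weight_eq, weight_eq] at hw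
  have hη1 := h1 η hη
  have hθ1 := h1 θ hθ
  apply hne
  by_cases h3 : ∃ ζ ∈ minSet α f, ζ 1 = 0
  · have h4 := h2 h3
    have e0 := h4 η hη
    have e1 := h4 θ hθ
    have e2 : η 1 = 0 := by have := hη1 (by omega); omega
    have e3 : θ 1 = 0 := by have := hθ1 (by omega); omega
    rw [e2, e3] at hw
    have e4 : η 0 = θ 0 := Nat.eq_of_mul_eq_mul_left (hα 0) (by omega)
    ext v
    fin_cases v
    · exact e4
    · exact e2.trans e3.symm
  · push Not at h3
    have e0 := h3 η hη
    have e1 := h3 θ hθ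
    have e2 : η 0 = 0 := by
      by_contra h; have := hη1 (by omega); omega
    have e3 : θ 0 = 0 := by
      by_contra h; have := hθ1 (by omega); omega
    rw [e2, e3] at hw
    have e4 : η 1 = θ 1 := Nat.eq_of_mul_eq_mul_left (hα 1) (by omega)
    ext v
    fin_cases v
    · exact e2.trans e3.symm
    · exact e4

/-- Lowering `α` by `(a, b)` lowers the weight of `η` by `a η₀ + b η₁`, and some `η` of the edge
makes this at least `a + b`: one off the axes, or else the end on the axis of the larger of `a`,
`b`, where `f` has exponent at least `2`. It controls the codimensions of the strata. -/
theorem nu_add_le {f : MvPowerSeries (Fin 2) k} (hf : 2 ≤ f.order) {α β : Fin 2 → ℕ}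
    (hα : ∀ v, 1 ≤ α v) (hn : (minSet α f).Nontrivial) (hβ : ∀ v, β v ≤ α v) :
    nu β f + (α 0 + α 1) ≤ nu α f + (β 0 + β 1) := by
  obtain ⟨a, ha⟩ := Nat.exists_eq_add_of_le (hβ 0)
  obtain ⟨b, hb⟩ := Nat.exists_eq_add_of_le (hβ 1)
  have key : ∀ η ∈ minSet α f, a + b ≤ a * η 0 + b * η 1 →
      nu β f + (α 0 + α 1) ≤ nu α f + (β 0 + β 1) := by
    intro η hη h
    have h1 := nu_le β hη.1
    rw [← hη.2, weight_eq, ha, hb]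
    rw [weight_eq] at h1
    nlinarith
  rcases exists_mem_minSet_axis hα hn with ⟨η, hη, h0, h1⟩ | ⟨⟨η, hη, h1⟩, ⟨θ, hθ, h0⟩⟩
  · refine key η hη ?_
    nlinarith
  · have e1 := two_le_of_mem_supp hf hη.1
    have e2 := two_le_of_mem_supp hf hθ.1
    rcases le_total a b with h | h
    · refine key θ hθ ?_
      nlinarith
    · refine key η hη ?_
      nlinarith

/-- By minimality, lowering `γ_v` by one makes `ν` at most `m`; `η` is an exponent that attains the
new minimum. -/
theorem setB_le {f : MvPowerSeries (Fin 2) k} (hf0 : f ≠ 0) {m : ℕ} {γ : Fin 2 → ℕ}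
    (hγ : γ ∈ setB f m) {v : Fin 2} (hv : 2 ≤ γ v) :
    ∃ η ∈ supp f, Finsupp.weight γ η ≤ m + η v ∧ 1 ≤ η v := by
  set δ := Function.update γ v (γ v - 1) with hδ
  have hδv : δ v = γ v - 1 := by simp [δ]
  have hδu : ∀ u, u ≠ v → δ u = γ u := fun u hu => by simp [δ, hu]
  have hδ1 : ∀ u, 1 ≤ δ u := fun u => by
    by_cases hu : u = v
    · rw [hu, hδv]; omega
    · rw [hδu u hu]; exact hγ.1.1 u
  have hlt : ¬ m < nu δ f := by
    intro h
    have hle : δ ≤ γ := fun u => by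
      change δ u ≤ γ u
      by_cases hu : u = v
      · rw [hu, hδv]; omega
      · rw [hδu u hu]
    have h1 : γ v ≤ δ v := hγ.2 (y := δ) ⟨hδ1, h⟩ hle v
    rw [hδv] at h1
    omega
  obtain ⟨η, h1, h2⟩ := exists_weight_eq_nu δ hf0
  have h3 : Finsupp.weight γ η = Finsupp.weight δ η + η v := by
    rw [weight_eq, weight_eq]
    obtain ⟨b, hb⟩ := Nat.exists_eq_add_of_le hv
    fin_cases v
    · have := hδu 1 (by simp)
      simp only [Fin.zero_eta] at hδv hb ⊢
      rw [this, hδv, hb, show 2 + b - 1 = 1 + b by omega]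
      ring
    · have := hδu 0 (by simp)
      simp only [Fin.mk_one] at hδv hb ⊢
      rw [this, hδv, hb, show 2 + b - 1 = 1 + b by omega]
      ring
  have h4 := nu_le γ h1
  have h5 := hγ.1.2
  exact ⟨η, h1, by omega, by omega⟩

/-- Ensures that `𝓗^γ_m` still determines `γ`, as the coordinates have indices at most `m`. -/
theorem setB_le_succ {f : MvPowerSeries (Fin 2) k} (hf0 : f ≠ 0) {m : ℕ} {γ : Fin 2 → ℕ}
    (hγ : γ ∈ setB f m) (v : Fin 2) : γ v ≤ m + 1 := by
  by_cases hv : 2 ≤ γ v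
  · obtain ⟨η, h1, h2, h3⟩ := setB_le hf0 hγ hv
    have h4 : γ v * η v ≤ Finsupp.weight γ η := by
      rw [weight_eq]
      fin_cases v
      · exact Nat.le_add_right _ _
      · exact Nat.le_add_left _ _
    obtain ⟨b, hb⟩ := Nat.exists_eq_add_of_le hv
    obtain ⟨a, ha⟩ := Nat.exists_eq_add_of_le h3
    rw [hb, ha] at h4
    rw [ha] at h2
    rw [hb]
    nlinarith
  · omega

/-- The exponents of `f` that bound a minimal `α + (1, 1)` with `ν_α(f) = m` lie on the axes. -/
theorem exists_axes_of_mem_setB {f : MvPowerSeries (Fin 2) k} (hf0 : f ≠ 0) {m : ℕ}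
    {α : Fin 2 → ℕ} (hα : ∀ v, 1 ≤ α v) (hm : m = nu α f) (h : α + 1 ∈ setB f m) :
    (∃ η ∈ minSet α f, η 1 = 0) ∧ ∃ η ∈ minSet α f, η 0 = 0 := by
  have key : ∀ v : Fin 2, ∃ η ∈ supp f, Finsupp.weight α η + (η 0 + η 1) ≤ m + η v := by
    intro v
    obtain ⟨η, h1, h2, -⟩ := setB_le hf0 h (v := v) (by
      have := hα v
      simp only [Pi.add_apply, Pi.one_apply]; omega)
    refine ⟨η, h1, le_trans (le_of_eq ?_) h2⟩
    rw [weight_eq, weight_eq]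
    simp only [Pi.add_apply, Pi.one_apply]
    ring
  constructor
  · obtain ⟨η, h1, h2⟩ := key 0
    have := nu_le α h1
    exact ⟨η, ⟨h1, by omega⟩, by omega⟩
  · obtain ⟨η, h1, h2⟩ := key 1
    have := nu_le α h1
    exact ⟨η, ⟨h1, by omega⟩, by omega⟩

theorem nontrivial_of_axes {f : MvPowerSeries (Fin 2) k} (hf : 2 ≤ f.order) {α : Fin 2 → ℕ}
    (h1 : ∃ η ∈ minSet α f, η 1 = 0) (h0 : ∃ η ∈ minSet α f, η 0 = 0) :
    (minSet α f).Nontrivial := by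
  obtain ⟨η, hη, hη1⟩ := h1
  obtain ⟨θ, hθ, hθ0⟩ := h0
  refine ⟨η, hη, θ, hθ, ?_⟩
  rintro rfl
  have := two_le_of_mem_supp hf hη.1
  omega

theorem HasBranchForm.single_mem_minSet {α : Fin 2 → ℕ} {g : MvPowerSeries (Fin 2) k}
    {e : Fin 2 → ℕ} {p : Fin 2 → k} {c : k} (h : HasBranchForm α g e p c) (v : Fin 2) :
    Finsupp.single v (e v) ∈ minSet α g := by
  refine (mem_support_initForm h.pos).1 ?_
  rw [MvPolynomial.mem_support_iff, h.eq, MvPolynomial.coeff_C_mul, branchPoly]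
  have hpow : ∀ w, (MvPolynomial.C (p w)⁻¹ * MvPolynomial.X w : MvPolynomial (Fin 2) k) ^ e w =
      MvPolynomial.monomial (Finsupp.single w (e w)) ((p w)⁻¹ ^ e w) := by
    intro w
    rw [mul_pow, ← map_pow, MvPolynomial.X_pow_eq_monomial, MvPolynomial.C_mul_monomial, mul_one]
  have hne : Finsupp.single (0 : Fin 2) (e 0) ≠ Finsupp.single 1 (e 1) := by
    intro h1
    have h2 := DFunLike.congr_fun h1 0
    have := h.one_le 0
    simp at h2
    omega
  rw [hpow, hpow, MvPolynomial.coeff_sub, MvPolynomial.coeff_monomial,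
    MvPolynomial.coeff_monomial]
  refine mul_ne_zero h.ne_zero ?_
  fin_cases v
  · simp [hne.symm, h.torus]
  · simp [hne, h.torus]

/-- Pure powers of both variables occur, so a factor divisible by a variable has no branch form. -/
theorem HasBranchForm.not_X_dvd {α : Fin 2 → ℕ} {g : MvPowerSeries (Fin 2) k}
    {e : Fin 2 → ℕ} {p : Fin 2 → k} {c : k} (h : HasBranchForm α g e p c) (v : Fin 2) :
    ¬ MvPowerSeries.X v ∣ g := by
  rw [MvPowerSeries.X_dvd_iff]
  intro h1
  refine (h.single_mem_minSet (v + 1)).1 (h1 _ ?_)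
  rw [Finsupp.single_apply, if_neg (by omega)]

theorem HasBranchForm.eq_exponents {α : Fin 2 → ℕ} {g g' : MvPowerSeries (Fin 2) k}
    {e e' : Fin 2 → ℕ} {p p' : Fin 2 → k} {c c' : k} (h : HasBranchForm α g e p c)
    (h' : HasBranchForm α g' e' p' c') : e = e' := by
  have h1 : e 0 * e' 1 = e 1 * e' 0 := by
    have hpos : 0 < α 0 * α 1 := Nat.mul_pos (h.pos 0) (h.pos 1)
    refine Nat.eq_of_mul_eq_mul_right hpos ?_
    calc e 0 * e' 1 * (α 0 * α 1) = (e 0 * α 0) * (e' 1 * α 1) := by ring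
      _ = (e 1 * α 1) * (e' 0 * α 0) := by rw [h.weight, h'.weight]
      _ = _ := by ring
  have d0 : e 0 = e' 0 := Nat.dvd_antisymm
    (h.coprime.dvd_of_dvd_mul_left ⟨e' 1, h1.symm⟩)
    (h'.coprime.dvd_of_dvd_mul_right ⟨e 1, by rw [h1]; ring⟩)
  have d1 : e 1 = e' 1 := by
    rw [d0, mul_comm] at h1
    exact (Nat.eq_of_mul_eq_mul_right (h'.one_le 0) h1).symm
  funext v
  fin_cases v
  · exact d0
  · exact d1

/-- The two binomials have the same exponents, so along the parametrisation through `p` the second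
is a constant times a power of `s`. Vanishing at one torus point over `K` gives vanishing at `p`, a
point over `k`. -/
theorem HasBranchForm.eval_eq_zero_of_common_zero {α : Fin 2 → ℕ}
    {g g' : MvPowerSeries (Fin 2) k} {e e' : Fin 2 → ℕ} {p p' : Fin 2 → k} {c c' : k}
    (h : HasBranchForm α g e p c) (h' : HasBranchForm α g' e' p' c') {K : Type*} [Field K]
    [Algebra k K] {x : Fin 2 → K} (hx : ∀ v, x v ≠ 0)
    (h0 : MvPolynomial.aeval x (initForm α g) = 0)
    (h0' : MvPolynomial.aeval x (initForm α g') = 0) :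
    MvPolynomial.eval p (initForm α g') = 0 := by
  obtain rfl := h.eq_exponents h'
  obtain ⟨s, hs, hsx⟩ := h.exists_torus_parameter hx h0
  rw [h'.aeval_initForm, hsx, hsx] at h0'
  have h1 := (mul_eq_zero.1 h0').resolve_left ((map_ne_zero _).2 h'.ne_zero)
  have h2 : (algebraMap k K ((p' 0)⁻¹ * p 0) ^ e 0 - algebraMap k K ((p' 1)⁻¹ * p 1) ^ e 1) *
      s ^ (e 0 * e 1) = 0 := by
    rw [← h1, map_mul, map_mul]
    change _ = (_ * (_ * s ^ e 1)) ^ e 0 - (_ * (_ * s ^ e 0)) ^ e 1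
    rw [← mul_assoc, ← mul_assoc, mul_pow _ (s ^ e 1), mul_pow _ (s ^ e 0), ← pow_mul, ← pow_mul]
    ring
  have h3 := (mul_eq_zero.1 h2).resolve_right (pow_ne_zero _ hs)
  rw [← map_pow, ← map_pow, ← map_sub, map_eq_zero] at h3
  have h4 := h'.aeval_initForm (A := k) p
  rw [MvPolynomial.aeval_eq_eval] at h4
  simp only [Algebra.algebraMap_self, RingHom.id_apply] at h4
  rw [h3, mul_zero] at h4
  exact h4


/-! ### Newton non-degenerate power series and their irreducible factors -/

section Factors

variable {f : MvPowerSeries (Fin 2) k} {ι : Type*} [Fintype ι] {G : ι → MvPowerSeries (Fin 2) k}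

theorem initForm_factor (hG : ∀ l, Irreducible (G l)) {α : Fin 2 → ℕ} (hα : ∀ v, 1 ≤ α v)
    (hfG : f = ∏ l, G l) : initForm α f = ∏ l, initForm α (G l) := by
  rw [hfG, initForm_prod hα _ _ fun l _ => (hG l).ne_zero]

theorem exists_cofactor [DecidableEq ι] (hG : ∀ l, Irreducible (G l)) (hfG : f = ∏ l, G l) (l : ι) :
    f = G l * ∏ l' ∈ Finset.univ.erase l, G l' ∧ ∏ l' ∈ Finset.univ.erase l, G l' ≠ 0 :=
  ⟨by rw [hfG, Finset.mul_prod_erase _ _ (Finset.mem_univ l)],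
    Finset.prod_ne_zero_iff.2 fun l' _ => (hG l').ne_zero⟩

theorem nu_factor_le (hG : ∀ l, Irreducible (G l)) (hfG : f = ∏ l, G l) {α : Fin 2 → ℕ}
    (hα : ∀ v, 1 ≤ α v) (l : ι) : nu α (G l) ≤ nu α f := by
  classical
  obtain ⟨h1, h2⟩ := exists_cofactor hG hfG l
  rw [h1, nu_mul hα (hG l).ne_zero h2]
  exact Nat.le_add_right _ _

/-- At a zero of one factor the product rule leaves the derivative of that factor times the value of
the cofactor. As this is nonzero, the zero is smooth on the factor and belongs to no other factor.
-/
theorem IsNewtonNondegenerate.hasBranchForm (hf : IsNewtonNondegenerate f)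
    (hG : ∀ l, Irreducible (G l)) (hfG : f = ∏ l, G l) {α : Fin 2 → ℕ} (hα : ∀ v, 1 ≤ α v)
    {l : ι} {p : Fin 2 → k} (hp : ∀ v, p v ≠ 0) (h0 : MvPolynomial.eval p (initForm α (G l)) = 0) :
    (∃ (e : Fin 2 → ℕ) (c : k), HasBranchForm α (G l) e p c) ∧
      ∀ l', MvPolynomial.eval p (initForm α (G l')) = 0 → l' = l := by
  classical
  obtain ⟨h1, h2⟩ := exists_cofactor hG hfG l
  have h3 : initForm α f = initForm α (G l) *
      initForm α (∏ l' ∈ Finset.univ.erase l, G l') := by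
    conv_lhs => rw [h1]
    exact initForm_mul hα (hG l).ne_zero h2
  obtain ⟨v, hv⟩ := hf.exists_pderiv_ne_zero hα hp (by rw [h3, map_mul, h0, zero_mul])
  rw [h3, Derivation.leibniz, map_add, smul_eq_mul, smul_eq_mul, map_mul, map_mul, h0, zero_mul,
    zero_add] at hv
  refine ⟨Irreducible.hasBranchForm hα hp (hG l) h0 ⟨v, right_ne_zero_of_mul hv⟩, fun l' hl' => ?_⟩
  by_contra hne
  apply left_ne_zero_of_mul hv
  rw [initForm_prod hα _ _ fun l' _ => (hG l').ne_zero, map_prod]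
  exact Finset.prod_eq_zero (Finset.mem_erase.2 ⟨hne, Finset.mem_univ _⟩) hl'

theorem IsNewtonNondegenerate.exists_hasBranchForm [IsAlgClosed k] (hf : IsNewtonNondegenerate f)
    (hG : ∀ l, Irreducible (G l)) (hfG : f = ∏ l, G l) {α : Fin 2 → ℕ} (hα : ∀ v, 1 ≤ α v)
    {l : ι} (h : (minSet α (G l)).Nontrivial) :
    ∃ (e : Fin 2 → ℕ) (p : Fin 2 → k) (c : k), HasBranchForm α (G l) e p c := by
  obtain ⟨p, hp, h0⟩ := exists_torus_zero hα h
  obtain ⟨⟨e, c, h⟩, -⟩ := hf.hasBranchForm hG hfG hα hp h0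
  exact ⟨e, p, c, h⟩

/-- Non-degeneracy concerns points over `k`; the parametrisation moves a common zero over `K` to the
`k`-point `p`. -/
theorem IsNewtonNondegenerate.eq_of_common_zero [IsAlgClosed k] (hf : IsNewtonNondegenerate f)
    (hG : ∀ l, Irreducible (G l)) (hfG : f = ∏ l, G l) {α : Fin 2 → ℕ} (hα : ∀ v, 1 ≤ α v)
    {l l' : ι} {K : Type*} [Field K] [Algebra k K] {x : Fin 2 → K} (hx : ∀ v, x v ≠ 0)
    (h0 : MvPolynomial.aeval x (initForm α (G l)) = 0)
    (h0' : MvPolynomial.aeval x (initForm α (G l')) = 0) : l' = l := by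
  obtain ⟨e, p, c, h⟩ := hf.exists_hasBranchForm hG hfG hα
    (minSet_nontrivial_of_aeval_eq_zero hα (hG l).ne_zero hx h0)
  obtain ⟨e', p', c', h'⟩ := hf.exists_hasBranchForm hG hfG hα
    (minSet_nontrivial_of_aeval_eq_zero hα (hG l').ne_zero hx h0')
  exact (hf.hasBranchForm hG hfG hα h.torus (by
    have := h.eval_eq_zero_of_common_zero h hx h0 h0
    exact this)).2 l' (h.eval_eq_zero_of_common_zero h' hx h0 h0')

theorem HasBranchForm.minSet_nontrivial {α : Fin 2 → ℕ} {g : MvPowerSeries (Fin 2) k}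
    {e : Fin 2 → ℕ} {p : Fin 2 → k} {c : k} (h : HasBranchForm α g e p c) :
    (minSet α g).Nontrivial := by
  refine ⟨_, h.single_mem_minSet 0, _, h.single_mem_minSet 1, fun h1 => ?_⟩
  have h2 := DFunLike.congr_fun h1 0
  have := h.one_le 0
  simp at h2
  omega

theorem minSet_nontrivial_iff_exists_factor [IsAlgClosed k] (hG : ∀ l, Irreducible (G l))
    (hfG : f = ∏ l, G l) {α : Fin 2 → ℕ} (hα : ∀ v, 1 ≤ α v) :
    (minSet α f).Nontrivial ↔ ∃ l, (minSet α (G l)).Nontrivial := by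
  have hf0 : f ≠ 0 := by
    rw [hfG]; exact Finset.prod_ne_zero_iff.2 fun l _ => (hG l).ne_zero
  rw [← castPlane_mem_tropicalVariety_iff hα hf0, hfG,
    castPlane_mem_tropicalVariety_prod hα _ _ fun l _ => (hG l).ne_zero]
  simp only [Finset.mem_univ, true_and]
  exact exists_congr fun l => castPlane_mem_tropicalVariety_iff hα (hG l).ne_zero

/-! ### The jet fibre as a union -/

theorem setH_subset_jetFibre {m : ℕ} {γ : Fin 2 → ℕ} (hγ : ∀ v, 1 ≤ γ v) (h : m < nu γ f) :
    setH k m γ ⊆ jetFibre f m := by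
  intro Q hQ
  have hjet : IsJet (residueJet Q) γ (jetTail (residueJet Q) γ) :=
    isJet_jetTail hγ fun v n hn => mem_iff_residueJet.1 (mem_setH.1 hQ v n hn)
  exact mem_jetFibre.2 ⟨fun v => mem_setH.1 hQ v 0 (hγ v), fun n hn =>
    mem_iff_residueJet.2 (hjet.eq_zero_of_lt_nu f hn (by omega))⟩

theorem isClosed_jetFibre (f : MvPowerSeries (Fin 2) k) (m : ℕ) : IsClosed (jetFibre f m) :=
  PrimeSpectrum.isClosed_zeroLocus _

/-- The cofactor always contributes order `ν_α(f) - ν_α(G l)`; the equations of `G l` supply the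
rest of `m + 1`. -/
theorem setF_subset_jetFibre (hG : ∀ l, Irreducible (G l)) (hfG : f = ∏ l, G l) {m : ℕ}
    {α : Fin 2 → ℕ} (hα : ∀ v, 1 ≤ α v) (hm : nu α f ≤ m) (l : ι) :
    setF (G l) m α (nu α (G l) + (m - nu α f)) ⊆ jetFibre f m := by
  classical
  intro Q hQ
  obtain ⟨hH, hc, -⟩ := mem_setF.1 hQ
  have hjet : IsJet (residueJet Q) α (jetTail (residueJet Q) α) :=
    isJet_jetTail hα fun v n hn => mem_iff_residueJet.1 (mem_setH.1 hH v n hn)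
  obtain ⟨h1, h2⟩ := exists_cofactor hG hfG l
  set h := ∏ l' ∈ Finset.univ.erase l, G l'
  have hnu : nu α f = nu α (G l) + nu α h := by
    conv_lhs => rw [h1]
    exact nu_mul hα (hG l).ne_zero h2
  have d1 : PowerSeries.X ^ (nu α (G l) + (m - nu α f) + 1) ∣ jetEval (residueJet Q) (G l) := by
    rw [PowerSeries.X_pow_dvd_iff]
    intro n hn
    rw [coeff_jetEval]
    exact mem_iff_residueJet.1 (hc n (by omega))
  have d2 : PowerSeries.X ^ nu α h ∣ jetEval (residueJet Q) h := by
    rw [PowerSeries.X_pow_dvd_iff]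
    intro n hn
    rw [coeff_jetEval]
    exact hjet.eq_zero_of_lt_nu h (by omega) hn
  have d3 : PowerSeries.X ^ (m + 1) ∣ jetEval (residueJet Q) f := by
    have := mul_dvd_mul d1 d2
    rwa [← pow_add, ← map_mul, ← h1,
      show nu α (G l) + (m - nu α f) + 1 + nu α h = m + 1 by omega] at this
  refine mem_jetFibre.2 ⟨fun v => mem_setH.1 hH v 0 (hα v), fun n hn => ?_⟩
  rw [mem_iff_residueJet, ← coeff_jetEval]
  exact PowerSeries.X_pow_dvd_iff.1 d3 n (by omega)

theorem exists_setB_le {m : ℕ} {α : Fin 2 → ℕ} (hα : ∀ v, 1 ≤ α v) (h : m < nu α f) :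
    ∃ γ ∈ setB f m, γ ≤ α := by
  obtain ⟨γ, h1, h2⟩ := exists_minimal_le_of_wellFoundedLT
    (fun γ : Fin 2 → ℕ => (∀ v, 1 ≤ γ v) ∧ m < nu γ f) α ⟨hα, h⟩
  exact ⟨γ, h2, h1⟩

theorem exists_isJet {m : ℕ} {K : Type*} [Field K] [Algebra k K] (φ : JetRing k m →ₐ[k] K)
    (h0 : ∀ v, φ (jetVar k m v 0) = 0) :
    ∃ (α : Fin 2 → ℕ) (X : Fin 2 → PowerSeries K), IsJet φ α X ∧
      ∀ v, PowerSeries.constantCoeff (X v) ≠ 0 := by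
  classical
  have key : ∀ v, ∃ (a : ℕ) (Y : PowerSeries K), 1 ≤ a ∧ (∀ n < a, φ (jetVar k m v n) = 0) ∧
      (∀ i, a + i ≤ m → φ (jetVar k m v (a + i)) = PowerSeries.coeff i Y) ∧
      PowerSeries.constantCoeff Y ≠ 0 := by
    intro v
    by_cases h : ∃ n, φ (jetVar k m v n) ≠ 0
    · refine ⟨Nat.find h, PowerSeries.mk fun i => φ (jetVar k m v (Nat.find h + i)), ?_,
        fun n hn => not_not.1 (Nat.find_min h hn), fun i _ => by simp, ?_⟩
      · refine Nat.pos_of_ne_zero fun h1 => ?_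
        have := Nat.find_spec h
        rw [h1] at this
        exact this (h0 v)
      · rw [← PowerSeries.coeff_zero_eq_constantCoeff_apply, PowerSeries.coeff_mk]
        exact Nat.find_spec h
    · push Not at h
      -- A coordinate that vanishes identically receives the order `m + 1` and the series `1`, about
      -- which nothing is then required.
      exact ⟨m + 1, 1, by omega, fun n _ => h n, fun i hi => by omega, by simp⟩
  choose α X h1 h2 h3 h4 using key
  exact ⟨α, X, ⟨h1, h2, h3⟩, h4⟩

/-- The stratification by order vectors: either `ν_α(f)` exceeds `m`, or the leading coefficients
are a torus zero of exactly one factor, and that factor has to satisfy all the remaining equations.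
-/
theorem exists_of_mem_jetFibre [IsAlgClosed k] (hf : IsNewtonNondegenerate f)
    (hG : ∀ l, Irreducible (G l)) (hfG : f = ∏ l, G l) {m : ℕ} {Q : JetSpace k m}
    (hQ : Q ∈ jetFibre f m) :
    (∃ γ ∈ setB f m, Q ∈ setH k m γ) ∨
      ∃ (α : Fin 2 → ℕ) (l : ι), (∀ v, 1 ≤ α v) ∧ (minSet α (G l)).Nontrivial ∧ nu α f ≤ m ∧
        Q ∈ setF (G l) m α (nu α (G l) + (m - nu α f)) := by
  classical
  obtain ⟨hQ0, hQf⟩ := mem_jetFibre.1 hQ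
  obtain ⟨α, X, hjet, hX⟩ := exists_isJet (residueJet Q) fun v => mem_iff_residueJet.1 (hQ0 v)
  have hH : Q ∈ setH k m α := mem_setH.2 fun v n hn => mem_iff_residueJet.2 (hjet.lt v n hn)
  have hα := hjet.one_le
  rcases lt_or_ge m (nu α f) with hm | hm
  · left
    obtain ⟨γ, hγ, hγα⟩ := exists_setB_le hα hm
    exact ⟨γ, hγ, mem_setH.2 fun v n hn => mem_setH.1 hH v n (hn.trans_le (hγα v))⟩
  · right
    have h0 := mem_iff_residueJet.1 (hQf _ hm)
    rw [hjet.apply_nu f hm, initForm_factor hG hα hfG, map_prod, Finset.prod_eq_zero_iff] at h0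
    obtain ⟨l, -, hl⟩ := h0
    have hn := minSet_nontrivial_of_aeval_eq_zero hα (hG l).ne_zero hX hl
    refine ⟨α, l, hα, hn, hm, ?_⟩
    obtain ⟨e, p, c, hB⟩ := hf.exists_hasBranchForm hG hfG hα hn
    have hle := nu_factor_le hG hfG hα l
    have hαm : ∀ v, α v ≤ m := fun v => (hB.le_nu v).trans (hle.trans hm)
    obtain ⟨h1, h2⟩ := exists_cofactor hG hfG l
    set h := ∏ l' ∈ Finset.univ.erase l, G l' with hh
    have hnu : nu α f = nu α (G l) + nu α h := by
      conv_lhs => rw [h1]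
      exact nu_mul hα (hG l).ne_zero h2
    -- No other factor vanishes at the leading coefficients, so the cofactor is `t^{ν_α(h)}` times a
    -- unit and can be cancelled.
    have hne : residueJet Q (jetCoeff h m (nu α h)) ≠ 0 := by
      rw [hjet.apply_nu h (by omega), hh, initForm_prod hα _ _ fun l' _ => (hG l').ne_zero,
        map_prod, Finset.prod_ne_zero_iff]
      intro l' hl' h0
      exact (Finset.mem_erase.1 hl').1 (hf.eq_of_common_zero hG hfG hα hX hl h0)
    have d2 : PowerSeries.X ^ nu α h ∣ jetEval (residueJet Q) h := by
      rw [PowerSeries.X_pow_dvd_iff]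
      intro n hn
      rw [coeff_jetEval]
      exact hjet.eq_zero_of_lt_nu h (by omega) hn
    obtain ⟨u, hu⟩ := d2
    have hu0 : IsUnit u := by
      rw [PowerSeries.isUnit_iff_constantCoeff, isUnit_iff_ne_zero]
      rw [← coeff_jetEval, hu, PowerSeries.coeff_X_pow_mul', if_pos le_rfl, Nat.sub_self,
        PowerSeries.coeff_zero_eq_constantCoeff_apply] at hne
      exact hne
    have d3 : PowerSeries.X ^ (m + 1) ∣ jetEval (residueJet Q) f := by
      rw [PowerSeries.X_pow_dvd_iff]
      intro n hn
      rw [coeff_jetEval]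
      exact mem_iff_residueJet.1 (hQf n (by omega))
    have d1 : PowerSeries.X ^ (nu α (G l) + (m - nu α f) + 1) ∣ jetEval (residueJet Q) (G l) := by
      have he : (PowerSeries.X : PowerSeries Q.asIdeal.ResidueField) ^ (m + 1) =
          PowerSeries.X ^ nu α h * PowerSeries.X ^ (nu α (G l) + (m - nu α f) + 1) := by
        rw [← pow_add]; congr 1; omega
      rw [he, h1, map_mul, ← h1, hu, mul_left_comm] at d3
      have := (mul_dvd_mul_iff_left (pow_ne_zero _ PowerSeries.X_ne_zero)).1 d3
      exact (hu0.dvd_mul_right).1 this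
    refine mem_setF.2 ⟨hH, fun n hn => ?_, fun v => ?_⟩
    · rw [mem_iff_residueJet, ← coeff_jetEval]
      exact PowerSeries.X_pow_dvd_iff.1 d1 n (by omega)
    · rw [mem_iff_residueJet]
      have := hjet.add v 0 (hαm v)
      rw [add_zero, PowerSeries.coeff_zero_eq_constantCoeff_apply] at this
      rw [this]
      exact hX v

/-! ### Containments -/

namespace HasBranchForm

variable {α : Fin 2 → ℕ} {g : MvPowerSeries (Fin 2) k} {e : Fin 2 → ℕ} {p : Fin 2 → k} {c : k}

/-- For `E = 0` the only condition is that the leading coefficients annihilate the initial form.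
Letting the torus parameter tend to `0`, with the later coefficients arbitrary, reaches the generic
point of `𝓗^{α+(1,1)}`. -/
theorem genericF_le_genericH_add_one (h : HasBranchForm α g e p c) {m : ℕ}
    (hm : nu α g + 0 ≤ m) : h.genericF hm ≤ genericH k m (α + 1) := by
  have hαm : ∀ v, α v ≤ m := fun v => by have := h.le_nu v; omega
  -- The polynomial variable is the torus parameter, set to `0` in `hcomp`.
  let X : Fin 2 → PowerSeries (Polynomial (JetRing k m)) := fun v => PowerSeries.mk fun i =>
    if i = 0 then algebraMap k (Polynomial (JetRing k m)) (p v) * Polynomial.X ^ e (v + 1)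
    else Polynomial.C (truncJet k m (α + 1) (jetVar k m v (α v + i)))
  have hX : (fun v => PowerSeries.constantCoeff (X v)) = fun v =>
      algebraMap k (Polynomial (JetRing k m)) (p v) * Polynomial.X ^ e (v + 1) := by
    funext v
    rw [← PowerSeries.coeff_zero_eq_constantCoeff_apply]
    simp [X]
  have hjet := isJet_jetHom (k := k) (m := m) h.pos X
  have hmem : pointOf (jetHom m α X) ∈ setF g m α (nu α g + 0) := by
    rw [hjet.pointOf_mem_setF_iff hm hαm]
    refine ⟨?_, fun v => ?_⟩
    · rw [zero_add, pow_one, PowerSeries.X_dvd_iff, constantCoeff_reducedEval g (by omega), hX]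
      exact h.aeval_torus _
    · rw [congrFun hX v]
      refine mul_ne_zero ?_ (pow_ne_zero _ Polynomial.X_ne_zero)
      exact ((IsUnit.mk0 _ (h.torus v)).map _).ne_zero
  refine (h.genericF_le hm hmem).trans fun a ha => ?_
  have hcomp : ((Polynomial.aeval (0 : JetRing k m)).restrictScalars k).comp (jetHom m α X) =
      truncJet k m (α + 1) := by
    apply MvPolynomial.algHom_ext
    rintro ⟨v, n⟩
    have hvar : MvPolynomial.X (v, n) = jetVar k m v n := by
      rw [jetVar, dif_pos n.2]
    rw [AlgHom.comp_apply, jetHom, MvPolynomial.aeval_X]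
    simp only
    split_ifs with hn
    · rw [map_zero, truncJet, MvPolynomial.aeval_X, if_pos]
      exact lt_trans hn (Nat.lt_succ_self _)
    · by_cases h0 : (n : ℕ) - α v = 0
      · have he := h.one_le (v + 1)
        simp [X, h0, truncJet, show ¬ α v < (n : ℕ) by omega,
          zero_pow (show e (v + 1) ≠ 0 by omega)]
      · rw [hvar]
        simp only [X, PowerSeries.coeff_mk, if_neg h0]
        rw [Nat.add_sub_cancel' (not_lt.1 hn)]
        simp
  change truncJet k m (α + 1) a = 0
  rw [← hcomp, AlgHom.comp_apply, mem_pointOf.1 ha, map_zero]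

end HasBranchForm

/-- For `γ ≤ m` the leading coordinates on `𝓗^γ` are independent variables, so a nonzero initial
form does not vanish on them. -/
theorem jetCoeff_nu_notMem_genericH {m : ℕ} {γ : Fin 2 → ℕ} (hγ : ∀ v, 1 ≤ γ v)
    (hγm : ∀ v, γ v ≤ m) {g : MvPowerSeries (Fin 2) k} (hg : g ≠ 0) (hm : nu γ g ≤ m) :
    jetCoeff g m (nu γ g) ∉ (genericH k m γ).asIdeal := by
  rw [genericH, mem_pointOf]
  have hjet : IsJet (truncJet k m γ) γ (jetTail (truncJet k m γ) γ) :=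
    isJet_jetTail hγ fun v n hn => (jetVar_mem_genericH (k := k) (m := m)).2 (Or.inl hn)
  rw [hjet.apply_nu g hm]
  have hX : (fun v => PowerSeries.constantCoeff (jetTail (truncJet k m γ) γ v)) =
      fun v => MvPolynomial.X (R := k) ((v, ⟨γ v, Nat.lt_succ_of_le (hγm v)⟩) :
        Fin 2 × Fin (m + 1)) := by
    funext v
    rw [← PowerSeries.coeff_zero_eq_constantCoeff_apply]
    rw [jetTail, PowerSeries.coeff_mk, add_zero, jetVar, dif_pos (Nat.lt_succ_of_le (hγm v)),
      truncJet, MvPolynomial.aeval_X, if_neg (lt_irrefl _)]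
  rw [hX]
  intro h
  have h1 : MvPolynomial.rename (fun v : Fin 2 => ((v, ⟨γ v, Nat.lt_succ_of_le (hγm v)⟩) :
      Fin 2 × Fin (m + 1))) (initForm γ g) = 0 := by
    rw [← h]
    exact DFunLike.congr_fun (MvPolynomial.algHom_ext fun v => by simp) _
  have hinj : Function.Injective (fun v : Fin 2 => ((v, ⟨γ v, Nat.lt_succ_of_le (hγm v)⟩) :
      Fin 2 × Fin (m + 1))) := fun a b hab => (Prod.ext_iff.1 hab).1
  rw [← map_zero (MvPolynomial.rename _)] at h1
  exact initForm_ne_zero hγ hg (MvPolynomial.rename_injective _ hinj h1)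

theorem eq_of_genericH_le {m : ℕ} (hf0 : f ≠ 0) {γ γ' : Fin 2 → ℕ} (hγ : γ ∈ setB f m)
    (hγ' : γ' ∈ setB f m) (h : genericH k m γ ≤ genericH k m γ') : γ = γ' := by
  have hle : γ ≤ γ' := by
    intro v
    have h1 := hγ.1.1 v
    have h2 := setB_le_succ hf0 hγ v
    have h3 := jetVar_mem_genericH.1 (h (jetVar_mem_genericH.2
      (Or.inl (show γ v - 1 < γ v by omega))))
    change γ v ≤ γ' v
    omega
  exact le_antisymm hle (hγ'.2 hγ.1 hle)

theorem HasBranchForm.not_genericH_le {m E : ℕ} (hf0 : f ≠ 0) {γ α : Fin 2 → ℕ}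
    (hγ : γ ∈ setB f m) {g : MvPowerSeries (Fin 2) k} {e : Fin 2 → ℕ} {p : Fin 2 → k} {c : k}
    (h : HasBranchForm α g e p c) (hm : nu α g + E ≤ m) (hfm : nu α f ≤ m) :
    ¬ genericH k m γ ≤ h.genericF hm := by
  intro hle
  have hF := mem_setF.1 (h.genericF_mem hm)
  have h1 : ∀ v, γ v ≤ α v := by
    intro v
    by_contra hn
    exact hF.2.2 v (hle (jetVar_mem_genericH.2 (Or.inl (not_le.1 hn))))
  have := nu_mono h1 hf0
  have := hγ.1.2
  omega

/-- Inclusion forces `β ≤ α`. For `β = α` the two factors share a torus zero. Otherwise the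
inclusion is strict and the heights contradict `nu_add_le`. -/
theorem eq_of_genericF_le [IsAlgClosed k] (hf : IsNewtonNondegenerate f) (hsing : 2 ≤ f.order)
    (hG : ∀ l, Irreducible (G l)) (hfG : f = ∏ l, G l) {m : ℕ} {α β : Fin 2 → ℕ} {l l' : ι}
    {e e' : Fin 2 → ℕ} {p p' : Fin 2 → k} {c c' : k}
    (h : HasBranchForm α (G l) e p c) (h' : HasBranchForm β (G l') e' p' c')
    (hαm : nu α f ≤ m) (hβm : nu β f ≤ m)
    (hm : nu α (G l) + (m - nu α f) ≤ m) (hm' : nu β (G l') + (m - nu β f) ≤ m)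
    (hle : h'.genericF hm' ≤ h.genericF hm) : β = α ∧ l' = l := by
  have hF := mem_setF.1 (h.genericF_mem hm)
  have hF' := mem_setF.1 (h'.genericF_mem hm')
  have hH : h.genericF hm ∈ setH k m β :=
    mem_setH.2 fun v n hn => hle (mem_setH.1 hF'.1 v n hn)
  have hc : jetCoeff (G l') m (nu β (G l')) ∈ (h.genericF hm).asIdeal :=
    hle (hF'.2.1 _ (by omega))
  have hβα : ∀ v, β v ≤ α v := by
    intro v
    by_contra hn
    exact hF.2.2 v (mem_setH.1 hH v _ (not_le.1 hn))
  by_cases heq : β = α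
  · refine ⟨heq, ?_⟩
    subst heq
    set φ := residueJet (h.genericF hm)
    have hjet : IsJet φ β (jetTail φ β) :=
      isJet_jetTail h.pos fun v n hn => mem_iff_residueJet.1 (mem_setH.1 hH v n hn)
    have hx : ∀ v, PowerSeries.constantCoeff (jetTail φ β v) ≠ 0 := by
      intro v
      rw [← PowerSeries.coeff_zero_eq_constantCoeff_apply, jetTail, PowerSeries.coeff_mk]
      exact fun h0 => hF.2.2 v (mem_iff_residueJet.2 h0)
    have h1 := mem_iff_residueJet.1 (hF.2.1 (nu β (G l)) (by omega))
    have h2 := mem_iff_residueJet.1 hc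
    rw [hjet.apply_nu _ (by omega)] at h1 h2
    exact hf.eq_of_common_zero hG hfG h.pos hx h1 h2
  · exfalso
    obtain ⟨v, hv⟩ : ∃ v, β v < α v := by
      by_contra hn
      push Not at hn
      exact heq (funext fun v => le_antisymm (hβα v) (hn v))
    have hv' := mem_setH.1 hF.1 v _ hv
    have hlt : h'.genericF hm' < h.genericF hm := by
      refine lt_of_le_of_ne hle fun h1 => hF'.2.2 v ?_
      rw [h1]; exact hv'
    have h1 := (add_le_add_left (h'.le_height_genericF hm') 1).trans
      ((add_one_le_height hlt).trans (h.height_genericF_le hm))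
    have h2 : β 0 + β 1 + (m - nu β f + 1) + 1 ≤ α 0 + α 1 + (m - nu α f + 1) := by
      exact_mod_cast h1
    have h3 := nu_add_le hsing h.pos ((minSet_nontrivial_iff_exists_factor hG hfG h.pos).2
      ⟨l, h.minSet_nontrivial⟩) hβα
    omega

end Factors


/-! ### The role of `B*_m`, and the decomposition for a list of irreducible factors -/

section Components

variable {f : MvPowerSeries (Fin 2) k} {ι : Type*} [Fintype ι] {G : ι → MvPowerSeries (Fin 2) k}

/-- The minimal exponents on the two axes bound the coordinates of a competitor `β` from below
separately. -/
theorem mem_setB_of_add_one (hf : 2 ≤ f.order) {n : ℕ} {α : Fin 2 → ℕ} (hα : ∀ v, 1 ≤ α v)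
    (hm : n + 1 = nu α f) (h1 : ∃ η ∈ minSet α f, η 1 = 0) (h0 : ∃ η ∈ minSet α f, η 0 = 0) :
    α ∈ setB f n := by
  refine ⟨⟨hα, by omega⟩, ?_⟩
  rintro β ⟨hβ, hβn⟩ hle v
  obtain ⟨η, hη, hη1⟩ := h1
  obtain ⟨θ, hθ, hθ0⟩ := h0
  have e1 := nu_le β hη.1
  have e2 := nu_le β hθ.1
  have e3 := hη.2
  have e4 := hθ.2
  have e5 := two_le_of_mem_supp hf hη.1
  have e6 := two_le_of_mem_supp hf hθ.1
  rw [weight_eq] at e1 e2 e3 e4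
  rw [hη1, mul_zero, add_zero] at e1 e3
  rw [hθ0, mul_zero, zero_add] at e2 e4
  have g1 : α 0 * η 0 ≤ β 0 * η 0 := by omega
  have g2 : α 1 * θ 1 ≤ β 1 * θ 1 := by omega
  fin_cases v
  · exact Nat.le_of_mul_le_mul_right g1 (by omega)
  · exact Nat.le_of_mul_le_mul_right g2 (by omega)

/-- Minimality of `α + (1,1)` puts minimal exponents of `f` on both axes, and then the other
conditions for removal, `α ∈ B_{m-1}` and `α ∈ ∂σ`, are automatic. -/
theorem add_one_notMem_setBstar [IsAlgClosed k] (hf : 2 ≤ f.order) (hf0 : f ≠ 0) {m : ℕ}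
    {α : Fin 2 → ℕ} (hα : ∀ v, 1 ≤ α v) (hm : m = nu α f) (h : α + 1 ∈ setB f m) :
    α + 1 ∉ setBstar f m := by
  obtain ⟨h1, h0⟩ := exists_axes_of_mem_setB hf0 hα hm h
  have hT := (castPlane_mem_tropicalVariety_iff hα hf0).2 (nontrivial_of_axes hf h1 h0)
  obtain ⟨n, rfl⟩ : ∃ n, m = n + 1 := by
    obtain ⟨η, hη, hη1⟩ := h1
    have e3 := hη.2
    have e5 := two_le_of_mem_supp hf hη.1
    rw [weight_eq, hη1, mul_zero, add_zero] at e3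
    have : 1 * 1 ≤ α 0 * η 0 := Nat.mul_le_mul (hα 0) (by omega)
    exact ⟨m - 1, by omega⟩
  intro hstar
  refine hstar.2 ⟨n, α, rfl, hm, mem_setB_of_add_one hf hα hm h1 h0, ?_, rfl⟩
  obtain ⟨η, hη, hη1⟩ := h1
  obtain ⟨θ, hθ, hθ0⟩ := h0
  exact mem_frontier_of_axes hα hη hη1 hθ hθ0 hT

/-- Since `ν_γ(f) > ν_α(f)`, some leading coordinate vanishes on `𝓗^γ`; by `jetVar_mem_iff` both do.
-/
theorem add_one_le_of_genericF_le (hf0 : f ≠ 0) {m E : ℕ} {γ α : Fin 2 → ℕ} (hγ : γ ∈ setB f m)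
    {g : MvPowerSeries (Fin 2) k} {e : Fin 2 → ℕ} {p : Fin 2 → k} {c : k}
    (h : HasBranchForm α g e p c) (hm : nu α g + E ≤ m) (hfm : nu α f ≤ m)
    (hle : h.genericF hm ≤ genericH k m γ) : ∀ v, α v + 1 ≤ γ v := by
  have hαm : ∀ v, α v ≤ m := fun v => by have := h.le_nu v; omega
  have hF := mem_setF.1 (h.genericF_mem hm)
  have hH : genericH k m γ ∈ setH k m α :=
    mem_setH.2 fun v n hn => hle (mem_setH.1 hF.1 v n hn)
  have hαγ : ∀ v, α v ≤ γ v := by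
    intro v
    have h1 := h.pos v
    have h2 := hαm v
    have := jetVar_mem_genericH.1 (mem_setH.1 hH v (α v - 1) (by omega))
    omega
  have hiff := h.jetVar_mem_iff (by omega) hH (hle (hF.2.1 _ (by omega)))
  obtain ⟨v, hv⟩ : ∃ v, α v < γ v := by
    by_contra hn
    push Not at hn
    have h1 := nu_mono hn hf0
    have h2 := hγ.1.2
    omega
  intro w
  have h1 := jetVar_mem_genericH.1 (hiff v w (jetVar_mem_genericH.2 (Or.inl hv)))
  have h2 := hαm w
  omega

/-- If `ν_α(f) = m`, then `α + (1,1)` already has `ν > m`, so `γ` equals it and was removed. If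
`ν_α(f) < m`, heights and minimality of `γ` leave one numerical case, which an equation of `g`
excludes. -/
theorem notMem_setBstar_of_genericF_le [IsAlgClosed k] (hsing : 2 ≤ f.order) (hf0 : f ≠ 0)
    {m : ℕ} {γ α : Fin 2 → ℕ} {g : MvPowerSeries (Fin 2) k} (hg0 : g ≠ 0) {e : Fin 2 → ℕ}
    {p : Fin 2 → k} {c : k}
    (h : HasBranchForm α g e p c) (hfm : nu α f ≤ m)
    (hm : nu α g + (m - nu α f) ≤ m) (hle : h.genericF hm ≤ genericH k m γ) :
    γ ∉ setBstar f m := by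
  intro hstar
  have hγ := hstar.1
  have hαγ := add_one_le_of_genericF_le hf0 hγ h hm hfm hle
  have hpos := h.pos
  rcases hfm.eq_or_lt with hmα | hlt
  · have hle1 : α + 1 ≤ γ := hαγ
    have hmin : γ = α + 1 := by
      refine le_antisymm (hγ.2 ⟨fun v => ?_, ?_⟩ hle1) hle1
      · simp
      · obtain ⟨η, h1, h2⟩ := exists_weight_eq_nu (α + 1) hf0
        have h3 := nu_le α h1
        have h4 := two_le_of_mem_supp hsing h1
        rw [← h2, weight_eq]
        rw [weight_eq] at h3
        simp only [Pi.add_apply, Pi.one_apply, add_mul, one_mul]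
        omega
    subst hmin
    exact add_one_notMem_setBstar hsing hf0 hpos hmα.symm hγ hstar
  · have hheight : α 0 + α 1 + (m - nu α f + 1) + 1 ≤ γ 0 + γ 1 := by
      have h1 : h.genericF hm < genericH k m γ :=
        lt_of_le_of_ne hle fun heq => h.not_genericH_le hf0 hγ hm hfm heq.ge
      exact_mod_cast (add_le_add_left (h.le_height_genericF hm) 1).trans
        ((add_one_le_height h1).trans (height_genericH_le m γ))
    -- Write `γ = α + (1,1) + (a,b)` and `m = ν_α(f) + N`. Heights give `N ≤ a + b`. Minimality of
    -- `γ` gives `k1` and `k2`, which force `η` and `θ` onto the axes and `2a = 2b = N`.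
    obtain ⟨a, ha⟩ := Nat.exists_eq_add_of_le (hαγ 0)
    obtain ⟨b, hb⟩ := Nat.exists_eq_add_of_le (hαγ 1)
    obtain ⟨N, hN⟩ := Nat.exists_eq_add_of_le hfm
    obtain ⟨η, hη, hη1, hη2⟩ := setB_le hf0 hγ (v := 0) (by have := hpos 0; omega)
    obtain ⟨θ, hθ, hθ1, hθ2⟩ := setB_le hf0 hγ (v := 1) (by have := hpos 1; omega)
    have e1 := nu_le α hη
    have e2 := nu_le α hθ
    have o1 := two_le_of_mem_supp hsing hη
    have o2 := two_le_of_mem_supp hsing hθ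
    rw [weight_eq] at hη1 hθ1 e1 e2
    rw [ha, hb] at hη1 hθ1
    have k1 : a * η 0 + (b + 1) * η 1 ≤ N := by nlinarith
    have k2 : (a + 1) * θ 0 + b * θ 1 ≤ N := by nlinarith
    have hab : N ≤ a + b := by omega
    have z1 : η 1 = 0 := by
      by_contra hne
      have q1 : a * 1 ≤ a * η 0 := Nat.mul_le_mul_left _ hη2
      have q2 : (b + 1) * 1 ≤ (b + 1) * η 1 := Nat.mul_le_mul_left _ (by omega)
      omega
    have z2 : θ 0 = 0 := by
      by_contra hne
      have q1 : b * 1 ≤ b * θ 1 := Nat.mul_le_mul_left _ hθ2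
      have q2 : (a + 1) * 1 ≤ (a + 1) * θ 0 := Nat.mul_le_mul_left _ (by omega)
      omega
    rw [z1, mul_zero, add_zero] at k1 hη1 e1
    rw [z2, mul_zero, zero_add] at k2 hθ1 e2
    have q1 : a * 2 ≤ a * η 0 := Nat.mul_le_mul_left _ (by omega)
    have q2 : b * 2 ≤ b * θ 1 := Nat.mul_le_mul_left _ (by omega)
    have haN : 2 * a = N := by omega
    have hbN : 2 * b = N := by omega
    have hη0 : η 0 = 2 := by
      have : a * η 0 ≤ a * 2 := by omega
      have := Nat.le_of_mul_le_mul_left this (by omega)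
      omega
    have hθ0 : θ 1 = 2 := by
      have : b * θ 1 ≤ b * 2 := by omega
      have := Nat.le_of_mul_le_mul_left this (by omega)
      omega
    rw [hη0] at e1 hη1
    rw [hθ0] at e2 hθ1
    have hα01 : α 0 = α 1 := by omega
    -- Both `2α₀` and `2α₁` equal `ν_α(f)`, so the coprime exponents of the branch are equal to `1`.
    have he : e 0 = 1 ∧ e 1 = 1 := by
      have hw := h.weight
      rw [hα01] at hw
      have heq := Nat.eq_of_mul_eq_mul_right (hpos 1) hw
      have hc := h.coprime
      rw [heq, Nat.coprime_self] at hc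
      omega
    have hnu : nu α g = α 0 := by rw [h.nu_eq, he.1, one_mul]
    have hmem := h.single_mem_minSet 0
    have hγg : nu γ g ≤ γ 0 := by
      refine (nu_le γ hmem.1).trans (le_of_eq ?_)
      rw [weight_eq, he.1]
      simp
    have hF := mem_setF.1 (h.genericF_mem hm)
    -- As `a ≥ 1`, `ν_γ(g) ≤ γ₀ = α₀ + 1 + a ≤ α₀ + N`, so the equation of index `ν_γ(g)` is among
    -- those imposed on `g`, yet it is nonzero on `𝓗^γ`.
    refine jetCoeff_nu_notMem_genericH hγ.1.1 (fun v => ?_) hg0 (by omega)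
      (hle (hF.2.1 (nu γ g) (by omega)))
    fin_cases v
    · show γ 0 ≤ m
      omega
    · show γ 1 ≤ m
      omega

theorem infiniteComponent_eq (g : MvPowerSeries (Fin 2) k) {m : ℕ} {α : Fin 2 → ℕ}
    (hm : nu α f ≤ m) :
    infiniteComponent f g m α = closure (setF g m α (nu α g + (m - nu α f))) := by
  rw [infiniteComponent, Nat.add_sub_assoc hm]

theorem setH_subset_infiniteComponent [IsAlgClosed k] (hf : IsNewtonNondegenerate f)
    (hsing : 2 ≤ f.order) (hG : ∀ l, Irreducible (G l)) (hfG : f = ∏ l, G l) {m : ℕ}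
    {γ : Fin 2 → ℕ} (hγ : γ ∈ setB f m) (hγ' : γ ∉ setBstar f m) :
    ∃ (α : Fin 2 → ℕ) (l : ι), (∀ v, 1 ≤ α v) ∧ (minSet α (G l)).Nontrivial ∧ nu α f ≤ m ∧
      setH k m γ ⊆ infiniteComponent f (G l) m α := by
  have hf0 : f ≠ 0 := hf.1.ne_zero
  obtain ⟨n, α, -, hm, hα, -, rfl⟩ : ∃ (n : ℕ) (α : Fin 2 → ℕ), m = n + 1 ∧ m = nu α f ∧
      α ∈ setB f n ∧ castPlane α ∈ frontier (convexHull ℝ (tropicalVariety f)) ∧ γ = α + 1 := by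
    by_contra hn
    exact hγ' ⟨hγ, hn⟩
  have hα1 := hα.1.1
  obtain ⟨h1, h0⟩ := exists_axes_of_mem_setB hf0 hα1 hm hγ
  obtain ⟨l, hl⟩ := (minSet_nontrivial_iff_exists_factor hG hfG hα1).1
    (nontrivial_of_axes hsing h1 h0)
  obtain ⟨e, p, c, h⟩ := hf.exists_hasBranchForm hG hfG hα1 hl
  refine ⟨α, l, hα1, hl, hm.ge, ?_⟩
  have hle := nu_factor_le hG hfG hα1 l
  have hm0 : nu α (G l) + 0 ≤ m := by omega
  rw [infiniteComponent_eq _ hm.ge, ← hm, Nat.sub_self, h.closure_setF hm0, setH_eq_closure]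
  refine closure_minimal (Set.singleton_subset_iff.2 ?_) isClosed_closure
  rw [← PrimeSpectrum.le_iff_mem_closure]
  exact h.genericF_le_genericH_add_one hm0

/-- The index sets `A l` are left open between two bounds. This covers both `A_m(i)`, where factors
divisible by a variable are still listed, and the index set without repetition. -/
theorem jetFibre_eq_union [IsAlgClosed k] (hf : IsNewtonNondegenerate f) (hsing : 2 ≤ f.order)
    (hG : ∀ l, Irreducible (G l)) (hfG : f = ∏ l, G l) (m : ℕ) {A : ι → Set (Fin 2 → ℕ)}
    (hA : ∀ l, ∀ α ∈ A l, (∀ v, 1 ≤ α v) ∧ nu α f ≤ m)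
    (hA' : ∀ l α, (∀ v, 1 ≤ α v) → nu α f ≤ m → (minSet α (G l)).Nontrivial → α ∈ A l) :
    jetFibre f m = (⋃ γ ∈ setBstar f m, setH k m γ) ∪
      ⋃ l, ⋃ α ∈ A l, infiniteComponent f (G l) m α := by
  apply Set.Subset.antisymm
  · intro Q hQ
    have key : ∀ (α : Fin 2 → ℕ) (l : ι), (∀ v, 1 ≤ α v) → (minSet α (G l)).Nontrivial →
        nu α f ≤ m → Q ∈ infiniteComponent f (G l) m α →
        Q ∈ ⋃ l, ⋃ α ∈ A l, infiniteComponent f (G l) m α := fun α l h1 h2 h3 h4 =>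
      Set.mem_iUnion.2 ⟨l, Set.mem_iUnion₂.2 ⟨α, hA' l α h1 h3 h2, h4⟩⟩
    rcases exists_of_mem_jetFibre hf hG hfG hQ with ⟨γ, hγ, hQγ⟩ | ⟨α, l, h1, h2, h3, h4⟩
    · by_cases hs : γ ∈ setBstar f m
      · exact Or.inl (Set.mem_iUnion₂.2 ⟨γ, hs, hQγ⟩)
      · obtain ⟨α, l, h1, h2, h3, h4⟩ := setH_subset_infiniteComponent hf hsing hG hfG hγ hs
        exact Or.inr (key α l h1 h2 h3 (h4 hQγ))
    · refine Or.inr (key α l h1 h2 h3 ?_)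
      rw [infiniteComponent_eq _ h3]
      exact subset_closure h4
  · refine Set.union_subset (Set.iUnion₂_subset fun γ hγ => setH_subset_jetFibre hγ.1.1.1 hγ.1.1.2)
      (Set.iUnion_subset fun l => Set.iUnion₂_subset fun α hα => ?_)
    obtain ⟨h1, h2⟩ := hA l α hα
    rw [infiniteComponent_eq _ h2]
    exact closure_minimal (setF_subset_jetFibre hG hfG h1 h2 l) (isClosed_jetFibre f m)

theorem bijOn_componentsOf_jetFibre [IsAlgClosed k] (hf : IsNewtonNondegenerate f)
    (hsing : 2 ≤ f.order) (hG : ∀ l, Irreducible (G l)) (hfG : f = ∏ l, G l) (m : ℕ)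
    {I : Set (ι × (Fin 2 → ℕ))}
    (hI : ∀ q, q ∈ I ↔ (∀ v, 1 ≤ q.2 v) ∧ nu q.2 f ≤ m ∧ (minSet q.2 (G q.1)).Nontrivial) :
    Set.BijOn (Sum.elim (fun γ => setH k m γ) fun q : ι × (Fin 2 → ℕ) =>
        infiniteComponent f (G q.1) m q.2)
      (Sum.inl '' setBstar f m ∪ Sum.inr '' I) (componentsOf (jetFibre f m)) := by
  have hf0 : f ≠ 0 := hf.1.ne_zero
  have hbr : ∀ q ∈ I, nu q.2 (G q.1) ≤ nu q.2 f ∧ nu q.2 f ≤ m ∧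
      ∃ (hm : nu q.2 (G q.1) + (m - nu q.2 f) ≤ m) (e : Fin 2 → ℕ) (p : Fin 2 → k) (c : k)
        (h : HasBranchForm q.2 (G q.1) e p c),
        infiniteComponent f (G q.1) m q.2 = closure {h.genericF hm} := by
    intro q hq
    obtain ⟨h1, h2, h3⟩ := (hI q).1 hq
    have h4 := nu_factor_le hG hfG h1 q.1
    have hm : nu q.2 (G q.1) + (m - nu q.2 f) ≤ m := by omega
    obtain ⟨e, p, c, h⟩ := hf.exists_hasBranchForm hG hfG h1 h3
    exact ⟨h4, h2, hm, e, p, c, h, by rw [infiniteComponent_eq _ h2, h.closure_setF hm]⟩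
  have hcl : ∀ {P Q : JetSpace k m}, closure {P} ⊆ closure {Q} → Q ≤ P := fun h =>
    (PrimeSpectrum.le_iff_mem_closure _ _).2 (h (subset_closure rfl))
  refine bijOn_componentsOf (isClosed_jetFibre f m) ?_ ?_ ?_
  · rintro _ (⟨γ, -, rfl⟩ | ⟨q, hq, rfl⟩)
    · exact ⟨_, setH_eq_closure γ⟩
    · obtain ⟨-, -, hm, e, p, c, h, he⟩ := hbr q hq
      exact ⟨_, he⟩
  · rw [Set.biUnion_union, Set.biUnion_image, Set.biUnion_image,
      jetFibre_eq_union hf hsing hG hfG m (A := fun l => {α | (l, α) ∈ I})]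
    · congr 1
      ext Q
      simp only [Set.mem_iUnion, Set.mem_ofPred_eq, Sum.elim_inr, Prod.exists, exists_prop]
    · exact fun l α hα => ⟨((hI _).1 hα).1, ((hI _).1 hα).2.1⟩
    · exact fun l α h1 h2 h3 => (hI _).2 ⟨h1, h2, h3⟩
  -- Inclusions of closures are read as inequalities of generic points in reverse; the four cases
  -- are the pairs of types of sets.
  · rintro _ (⟨γ, hγ, rfl⟩ | ⟨q, hq, rfl⟩) _ (⟨γ', hγ', rfl⟩ | ⟨q', hq', rfl⟩) hsub
    · simp only [Sum.elim_inl, setH_eq_closure] at hsub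
      rw [eq_of_genericH_le hf0 hγ'.1 hγ.1 (hcl hsub)]
    · obtain ⟨h1, h2, hm, e, p, c, h, he⟩ := hbr q' hq'
      simp only [Sum.elim_inl, Sum.elim_inr, he, setH_eq_closure] at hsub
      exact (notMem_setBstar_of_genericF_le hsing hf0 (hG q'.1).ne_zero h h2 hm (hcl hsub)
        hγ).elim
    · obtain ⟨h1, h2, hm, e, p, c, h, he⟩ := hbr q hq
      simp only [Sum.elim_inl, Sum.elim_inr, he, setH_eq_closure] at hsub
      exact (h.not_genericH_le hf0 hγ'.1 hm h2 (hcl hsub)).elim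
    · obtain ⟨h1, h2, hm, e, p, c, h, he⟩ := hbr q hq
      obtain ⟨h1', h2', hm', e', p', c', h', he'⟩ := hbr q' hq'
      simp only [Sum.elim_inr, he, he'] at hsub
      obtain ⟨h3, h4⟩ := eq_of_genericF_le hf hsing hG hfG h h' h2 h2' hm hm' (hcl hsub)
      rw [Prod.ext h4.symm h3.symm]

end Components

end

end NewtonJets

/-! ### The theorem -/

open NewtonJets in
theorem mainTheorem1 {k : Type*} [Field k] [IsAlgClosed k]
    (f : MvPowerSeries (Fin 2) k)
    (hf : IsNewtonNondegenerate f)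
    (hsing : 2 ≤ f.order)
    {t : ℕ} (F : Fin t → MvPowerSeries (Fin 2) k)
    (hF : IsTropicalDecomposition f F)
    (r : Fin t → ℕ) (G : (i : Fin t) → Fin (r i) → MvPowerSeries (Fin 2) k)
    (hirr : ∀ i j, Irreducible (G i j))
    (hG : ∀ i, F i = ∏ j, G i j)
    (m : ℕ) :
    jetFibre f m =
        (⋃ γ ∈ setBstar f m, setH k m γ) ∪
          ⋃ i, ⋃ α ∈ setA f (F i) m, ⋃ j, infiniteComponent f (G i j) m α ∧
    Set.BijOn
      (Sum.elim (fun γ => setH k m γ)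
        (fun p : (Σ i : Fin t, Fin (r i)) × (Fin 2 → ℕ) =>
          infiniteComponent f (G p.1.1 p.1.2) m p.2))
      (Sum.inl '' setBstar f m ∪
        Sum.inr '' {p | p.2 ∈ setA f (F p.1.1) m ∧
          ∀ v, ¬ (MvPowerSeries.X v ∣ G p.1.1 p.1.2)})
      (componentsOf (jetFibre f m)) := by
  have hirr' : ∀ l : Σ i : Fin t, Fin (r i), Irreducible (G l.1 l.2) := fun l => hirr l.1 l.2
  have hfG : f = ∏ l : Σ i : Fin t, Fin (r i), G l.1 l.2 := by
    rw [Fintype.prod_sigma, hF.1]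
    exact Finset.prod_congr rfl fun i _ => hG i
  have hF0 : ∀ i, F i ≠ 0 := fun i => by
    rw [hG i]
    exact Finset.prod_ne_zero_iff.2 fun j _ => (hirr i j).ne_zero
  have htrop : ∀ i j α, (∀ v, 1 ≤ α v) → (minSet α (G i j)).Nontrivial →
      castPlane α ∈ tropicalVariety (F i) := by
    intro i j α hα hn
    rw [hG i, castPlane_mem_tropicalVariety_prod hα _ _ fun j _ => (hirr i j).ne_zero]
    exact ⟨j, Finset.mem_univ _, (castPlane_mem_tropicalVariety_iff hα (hirr i j).ne_zero).2 hn⟩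
  constructor
  · rw [jetFibre_eq_union hf hsing hirr' hfG m (A := fun l => setA f (F l.1) m)]
    · congr 1
      ext Q
      simp only [Set.mem_iUnion, Sigma.exists, exists_prop]
      constructor
      · rintro ⟨i, j, α, h1, h2⟩
        exact ⟨i, α, h1, j, h2⟩
      · rintro ⟨i, α, h1, j, h2⟩
        exact ⟨i, j, α, h1, h2⟩
    · exact fun l α hα => ⟨hα.1, hα.2.2⟩
    · exact fun l α h1 h2 h3 => ⟨h1, htrop _ _ _ h1 h3, h2⟩
  -- The index set matches: for a factor divisible by neither variable, `α ∈ T(F i)` makes `minSet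
  -- α` nontrivial; conversely, nontriviality gives a branch form, which excludes divisibility.
  · refine bijOn_componentsOf_jetFibre hf hsing hirr' hfG m fun q => ⟨?_, ?_⟩
    · rintro ⟨⟨h1, h2, h3⟩, h4⟩
      refine ⟨h1, h3, minSet_nontrivial_of_isSemiLine (hF0 q.1.1) ?_ (hF.2.1 _) ?_ h4 h1 h2⟩
      · rw [hG]
        exact Finset.dvd_prod_of_mem _ (Finset.mem_univ _)
      · have h5 := (hirr q.1.1 q.1.2).not_isUnit
        rwa [MvPowerSeries.isUnit_iff_constantCoeff, isUnit_iff_ne_zero, not_not] at h5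
    · rintro ⟨h1, h2, h3⟩
      obtain ⟨e, p, c, h⟩ := hf.exists_hasBranchForm hirr' hfG h1 h3
      exact ⟨⟨h1, htrop _ _ _ h1 h3, h2⟩, h.not_X_dvd⟩
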